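/- Let $\alpha\in(1,2)$ and let $(Z_t)_{t\ge 0}$ be the standard one-dimensional symmetric $\alpha$-stable Lévy process, $\mathbb E[e^{iuZ_t}]=e^{-t|u|^\alpha}$. For $x\in\mathbb R$ let $(X_t^x)_{t\ge0}$ be the stable Ornstein–Uhlenbeck process $$\mathrm dX_t=-X_t\,\mathrm dt+\mathrm dZ_t,\qquad X_0=x,$$ and let $\nu$ be its invariant probability measure. Let $(\gamma_n)_{n\ge1}$ be a decreasing sequence of positive numbers with $\lim_{n\to\infty}\gamma_n=0$ and $\sum_{n\ge1}\gamma_n=\infty$, and put $t_n=\sum_{i=1}^n\gamma_i$. Put $\theta=\frac{2-\alpha}{\alpha}$ and assume that $$\omega:=\limsup_{k\to\infty}\frac{\gamma_k^{\theta}-\gamma_{k+1}^{\theta}}{\gamma_{k+1}^{1+\theta}}<\min(\rho,1),\qquad \rho=\tfrac12e^{-2}.$$ Let $\tilde Z_1,\tilde Z_2,\dots$ be i.i.d. real random variables with density $p(z)=\frac{\alpha}{2|z|^{\alpha+1}}\mathbf 1_{\{|z|>1\}}$, and let $$\beta=\Big(\frac{\alpha}{2d_\alpha}\Big)^{1/\alpha},\qquad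 d_\alpha=\frac{\alpha\,2^{\alpha-1}\,\Gamma(\frac{1+\alpha}{2})}{\sqrt{\pi}\,\Gamma(1-\frac\alpha2)}.$$ Define $\tilde Y_{t_0}^x=x$ and $$\tilde Y_{t_{n+1}}^x=\tilde Y_{t_n}^x-\gamma_{n+1}\tilde Y_{t_n}^x+\frac{\gamma_{n+1}^{1/\alpha}}{\beta}\,\tilde Z_{n+1},\qquad n\ge0 .$$ Let $W_1(\mu_1,\mu_2)=\inf_{\Pi}\int|y-z|\,\Pi(\mathrm dy,\mathrm dz)$, the infimum being over all couplings $\Pi$ of $\mu_1$ and $\mu_2$, and let $\mathcal L(\cdot)$ denote the law of a random variable. Then for every $x\in\mathbb R$, $$0<\liminf_{n\to\infty}\frac{W_1\big(\nu,\mathcal L(\tilde Y^x_{t_n})\big)}{\gamma_n^{\frac2\alpha-1}}\le\limsup_{n\to\infty}\frac{W_1\big(\nu,\mathcal L(\tilde Y^x_{t_n})\big)}{\gamma_n^{\frac2\alpha-1}}<\infty .$$ That is, the rate $\gamma_n^{(2-\alpha)/\alpha}$ is sharp. -/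

import Mathlib

open MeasureTheory ProbabilityTheory Filter Topology
open scoped ENNReal NNReal

/-- Couplings of two measures on the real line. -/
def couplings (μ ν : Measure ℝ) : Set (Measure (ℝ × ℝ)) :=
  {π | π.map Prod.fst = μ ∧ π.map Prod.snd = ν}

/-- The `L¹`-Wasserstein distance `W₁(μ, ν) = inf_π ∫ |x - y| π(dx, dy)`, with values in `[0, ∞]`. -/
noncomputable def wassersteinOne (μ ν : Measure ℝ) : ℝ≥0∞ :=
  ⨅ π ∈ couplings μ ν, ∫⁻ z, ENNReal.ofReal |z.1 - z.2| ∂π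

/-- Paths that are right-continuous with left limits on `[0, ∞)`. -/
def IsCadlagPath (f : ℝ≥0 → ℝ) : Prop :=
  ∀ t, ContinuousWithinAt f (Set.Ici t) t ∧ ∃ l, Tendsto f (𝓝[<] t) (𝓝 l)

/-- `Z` is a standard one-dimensional symmetric `α`-stable Lévy process under `P`:
`E exp (i u Z_t) = exp (-t |u| ^ α)`. -/
structure IsSymmetricStableProcess {Ω : Type*} [MeasurableSpace Ω] (α : ℝ)
    (Z : ℝ≥0 → Ω → ℝ) (P : Measure Ω) : Prop where
  aemeasurable : ∀ t, AEMeasurable (Z t) P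
  zero : ∀ᵐ ω ∂P, Z 0 ω = 0
  indep_increments : HasIndepIncrements Z P
  charFun_increment : ∀ s t : ℝ≥0, s ≤ t → ∀ u : ℝ,
    charFun (P.map (fun ω => Z t ω - Z s ω)) u
      = ((Real.exp (-((t : ℝ) - (s : ℝ)) * |u| ^ α) : ℝ) : ℂ)
  cadlag : ∀ᵐ ω ∂P, IsCadlagPath (fun t => Z t ω)

/-- `X` solves `dX_t = -X_t dt + dZ_t`, `X_0 = x`, that is,
almost surely `X_t = x - ∫₀ᵗ X_s ds + Z_t` for all `t ≥ 0`. -/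
structure IsOUSolution {Ω : Type*} [MeasurableSpace Ω] (Z : ℝ≥0 → Ω → ℝ) (P : Measure Ω)
    (x : ℝ) (X : ℝ≥0 → Ω → ℝ) : Prop where
  aemeasurable : ∀ t, AEMeasurable (X t) P
  equation : ∀ᵐ ω ∂P, ∀ t : ℝ≥0,
    IntervalIntegrable (fun s : ℝ => X s.toNNReal ω) volume 0 t ∧
    X t ω = x - (∫ s in (0 : ℝ)..t, X s.toNNReal ω) + Z t ω

/-- `ν` is an invariant probability measure of the Markov family `x ↦ X^x`:
`∫ P(X_t^x ∈ A) ν(dx) = ν(A)` for all `t ≥ 0` and all Borel sets `A`. -/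
structure IsInvariantLaw {Ω : Type*} [MeasurableSpace Ω] (P : Measure Ω)
    (X : ℝ → ℝ≥0 → Ω → ℝ) (ν : Measure ℝ) : Prop where
  isProbabilityMeasure : IsProbabilityMeasure ν
  invariant : ∀ (t : ℝ≥0) (A : Set ℝ), MeasurableSet A →
    ∫⁻ x, (P.map (X x t)) A ∂ν = ν A

/-- The constant `d_α` of the Lévy measure `d_α |z|^{-1-α} dz` of the standard symmetric
`α`-stable process in dimension one. -/
noncomputable def stableConst (α : ℝ) : ℝ :=
  α * 2 ^ (α - 1) * Real.pi ^ (-(1 / 2) : ℝ) * Real.Gamma ((1 + α) / 2) / Real.Gamma (1 - α / 2)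

/-- `β = (α / (2 d_α))^{1/α}`. -/
noncomputable def paretoScale (α : ℝ) : ℝ := (α / (2 * stableConst α)) ^ (1 / α)

/-- The density `p(z) = α / (2 |z|^{α+1})` on `|z| > 1`, and `0` elsewhere. -/
noncomputable def symmParetoDensity (α z : ℝ) : ℝ :=
  if 1 < |z| then α / (2 * |z| ^ (α + 1)) else 0

/-- The symmetric Pareto law on the real line. -/
noncomputable def symmParetoLaw (α : ℝ) : Measure ℝ :=
  volume.withDensity (fun z => ENNReal.ofReal (symmParetoDensity α z))

/-- The Euler scheme with Pareto innovations `ξ 1, ξ 2, …` and steps `γ 1, γ 2, …` for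
`dX = -X dt + dZ`; the values `γ 0` and `ξ 0` are not used. -/
noncomputable def paretoEuler {Ω : Type*} (α : ℝ) (γ : ℕ → ℝ) (ξ : ℕ → Ω → ℝ) (x : ℝ) :
    ℕ → Ω → ℝ
  | 0 => fun _ => x
  | n + 1 => fun ω =>
      paretoEuler α γ ξ x n ω - γ (n + 1) * paretoEuler α γ ξ x n ω
        + γ (n + 1) ^ (1 / α) / paretoScale α * ξ (n + 1) ω

/-- `limsup_k (γ_k^θ - γ_{k+1}^θ) / γ_{k+1}^{1+θ}`, as an extended real number. -/
noncomputable def stepOmega (γ : ℕ → ℝ) (θ : ℝ) : EReal :=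
  limsup (fun k : ℕ =>
    (((γ k ^ θ - γ (k + 1) ^ θ) / γ (k + 1) ^ (1 + θ) : ℝ) : EReal)) atTop

/-- The assumption on the step sizes `γ_1, γ_2, …` with exponent `θ`. -/
structure StepAssumption (γ : ℕ → ℝ) (θ : ℝ) : Prop where
  theta_pos : 0 < θ
  theta_le_one : θ ≤ 1
  pos : ∀ n, 1 ≤ n → 0 < γ n
  decreasing : ∀ n, 1 ≤ n → γ (n + 1) ≤ γ n
  tendsto_zero : Tendsto γ atTop (𝓝 0)
  sum_eq_infty : Tendsto (fun n : ℕ => ∑ i ∈ Finset.Icc 1 n, γ i) atTop atTop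
  omega_lt_top : stepOmega γ θ < ⊤

/-- The constant `ρ = d^{2α-4} 2^{-d} exp (-2^d d^{4-2α})` in dimension `d`. -/
noncomputable def rhoConst (d : ℕ) (α : ℝ) : ℝ :=
  (d : ℝ) ^ (2 * α - 4) * 2 ^ (-(d : ℝ)) * Real.exp (-(2 ^ (d : ℝ) * (d : ℝ) ^ (4 - 2 * α)))

/-!
Every object in the problem is linear, so the whole comparison takes place between laws on the real
line. Write `θ = 2 / α - 1`, let `S` be the law of `Z 1`, with characteristic function
`exp (-|u| ^ α)`, and `ρ = unitPareto α` the law of a Pareto innovation divided by `β`.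

*Invariant law.* Integrating the equation against `exp` gives
`X_t = exp (-t) x + Z_t - ∫₀ᵗ exp (s - t) Z_s ds`, which is the limit of the sums
`stieltjesSum` of independent stable increments. Hence `charFun ν u = exp (-|u| ^ α / α)`
(`charFun_invariantLaw`): `ν` is the law at time `1 / α` of the stable process.

*Upper bound.* By Kantorovich duality (only the half `wassersteinOne_le_of_forall_lipschitz` of it is
needed, which on the line follows from the quantile coupling), it suffices to compare the integrals
of a bounded `1`-Lipschitz function. The Pareto innovations are exchanged one by one for stable ones
(`IsEulerLaw.exists_abs_integral_sub_le`). The exchange at the step `k` takes place under a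
convolution with a stable law at time `noiseTime α γ k n`, which turns the test function into one with
a bounded second derivative (`shiftLip_stable`, `ShiftLip.secondDiffLe`), and on such functions `ρ`
and `S` are at finite distance (`exists_zetaTwoLe_stable`). Both facts are proved by writing `S` as
the limit of normalised sums of `2 ^ j` independent copies of `ρ`: the smoothing is inherited from the
large jumps, and the distances between consecutive sums form a geometric series of ratio
`2 ^ (1 - 2 / α) < 1`. With stable innovations only, the law of the scheme is stable up to the
contracted starting point, and its time `noiseTime α γ N n` is within `O(γ n ^ θ)` of `1 / α`. The
hypothesis on the steps enters as `γ k ^ θ * decay γ k n ≤ γ n ^ θ`, where `decay γ k n` is the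
product of the factors `1 - γ j` (`SlowSteps.rpow_mul_decay_le`), and the errors add up to a Riemann
sum of `∫ (1 - p) ^ (-1 / α) dp` (`SlowSteps.sum_mul_decay_mul_rpow_le`).

*Lower bound.* A coupling bounds the difference of the characteristic functions at `1` by `W₁`
(`enorm_charFun_sub_le_wassersteinOne`). Near the origin the characteristic function of `ρ` exceeds
the stable one by a factor `exp (c t ^ 2)` (`exists_exp_le_norm_charFun_unitPareto`). These factors
multiply up to `exp (c Σ γ k ^ (2 / α) * decay γ k n ^ 2)`, where the sum is at least of order
`γ n ^ θ`, whereas the discretisation of the drift costs only `O(γ N ^ (1 - θ)) γ n ^ θ`. As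
`θ < 1`, the gain prevails once `N` is large (`IsEulerLaw.exists_le_norm_charFun_sub`).
-/

/-! ### Transport on the real line -/

/-- The quantile function of a law on the line (the generalised inverse of its distribution
function); it is only meaningful on `(0, 1)`. -/
noncomputable def quantile (μ : Measure ℝ) (u : ℝ) : ℝ := sInf {x | u ≤ cdf μ x}

lemma quantile_le_iff (μ : Measure ℝ) {u : ℝ} (hu : u ∈ Set.Ioo (0 : ℝ) 1) (x : ℝ) :
    quantile μ u ≤ x ↔ u ≤ cdf μ x := by
  have hne : {x | u ≤ cdf μ x}.Nonempty := by
    obtain ⟨y, hy⟩ := ((tendsto_cdf_atTop μ).eventually (lt_mem_nhds hu.2)).exists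
    exact ⟨y, hy.le⟩
  have hbdd : BddBelow {x | u ≤ cdf μ x} := by
    obtain ⟨y, hy⟩ := ((tendsto_cdf_atBot μ).eventually (gt_mem_nhds hu.1)).exists
    refine ⟨y, fun z hz => ?_⟩
    by_contra! h
    exact absurd (hz.trans ((monotone_cdf μ) h.le)) (not_le.mpr hy)
  refine ⟨fun h => ?_, fun h => csInf_le hbdd h⟩
  have hmem : u ≤ cdf μ (quantile μ u) := by
    have hc : Tendsto (cdf μ) (𝓝[>] (quantile μ u)) (𝓝 (cdf μ (quantile μ u))) :=
      ((cdf μ).right_continuous (quantile μ u)).mono_left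
        (nhdsWithin_mono _ Set.Ioi_subset_Ici_self)
    refine ge_of_tendsto hc ?_
    filter_upwards [self_mem_nhdsWithin] with z hz
    obtain ⟨w, hw, hwz⟩ := exists_lt_of_csInf_lt hne hz
    exact le_trans hw (monotone_cdf μ hwz.le)
  exact hmem.trans (monotone_cdf μ h)

lemma aemeasurable_quantile (μ : Measure ℝ) :
    AEMeasurable (quantile μ) (volume.restrict (Set.Ioo (0 : ℝ) 1)) := by
  refine aemeasurable_restrict_of_monotoneOn measurableSet_Ioo fun u hu v hv huv => ?_
  exact (quantile_le_iff μ hu _).2 (huv.trans ((quantile_le_iff μ hv _).1 le_rfl))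

/-- The quantile function transports the uniform law on `(0, 1)` to `μ`. -/
lemma map_quantile (μ : Measure ℝ) [IsProbabilityMeasure μ] :
    (volume.restrict (Set.Ioo (0 : ℝ) 1)).map (quantile μ) = μ := by
  have : IsFiniteMeasure ((volume.restrict (Set.Ioo (0 : ℝ) 1)).map (quantile μ)) := by
    infer_instance
  refine Measure.ext_of_Iic _ _ fun x => ?_
  rw [Measure.map_apply_of_aemeasurable (aemeasurable_quantile μ) measurableSet_Iic,
    ← ofReal_cdf, Measure.restrict_apply' measurableSet_Ioo]
  have h1 : quantile μ ⁻¹' Set.Iic x ∩ Set.Ioo 0 1 ⊆ Set.Ioc 0 (cdf μ x) := fun u hu =>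
    ⟨hu.2.1, (quantile_le_iff μ hu.2 x).1 hu.1⟩
  have h2 : Set.Ioo 0 (cdf μ x) ⊆ quantile μ ⁻¹' Set.Iic x ∩ Set.Ioo 0 1 := fun u hu => by
    have hu' : u ∈ Set.Ioo (0 : ℝ) 1 := ⟨hu.1, hu.2.trans_le (cdf_le_one μ x)⟩
    exact ⟨(quantile_le_iff μ hu' x).2 hu.2.le, hu'⟩
  refine le_antisymm ((measure_mono h1).trans ?_) (le_trans ?_ (measure_mono h2)) <;> simp

lemma ofReal_abs_sub_eq_lintegral (a b : ℝ) :
    ENNReal.ofReal |a - b| = ∫⁻ x, Set.indicator {x | ¬ (a ≤ x ↔ b ≤ x)} 1 x := by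
  have hS : {x : ℝ | ¬ (a ≤ x ↔ b ≤ x)} = Set.Ico (min a b) (max a b) := by
    ext x
    simp only [Set.mem_ofPred_eq, Set.mem_Ico, min_le_iff, lt_max_iff]
    constructor
    · intro h
      by_cases ha : a ≤ x <;> by_cases hb : b ≤ x <;> simp_all
    · rintro ⟨h1, h2⟩ h
      rcases h1 with h1 | h1 <;> rcases h2 with h2 | h2 <;> grind
  rw [hS, lintegral_indicator_one measurableSet_Ico, Real.volume_Ico, max_sub_min_eq_abs']

/-- The quantile coupling bounds the Wasserstein distance by the `L¹`-distance of the distribution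
functions. -/
lemma wassersteinOne_le_lintegral_cdf (μ ν : Measure ℝ) [IsProbabilityMeasure μ]
    [IsProbabilityMeasure ν] :
    wassersteinOne μ ν ≤ ∫⁻ x, ENNReal.ofReal |cdf μ x - cdf ν x| := by
  set U : Measure ℝ := volume.restrict (Set.Ioo (0 : ℝ) 1) with hU
  have hm : AEMeasurable (fun u => (quantile μ u, quantile ν u)) U :=
    (aemeasurable_quantile μ).prodMk (aemeasurable_quantile ν)
  have hπ : U.map (fun u => (quantile μ u, quantile ν u)) ∈ couplings μ ν := by
    refine ⟨?_, ?_⟩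
    · rw [AEMeasurable.map_map_of_aemeasurable measurable_fst.aemeasurable hm]
      exact map_quantile μ
    · rw [AEMeasurable.map_map_of_aemeasurable measurable_snd.aemeasurable hm]
      exact map_quantile ν
  have hFm : Measurable (cdf μ) := (monotone_cdf μ).measurable
  have hGm : Measurable (cdf ν) := (monotone_cdf ν).measurable
  have hE : MeasurableSet {q : ℝ × ℝ | ¬ (q.1 ≤ cdf μ q.2 ↔ q.1 ≤ cdf ν q.2)} := by
    have h1 : MeasurableSet {q : ℝ × ℝ | q.1 ≤ cdf μ q.2} :=
      measurableSet_le measurable_fst (hFm.comp measurable_snd)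
    have h2 : MeasurableSet {q : ℝ × ℝ | q.1 ≤ cdf ν q.2} :=
      measurableSet_le measurable_fst (hGm.comp measurable_snd)
    exact (MeasurableSet.iff h1 h2).compl
  calc wassersteinOne μ ν
      ≤ ∫⁻ z, ENNReal.ofReal |z.1 - z.2| ∂(U.map (fun u => (quantile μ u, quantile ν u))) :=
        iInf₂_le _ hπ
    _ = ∫⁻ u, ENNReal.ofReal |quantile μ u - quantile ν u| ∂U := by
        rw [lintegral_map' (by fun_prop) hm]
    _ = ∫⁻ u, (∫⁻ x, Set.indicator {q : ℝ × ℝ | ¬ (q.1 ≤ cdf μ q.2 ↔ q.1 ≤ cdf ν q.2)} 1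
          (u, x)) ∂U := by
        refine setLIntegral_congr_fun measurableSet_Ioo fun u hu => ?_
        simp only [ofReal_abs_sub_eq_lintegral, Set.indicator_apply, Set.mem_ofPred_eq,
          quantile_le_iff _ hu, Pi.one_apply]
    _ = ∫⁻ x, ∫⁻ u, Set.indicator {q : ℝ × ℝ | ¬ (q.1 ≤ cdf μ q.2 ↔ q.1 ≤ cdf ν q.2)} 1
          (u, x) ∂U := by
        refine lintegral_lintegral_swap (f := fun u x =>
          Set.indicator {q : ℝ × ℝ | ¬ (q.1 ≤ cdf μ q.2 ↔ q.1 ≤ cdf ν q.2)} 1 (u, x)) ?_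
        exact (measurable_one.indicator hE).aemeasurable
    _ ≤ ∫⁻ x, ENNReal.ofReal |cdf μ x - cdf ν x| := by
        refine lintegral_mono fun x => ?_
        have hsub : {u : ℝ | ¬ (u ≤ cdf μ x ↔ u ≤ cdf ν x)}
            ⊆ Set.Ioc (min (cdf μ x) (cdf ν x)) (max (cdf μ x) (cdf ν x)) := fun u hu => by
          simp only [Set.mem_ofPred_eq] at hu
          simp only [Set.mem_Ioc, min_lt_iff, le_max_iff]
          grind
        have hms : MeasurableSet {u : ℝ | ¬ (u ≤ cdf μ x ↔ u ≤ cdf ν x)} :=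
          (MeasurableSet.iff (measurableSet_Iic (a := cdf μ x))
            (measurableSet_Iic (a := cdf ν x))).compl
        calc ∫⁻ u, Set.indicator {q : ℝ × ℝ | ¬ (q.1 ≤ cdf μ q.2 ↔ q.1 ≤ cdf ν q.2)} 1 (u, x) ∂U
            = ∫⁻ u, Set.indicator {u : ℝ | ¬ (u ≤ cdf μ x ↔ u ≤ cdf ν x)} 1 u ∂U := rfl
          _ = U {u : ℝ | ¬ (u ≤ cdf μ x ↔ u ≤ cdf ν x)} := lintegral_indicator_one hms
          _ ≤ volume {u : ℝ | ¬ (u ≤ cdf μ x ↔ u ≤ cdf ν x)} := Measure.restrict_apply_le _ _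
          _ ≤ _ := measure_mono hsub
          _ = _ := by rw [Real.volume_Ioc, max_sub_min_eq_abs']

/-- An integration by parts: the function `x ↦ -∫_{-R}^R s(y) 1{x ≤ y} dy` integrates a law to
minus the integral of its distribution function against `s`. -/
lemma integral_neg_integral_indicator (μ : Measure ℝ) [IsProbabilityMeasure μ] {s : ℝ → ℝ}
    (hs : Measurable s) (hs1 : ∀ y, |s y| ≤ 1) (R : ℝ) :
    ∫ x, (-∫ y in Set.Icc (-R) R, s y * (Set.Ici x).indicator (1 : ℝ → ℝ) y) ∂μ
      = -∫ y in Set.Icc (-R) R, s y * cdf μ y := by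
  rw [integral_neg, integral_integral_swap]
  · congr 1
    refine integral_congr_ae (Eventually.of_forall fun y => ?_)
    have : (fun x : ℝ => s y * (Set.Ici x).indicator (1 : ℝ → ℝ) y)
        = fun x => s y * (Set.Iic y).indicator 1 x := by
      ext x; simp [Set.indicator_apply]
    simp only [this]
    rw [integral_const_mul, integral_indicator_one measurableSet_Iic, cdf_eq_real]
  · have hm : Measurable (fun q : ℝ × ℝ => s q.2 * (Set.Ici q.1).indicator (1 : ℝ → ℝ) q.2) := by
      have : (fun q : ℝ × ℝ => s q.2 * (Set.Ici q.1).indicator (1 : ℝ → ℝ) q.2)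
          = fun q => s q.2 * {q : ℝ × ℝ | q.1 ≤ q.2}.indicator 1 q := by
        ext q; simp [Set.indicator_apply]
      rw [this]
      exact (hs.comp measurable_snd).mul
        (measurable_one.indicator (measurableSet_le measurable_fst measurable_snd))
    refine Integrable.of_bound (C := 1) hm.aestronglyMeasurable (Eventually.of_forall fun q => ?_)
    simp only [Function.uncurry, Set.indicator_apply]
    split_ifs <;> simp [hs1]

/-- One half of Kantorovich duality on the line, in the form needed for upper bounds: bounded
`1`-Lipschitz test functions suffice to bound the Wasserstein distance. The extremal test function
has derivative the sign of the difference of the distribution functions. -/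
theorem wassersteinOne_le_of_forall_lipschitz (μ ν : Measure ℝ) [IsProbabilityMeasure μ]
    [IsProbabilityMeasure ν] {D : ℝ}
    (h : ∀ f : ℝ → ℝ, LipschitzWith 1 f → (∃ B, ∀ x, |f x| ≤ B) → ∫ x, f x ∂μ - ∫ x, f x ∂ν ≤ D) :
    wassersteinOne μ ν ≤ ENNReal.ofReal D := by
  refine (wassersteinOne_le_lintegral_cdf μ ν).trans ?_
  have hFm : Measurable (cdf μ) := (monotone_cdf μ).measurable
  have hGm : Measurable (cdf ν) := (monotone_cdf ν).measurable
  have key : ∀ R : ℝ, ∫⁻ x in Set.Icc (-R) R, ENNReal.ofReal |cdf μ x - cdf ν x|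
      ≤ ENNReal.ofReal D := by
    intro R
    let s : ℝ → ℝ := fun y => if cdf μ y ≤ cdf ν y then 1 else -1
    have hs : Measurable s :=
      Measurable.ite (measurableSet_le hFm hGm) measurable_const measurable_const
    have hs1 : ∀ y, |s y| ≤ 1 := fun y => by simp only [s]; split_ifs <;> simp
    let f : ℝ → ℝ := fun x => -∫ y in Set.Icc (-R) R, s y * (Set.Ici x).indicator (1 : ℝ → ℝ) y
    have hint : ∀ x, IntegrableOn (fun y => s y * (Set.Ici x).indicator (1 : ℝ → ℝ) y)
        (Set.Icc (-R) R) := fun x => by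
      refine Integrable.of_bound (C := 1)
        (hs.mul (measurable_one.indicator measurableSet_Ici)).aestronglyMeasurable
        (Eventually.of_forall fun y => ?_)
      simp only [Set.indicator_apply]
      split_ifs <;> simp [hs1]
    have hlip' : ∀ x x', x ≤ x' → |f x - f x'| ≤ x' - x := by
      intro x x' hxx
      have : f x - f x' = -∫ y in Set.Icc (-R) R, s y * (Set.Ico x x').indicator (1 : ℝ → ℝ) y := by
        simp only [f]
        rw [neg_sub_neg, ← neg_sub, ← integral_sub (hint x) (hint x')]
        congr 1
        refine integral_congr_ae (Eventually.of_forall fun y => ?_)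
        simp only [Set.indicator_apply, Set.mem_Ici, Set.mem_Ico, Pi.one_apply]
        grind
      rw [this, abs_neg]
      calc |∫ y in Set.Icc (-R) R, s y * (Set.Ico x x').indicator (1 : ℝ → ℝ) y|
          ≤ ∫ y in Set.Icc (-R) R, (Set.Ico x x').indicator (1 : ℝ → ℝ) y := by
            refine norm_integral_le_of_norm_le
              (f := fun y => s y * (Set.Ico x x').indicator (1 : ℝ → ℝ) y)
              ?_ (Eventually.of_forall fun y => ?_)
            · exact (integrable_const (1 : ℝ)).indicator measurableSet_Ico
            · simp only [Set.indicator_apply]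
              split_ifs <;> simp [hs1]
        _ = (volume.restrict (Set.Icc (-R) R)).real (Set.Ico x x') :=
            integral_indicator_one measurableSet_Ico
        _ ≤ volume.real (Set.Ico x x') :=
            ENNReal.toReal_mono (by simp) (Measure.restrict_le_self _)
        _ = x' - x := by simp [measureReal_def, hxx]
    have hlip : LipschitzWith 1 f := by
      refine LipschitzWith.of_dist_le_mul fun x x' => ?_
      rw [Real.dist_eq, Real.dist_eq, NNReal.coe_one, one_mul]
      rcases le_total x x' with hxx | hxx
      · rw [abs_sub_comm x x', abs_of_nonneg (sub_nonneg.2 hxx)]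
        exact hlip' x x' hxx
      · rw [abs_sub_comm (f x), abs_of_nonneg (sub_nonneg.2 hxx)]
        exact hlip' x' x hxx
    have hbdd : ∃ B, ∀ x, |f x| ≤ B := by
      refine ⟨1 * volume.real (Set.Icc (-R) R), fun x => ?_⟩
      simp only [f, abs_neg]
      have hR : volume (Set.Icc (-R) R) < ⊤ := measure_Icc_lt_top
      refine norm_setIntegral_le_of_norm_le_const
        (f := fun y => s y * (Set.Ici x).indicator (1 : ℝ → ℝ) y) hR fun y _ => ?_
      simp only [Set.indicator_apply]
      split_ifs <;> simp [hs1]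
    have hD := h f hlip hbdd
    simp only [f] at hD
    rw [integral_neg_integral_indicator μ hs hs1, integral_neg_integral_indicator ν hs hs1,
      neg_sub_neg, ← integral_sub] at hD
    · have habs : ∀ y, s y * cdf ν y - s y * cdf μ y = |cdf μ y - cdf ν y| := fun y => by
        simp only [s]
        split_ifs with hy
        · rw [abs_of_nonpos (by linarith)]; ring
        · rw [abs_of_nonneg (by linarith)]; ring
      simp only [habs] at hD
      rw [← ofReal_integral_eq_lintegral_ofReal]
      · exact ENNReal.ofReal_le_ofReal hD
      · refine Integrable.of_bound (C := 1) (hFm.sub hGm).abs.aestronglyMeasurable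
          (Eventually.of_forall fun y => ?_)
        rw [Real.norm_eq_abs, abs_abs, abs_le]
        constructor <;> linarith [cdf_nonneg μ y, cdf_le_one μ y, cdf_nonneg ν y, cdf_le_one ν y]
      · exact Eventually.of_forall fun _ => abs_nonneg _
    all_goals
      refine Integrable.of_bound (C := 1) (hs.mul (by assumption)).aestronglyMeasurable
        (Eventually.of_forall fun y => ?_)
      rw [norm_mul, Real.norm_eq_abs, Real.norm_eq_abs]
    · rw [abs_of_nonneg (cdf_nonneg ν y)]
      exact mul_le_one₀ (hs1 y) (cdf_nonneg ν y) (cdf_le_one ν y)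
    · rw [abs_of_nonneg (cdf_nonneg μ y)]
      exact mul_le_one₀ (hs1 y) (cdf_nonneg μ y) (cdf_le_one μ y)
  have hU : (⋃ n : ℕ, Set.Icc (-(n : ℝ)) n) = Set.univ := by
    refine Set.eq_univ_of_forall fun x => Set.mem_iUnion.2 ?_
    obtain ⟨n, hn⟩ := exists_nat_ge |x|
    exact ⟨n, abs_le.1 hn⟩
  rw [← setLIntegral_univ, ← hU, setLIntegral_iUnion_of_directed]
  · exact iSup_le fun n => key n
  · refine (Monotone.directed_le fun m n hmn => ?_)
    have : (m : ℝ) ≤ n := by exact_mod_cast hmn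
    exact Set.Icc_subset_Icc (by linarith) this

/-- Characteristic functions are Lipschitz functionals of the law for the Wasserstein distance. -/
theorem enorm_charFun_sub_le_wassersteinOne (μ ν : Measure ℝ) [IsProbabilityMeasure μ]
    [IsProbabilityMeasure ν] (u : ℝ) :
    ‖charFun μ u - charFun ν u‖ₑ ≤ ENNReal.ofReal |u| * wassersteinOne μ ν := by
  have key : ∀ π ∈ couplings μ ν, ‖charFun μ u - charFun ν u‖ₑ
      ≤ ENNReal.ofReal |u| * ∫⁻ z, ENNReal.ofReal |z.1 - z.2| ∂π := by
    rintro π ⟨h1, h2⟩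
    have hπ : IsProbabilityMeasure π := by
      refine ⟨?_⟩
      have := congrArg (fun m => m Set.univ) h1
      simpa [Measure.map_apply measurable_fst MeasurableSet.univ] using this
    have hi : ∀ g : ℝ × ℝ → ℝ, Measurable g →
        Integrable (fun z => Complex.exp (u * g z * Complex.I)) π := fun g hg => by
      refine Integrable.of_bound (C := 1) (by fun_prop) (Eventually.of_forall fun z => ?_)
      rw [← Complex.ofReal_mul, Complex.norm_exp_ofReal_mul_I]
    rw [← h1, ← h2, charFun_apply_real, charFun_apply_real,
      integral_map measurable_fst.aemeasurable (by fun_prop),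
      integral_map measurable_snd.aemeasurable (by fun_prop),
      ← integral_sub (hi _ measurable_fst) (hi _ measurable_snd)]
    refine (enorm_integral_le_lintegral_enorm _).trans ?_
    rw [← lintegral_const_mul _ (by fun_prop)]
    refine lintegral_mono fun z => ?_
    rw [← ofReal_norm, ← ENNReal.ofReal_mul (abs_nonneg _)]
    refine ENNReal.ofReal_le_ofReal ?_
    have : Complex.exp (u * z.1 * Complex.I) - Complex.exp (u * z.2 * Complex.I)
        = Complex.exp (u * z.2 * Complex.I)
          * (Complex.exp (Complex.I * ((u * (z.1 - z.2) : ℝ) : ℂ)) - 1) := by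
      rw [mul_sub, ← Complex.exp_add, mul_one]
      congr 2
      push_cast; ring
    rw [this, norm_mul, ← Complex.ofReal_mul, Complex.norm_exp_ofReal_mul_I, one_mul, ← abs_mul]
    exact Real.norm_exp_I_mul_ofReal_sub_one_le
  rcases eq_or_ne u 0 with rfl | hu
  · simp
  · have hu' : ENNReal.ofReal |u| ≠ 0 := by simpa using hu
    rw [mul_comm, ← ENNReal.div_le_iff_le_mul (Or.inl hu') (Or.inl ENNReal.ofReal_ne_top)]
    refine le_iInf₂ fun π hπ => ?_
    rw [ENNReal.div_le_iff_le_mul (Or.inl hu') (Or.inl ENNReal.ofReal_ne_top), mul_comm]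
    exact key π hπ

/-! ### The symmetric Pareto law -/

lemma symmParetoDensity_neg (α z : ℝ) : symmParetoDensity α (-z) = symmParetoDensity α z := by
  simp [symmParetoDensity]

lemma symmParetoDensity_nonneg {α : ℝ} (hα : 0 < α) (z : ℝ) : 0 ≤ symmParetoDensity α z := by
  unfold symmParetoDensity
  split_ifs <;> positivity

lemma measurable_symmParetoDensity (α : ℝ) : Measurable (symmParetoDensity α) := by
  unfold symmParetoDensity
  exact Measurable.ite (measurableSet_lt measurable_const (by fun_prop)) (by fun_prop)
    measurable_const

lemma symmParetoDensity_of_pos {α z : ℝ} (hz : 0 < z) :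
    symmParetoDensity α z = (Set.Ioi 1).indicator (fun y => α / 2 * y ^ (-α - 1)) z := by
  simp only [symmParetoDensity, Set.indicator_apply, Set.mem_Ioi, abs_of_pos hz]
  split_ifs
  · rw [show -α - 1 = -(α + 1) by ring, Real.rpow_neg hz.le]
    field_simp
  · rfl

lemma integral_symmParetoLaw_eq {E : Type*} [NormedAddCommGroup E] [NormedSpace ℝ E] {α : ℝ}
    (hα : 0 < α) (h : ℝ → E) :
    ∫ z, h z ∂(symmParetoLaw α) = ∫ z, symmParetoDensity α z • h z := by
  unfold symmParetoLaw
  rw [integral_withDensity_eq_integral_toReal_smul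
    (measurable_symmParetoDensity α).ennreal_ofReal (by simp)]
  simp [symmParetoDensity_nonneg hα]

lemma integrable_symmParetoLaw_iff {E : Type*} [NormedAddCommGroup E] [NormedSpace ℝ E] {α : ℝ}
    (hα : 0 < α) (h : ℝ → E) :
    Integrable h (symmParetoLaw α) ↔ Integrable (fun z => symmParetoDensity α z • h z) := by
  unfold symmParetoLaw
  rw [integrable_withDensity_iff_integrable_smul'
    (measurable_symmParetoDensity α).ennreal_ofReal (by simp)]
  simp [symmParetoDensity_nonneg hα]

lemma integral_eq_integral_Ioi_add_neg {E : Type*} [NormedAddCommGroup E] [NormedSpace ℝ E]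
    {g : ℝ → E} (hg : Integrable g) : ∫ z, g z = ∫ z in Set.Ioi 0, (g z + g (-z)) := by
  have h2 : IntegrableOn (fun z => g (-z)) (Set.Ioi 0) := hg.comp_neg.integrableOn
  rw [integral_add hg.integrableOn h2, ← intervalIntegral.integral_Iic_add_Ioi (b := 0)
    hg.integrableOn hg.integrableOn, integral_comp_neg_Ioi, neg_zero, add_comm]

lemma integrable_of_even_of_integrableOn_Ioi {E : Type*} [NormedAddCommGroup E]
    {g : ℝ → E} (heven : ∀ z, g (-z) = g z) (hg : IntegrableOn g (Set.Ioi 0)) : Integrable g := by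
  have h1 : IntegrableOn g (Set.Iic 0) := by
    have : IntegrableOn (fun z => g (-z)) (Set.Iic 0) := by
      rw [integrableOn_Iic_iff_integrableOn_Iio]
      have := hg.comp_neg
      simpa using this
    simpa [heven] using this
  rw [← integrableOn_univ, ← Set.Iic_union_Ioi (a := (0 : ℝ))]
  exact h1.union hg

lemma integrableOn_Ioi_symmParetoDensity_smul_iff {E : Type*} [NormedAddCommGroup E]
    [NormedSpace ℝ E] {α : ℝ} {h : ℝ → E} :
    IntegrableOn (fun z => symmParetoDensity α z • h z) (Set.Ioi 0) ↔
      IntegrableOn (fun z => (α / 2 * z ^ (-α - 1)) • h z) (Set.Ioi 1) := by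
  have : Set.EqOn (fun z => symmParetoDensity α z • h z)
      ((Set.Ioi 1).indicator (fun z => (α / 2 * z ^ (-α - 1)) • h z)) (Set.Ioi 0) := fun z hz => by
    simp only [symmParetoDensity_of_pos (Set.mem_Ioi.1 hz), Set.indicator_apply]
    split_ifs <;> simp
  rw [integrableOn_congr_fun this measurableSet_Ioi, integrableOn_indicator_iff measurableSet_Ioi,
    Set.Ioi_inter_Ioi]
  simp

/-- Integration against the symmetric Pareto law as an integral over the half-line. -/
lemma integral_symmParetoLaw {E : Type*} [NormedAddCommGroup E] [NormedSpace ℝ E] {α : ℝ}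
    (hα : 0 < α) {h : ℝ → E} (hi : Integrable h (symmParetoLaw α)) :
    ∫ z, h z ∂(symmParetoLaw α)
      = ∫ z in Set.Ioi 1, (α / 2 * z ^ (-α - 1)) • (h z + h (-z)) := by
  rw [integral_symmParetoLaw_eq hα, integral_eq_integral_Ioi_add_neg
    ((integrable_symmParetoLaw_iff hα h).1 hi)]
  have : Set.EqOn (fun z => symmParetoDensity α z • h z + symmParetoDensity α (-z) • h (-z))
      ((Set.Ioi 1).indicator (fun z => (α / 2 * z ^ (-α - 1)) • (h z + h (-z))))
      (Set.Ioi 0) := fun z hz => by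
    simp only [symmParetoDensity_neg, symmParetoDensity_of_pos (Set.mem_Ioi.1 hz),
      Set.indicator_apply]
    split_ifs <;> simp
  rw [setIntegral_congr_fun measurableSet_Ioi this, setIntegral_indicator measurableSet_Ioi,
    Set.Ioi_inter_Ioi]
  simp

lemma isFiniteMeasure_symmParetoLaw {α : ℝ} (hα : 0 < α) :
    IsFiniteMeasure (symmParetoLaw α) := by
  have : Integrable (fun _ : ℝ => (1 : ℝ)) (symmParetoLaw α) := by
    rw [integrable_symmParetoLaw_iff hα]
    refine integrable_of_even_of_integrableOn_Ioi (by simp [symmParetoDensity_neg]) ?_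
    rw [integrableOn_Ioi_symmParetoDensity_smul_iff]
    simp only [smul_eq_mul, mul_one]
    exact (integrableOn_Ioi_rpow_of_lt (by linarith) one_pos).const_mul _
  exact (integrable_const_iff_isFiniteMeasure one_ne_zero).1 this

/-- The tail of the symmetric Pareto law. -/
lemma symmParetoLaw_real_tail {α r : ℝ} (hα : 0 < α) (hr : 1 ≤ r) :
    (symmParetoLaw α).real {z | r < |z|} = r ^ (-α) := by
  have := isFiniteMeasure_symmParetoLaw hα
  have hm : MeasurableSet {z : ℝ | r < |z|} := measurableSet_lt measurable_const (by fun_prop)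
  have hi : Integrable ({z : ℝ | r < |z|}.indicator (1 : ℝ → ℝ)) (symmParetoLaw α) :=
    (integrable_const (1 : ℝ)).indicator hm
  rw [← integral_indicator_one hm, integral_symmParetoLaw hα hi]
  have : Set.EqOn (fun z : ℝ => (α / 2 * z ^ (-α - 1)) • ({z : ℝ | r < |z|}.indicator (1 : ℝ → ℝ) z
      + {z : ℝ | r < |z|}.indicator 1 (-z)))
      ((Set.Ioi r).indicator (fun z => α * z ^ (-α - 1))) (Set.Ioi 1) := fun z hz => by
    have hz : (1 : ℝ) < z := hz
    simp only [Set.indicator_apply, Set.mem_ofPred_eq, abs_neg, abs_of_pos (one_pos.trans hz),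
      Set.mem_Ioi, Pi.one_apply, smul_eq_mul]
    split_ifs <;> ring
  rw [setIntegral_congr_fun measurableSet_Ioi this, setIntegral_indicator measurableSet_Ioi,
    Set.Ioi_inter_Ioi, max_eq_right hr, integral_const_mul,
    integral_Ioi_rpow_of_lt (by linarith) (by linarith)]
  simp
  field_simp

lemma isProbabilityMeasure_symmParetoLaw {α : ℝ} (hα : 0 < α) :
    IsProbabilityMeasure (symmParetoLaw α) := by
  have := isFiniteMeasure_symmParetoLaw hα
  have h1 := symmParetoLaw_real_tail hα le_rfl
  rw [Real.one_rpow] at h1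
  refine ⟨le_antisymm ?_ ?_⟩
  · have h2 : (symmParetoLaw α) {z : ℝ | ¬ 1 < |z|} = 0 := by
      have hm0 : MeasurableSet {z : ℝ | 1 < |z|} := measurableSet_lt measurable_const (by fun_prop)
      have hm : MeasurableSet {z : ℝ | ¬ 1 < |z|} := hm0.compl
      rw [symmParetoLaw, withDensity_apply _ hm, setLIntegral_congr_fun (g := 0) hm]
      · simp
      · intro z hz
        have hz : ¬ 1 < |z| := hz
        simp [symmParetoDensity, hz]
    have h3 : (symmParetoLaw α) {z : ℝ | 1 < |z|} = 1 := by
      rw [measureReal_def] at h1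
      rw [← ENNReal.ofReal_toReal (measure_ne_top _ _), h1, ENNReal.ofReal_one]
    calc (symmParetoLaw α) Set.univ
        ≤ (symmParetoLaw α) {z : ℝ | 1 < |z|} + (symmParetoLaw α) {z : ℝ | ¬ 1 < |z|} := by
          refine (measure_mono ?_).trans (measure_union_le _ _)
          intro z _
          exact em _
      _ = 1 := by rw [h2, h3, add_zero]
  · rw [← ENNReal.ofReal_one, ← h1, ofReal_measureReal]
    exact measure_mono (Set.subset_univ _)

lemma integrable_id_symmParetoLaw {α : ℝ} (hα : 1 < α) :
    Integrable (fun z => z) (symmParetoLaw α) := by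
  have h0 : (0 : ℝ) < α := by linarith
  rw [← integrable_norm_iff (by fun_prop), integrable_symmParetoLaw_iff h0]
  refine integrable_of_even_of_integrableOn_Ioi (by simp [symmParetoDensity_neg]) ?_
  rw [integrableOn_Ioi_symmParetoDensity_smul_iff]
  have hr : IntegrableOn (fun z : ℝ => α / 2 * z ^ (-α)) (Set.Ioi 1) :=
    (integrableOn_Ioi_rpow_of_lt (by linarith) one_pos).const_mul _
  refine hr.congr_fun (fun z hz => ?_) measurableSet_Ioi
  have hz : 0 < z := one_pos.trans hz
  simp only [smul_eq_mul, Real.norm_eq_abs, abs_of_pos hz, Real.rpow_sub_one hz.ne']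
  field_simp

/-! ### The characteristic function of the Pareto law -/

lemma integrable_one_sub_cos_mul_gaussian {s : ℝ} (hs : 0 < s) :
    Integrable (fun y : ℝ => (1 - Real.cos y) * Real.exp (-s * y ^ 2)) := by
  refine (integrable_exp_neg_mul_sq hs).bdd_mul (c := 2) (by fun_prop)
    (Eventually.of_forall fun y => ?_)
  rw [Real.norm_eq_abs, abs_le]
  constructor <;> linarith [Real.neg_one_le_cos y, Real.cos_le_one y]

lemma integral_cos_mul_gaussian {s : ℝ} (hs : 0 < s) :
    ∫ y : ℝ, Real.cos y * Real.exp (-s * y ^ 2) = √(Real.pi / s) * Real.exp (-(1 / (4 * s))) := by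
  have h := fourierIntegral_gaussian (b := (s : ℂ)) (by simpa using hs) 1
  have h1 : (∫ y : ℝ, Complex.exp (Complex.I * 1 * y) * Complex.exp (-s * y ^ 2)).re
      = ∫ y : ℝ, Real.cos y * Real.exp (-s * y ^ 2) := by
    rw [← RCLike.re_eq_complex_re, ← integral_re]
    · congr 1
      ext y
      have : Complex.exp (-s * y ^ 2) = ((Real.exp (-s * y ^ 2) : ℝ) : ℂ) := by push_cast; rfl
      rw [this, mul_one, mul_comm Complex.I, Complex.exp_mul_I, RCLike.re_eq_complex_re,
        Complex.re_mul_ofReal, ← Complex.ofReal_cos, ← Complex.ofReal_sin]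
      simp [-Complex.ofReal_cos]
    · refine Integrable.bdd_mul (c := 1) ?_ (by fun_prop) (Eventually.of_forall fun y => ?_)
      · have := (integrable_exp_neg_mul_sq hs).ofReal (𝕜 := ℂ)
        refine this.congr (Eventually.of_forall fun y => ?_)
        simp
      · rw [mul_one, Complex.norm_exp_I_mul_ofReal]
  rw [← h1, h]
  have h2 : ((Real.pi : ℂ) / s) ^ (1 / 2 : ℂ) = ((√(Real.pi / s) : ℝ) : ℂ) := by
    rw [Real.sqrt_eq_rpow, Complex.ofReal_cpow (by positivity)]
    push_cast; rfl
  have h3 : Complex.exp (-1 ^ 2 / (4 * s)) = ((Real.exp (-(1 / (4 * s))) : ℝ) : ℂ) := by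
    push_cast; congr 1; ring
  rw [h2, h3, ← Complex.ofReal_mul, Complex.ofReal_re]

lemma integral_one_sub_cos_mul_gaussian {s : ℝ} (hs : 0 < s) :
    ∫ y in Set.Ioi (0 : ℝ), (1 - Real.cos y) * Real.exp (-s * y ^ 2)
      = √Real.pi / 2 * s ^ (-(1 / 2) : ℝ) * (1 - Real.exp (-(1 / (4 * s)))) := by
  have h := integral_eq_integral_Ioi_add_neg (integrable_one_sub_cos_mul_gaussian hs)
  simp only [Real.cos_neg, neg_sq, ← two_mul] at h
  rw [integral_const_mul] at h
  have h2 : ∫ y : ℝ, (1 - Real.cos y) * Real.exp (-s * y ^ 2)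
      = √(Real.pi / s) * (1 - Real.exp (-(1 / (4 * s)))) := by
    simp only [sub_mul, one_mul]
    rw [integral_sub (integrable_exp_neg_mul_sq hs), integral_gaussian,
      integral_cos_mul_gaussian hs]
    · ring
    · exact (integrable_exp_neg_mul_sq hs).bdd_mul (c := 1) (by fun_prop)
        (Eventually.of_forall fun y => Real.abs_cos_le_one y)
  have h3 : √(Real.pi / s) = √Real.pi * s ^ (-(1 / 2) : ℝ) := by
    rw [Real.sqrt_div' _ hs.le, Real.rpow_neg hs.le, ← Real.sqrt_eq_rpow, div_eq_mul_inv]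
  rw [h3] at h2
  linarith

/-- As `1 - exp (-1 / (4 s))` is the integral of `exp (-w)` over `4 s w ≤ 1`, this is a double
integral that can be evaluated in the other order. -/
lemma lintegral_one_sub_exp_mul_rpow {a : ℝ} (ha0 : 0 < a) (ha1 : a < 1) :
    ∫⁻ s in Set.Ioi (0 : ℝ), ENNReal.ofReal (s ^ (a - 1) * (1 - Real.exp (-(1 / (4 * s)))))
      = ENNReal.ofReal (4 ^ (-a) / a * Real.Gamma (1 - a)) := by
  have h1 : ∀ s ∈ Set.Ioi (0 : ℝ),
      ENNReal.ofReal (s ^ (a - 1) * (1 - Real.exp (-(1 / (4 * s)))))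
      = ∫⁻ w in Set.Ioi (0 : ℝ), {q : ℝ × ℝ | 4 * q.1 * q.2 ≤ 1}.indicator
          (fun q => ENNReal.ofReal (q.1 ^ (a - 1) * Real.exp (-q.2))) (s, w) := by
    intro s hs
    have hs : 0 < s := hs
    have e1 : (fun w : ℝ => {q : ℝ × ℝ | 4 * q.1 * q.2 ≤ 1}.indicator
          (fun q => ENNReal.ofReal (q.1 ^ (a - 1) * Real.exp (-q.2))) (s, w))
        = (Set.Iic (1 / (4 * s))).indicator
          (fun w => ENNReal.ofReal (s ^ (a - 1) * Real.exp (-w))) := by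
      ext w
      simp only [Set.indicator_apply, Set.mem_ofPred_eq, Set.mem_Iic,
        le_div_iff₀ (show 0 < 4 * s by positivity), mul_comm w]
    rw [e1, setLIntegral_indicator measurableSet_Iic, Set.Iic_inter_Ioi,
      ← ofReal_integral_eq_lintegral_ofReal]
    · rw [integral_const_mul, ← intervalIntegral.integral_of_le (by positivity)]
      congr 2
      rw [intervalIntegral.integral_comp_neg (fun w => Real.exp w), integral_exp]
      simp
    · exact (Continuous.integrableOn_Ioc (by fun_prop))
    · exact Eventually.of_forall fun w => by positivity
  have hm : MeasurableSet {q : ℝ × ℝ | 4 * q.1 * q.2 ≤ 1} :=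
    measurableSet_le (by fun_prop) measurable_const
  have h2 : ∀ w ∈ Set.Ioi (0 : ℝ),
      ∫⁻ s in Set.Ioi (0 : ℝ), {q : ℝ × ℝ | 4 * q.1 * q.2 ≤ 1}.indicator
          (fun q => ENNReal.ofReal (q.1 ^ (a - 1) * Real.exp (-q.2))) (s, w)
      = ENNReal.ofReal (4 ^ (-a) / a * (Real.exp (-w) * w ^ ((1 - a) - 1))) := by
    intro w hw
    have hw : 0 < w := hw
    have e1 : (fun s : ℝ => {q : ℝ × ℝ | 4 * q.1 * q.2 ≤ 1}.indicator
          (fun q => ENNReal.ofReal (q.1 ^ (a - 1) * Real.exp (-q.2))) (s, w))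
        = (Set.Iic (1 / (4 * w))).indicator
          (fun s => ENNReal.ofReal (s ^ (a - 1) * Real.exp (-w))) := by
      ext s
      simp only [Set.indicator_apply, Set.mem_ofPred_eq, Set.mem_Iic,
        le_div_iff₀ (show 0 < 4 * w by positivity)]
      rw [show 4 * s * w = s * (4 * w) by ring]
    have e2 : IntegrableOn (fun s : ℝ => s ^ (a - 1) * Real.exp (-w)) (Set.Ioc 0 (1 / (4 * w))) :=
      ((intervalIntegrable_iff_integrableOn_Ioc_of_le (by positivity)).1
        (intervalIntegral.intervalIntegrable_rpow' (by linarith))).mul_const _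
    rw [e1, setLIntegral_indicator measurableSet_Iic, Set.Iic_inter_Ioi,
      ← ofReal_integral_eq_lintegral_ofReal e2]
    · rw [integral_mul_const, ← intervalIntegral.integral_of_le (by positivity),
        integral_rpow (Or.inl (by linarith))]
      congr 1
      rw [sub_add_cancel, Real.zero_rpow ha0.ne', sub_zero, one_div, Real.inv_rpow (by positivity),
        Real.mul_rpow (by norm_num) hw.le, Real.rpow_neg (by norm_num),
        show 1 - a - 1 = -a by ring, Real.rpow_neg hw.le]
      field_simp
    · filter_upwards [ae_restrict_mem measurableSet_Ioc] with s hs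
      have := hs.1
      positivity
  rw [setLIntegral_congr_fun measurableSet_Ioi h1, lintegral_lintegral_swap,
    setLIntegral_congr_fun measurableSet_Ioi h2, ← ofReal_integral_eq_lintegral_ofReal]
  · rw [integral_const_mul, Real.Gamma_eq_integral (by linarith)]
  · exact (Real.GammaIntegral_convergent (by linarith)).const_mul _
  · filter_upwards [ae_restrict_mem measurableSet_Ioi] with w hw
    have : 0 < w := hw
    positivity
  · exact ((by fun_prop : Measurable _).indicator hm).aemeasurable

/-- The normalisation of the stable Lévy measure, `2 d_α ∫_0^∞ (1 - cos y) y^{-1-α} dy = 1`.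
The power is written as a mixture of Gaussians, for which the integral is explicit. -/
lemma lintegral_one_sub_cos_mul_rpow {α : ℝ} (h0 : 0 < α) (h2 : α < 2) :
    ∫⁻ y in Set.Ioi (0 : ℝ), ENNReal.ofReal ((1 - Real.cos y) * y ^ (-α - 1))
      = ENNReal.ofReal (1 / (2 * stableConst α)) := by
  have hΓ : 0 < Real.Gamma ((1 + α) / 2) := Real.Gamma_pos_of_pos (by linarith)
  have hΓ' : 0 < Real.Gamma (1 - α / 2) := Real.Gamma_pos_of_pos (by linarith)
  have h1 : ∀ y ∈ Set.Ioi (0 : ℝ), ENNReal.ofReal ((1 - Real.cos y) * y ^ (-α - 1))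
      = ∫⁻ s in Set.Ioi (0 : ℝ), ENNReal.ofReal ((1 / Real.Gamma ((1 + α) / 2)) *
          (s ^ ((1 + α) / 2 - 1) * ((1 - Real.cos y) * Real.exp (-s * y ^ 2)))) := by
    intro y hy
    have hy : 0 < y := hy
    have hc : 0 ≤ 1 - Real.cos y := by linarith [Real.cos_le_one y]
    have e := Real.integral_rpow_mul_exp_neg_mul_Ioi (a := (1 + α) / 2) (r := y ^ 2)
      (by linarith) (by positivity)
    have e3 : (1 / y ^ 2) ^ ((1 + α) / 2) = y ^ (-α - 1) := by
      rw [one_div, ← Real.rpow_natCast, ← Real.rpow_neg hy.le, ← Real.rpow_mul hy.le]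
      congr 1; push_cast; ring
    rw [e3] at e
    have e4 : ∫ s in Set.Ioi (0 : ℝ), (1 / Real.Gamma ((1 + α) / 2)) *
          (s ^ ((1 + α) / 2 - 1) * ((1 - Real.cos y) * Real.exp (-s * y ^ 2)))
        = (1 - Real.cos y) * y ^ (-α - 1) := by
      have : (fun s : ℝ => (1 / Real.Gamma ((1 + α) / 2)) *
          (s ^ ((1 + α) / 2 - 1) * ((1 - Real.cos y) * Real.exp (-s * y ^ 2))))
        = fun s => ((1 - Real.cos y) / Real.Gamma ((1 + α) / 2)) *
            (s ^ ((1 + α) / 2 - 1) * Real.exp (-(y ^ 2 * s))) := by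
        ext s
        rw [show -(y ^ 2 * s) = -s * y ^ 2 by ring]
        ring
      rw [this, integral_const_mul, e]
      field_simp
    have e5 : 0 < ∫ s in Set.Ioi (0 : ℝ), s ^ ((1 + α) / 2 - 1) * Real.exp (-(y ^ 2 * s)) := by
      rw [e]; positivity
    have e6 : IntegrableOn (fun s : ℝ => s ^ ((1 + α) / 2 - 1) * Real.exp (-(y ^ 2 * s)))
        (Set.Ioi 0) := by
      by_contra hcon
      rw [integral_undef hcon] at e5
      exact lt_irrefl _ e5
    rw [← e4, ofReal_integral_eq_lintegral_ofReal]
    · refine (e6.const_mul ((1 - Real.cos y) / Real.Gamma ((1 + α) / 2))).congr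
        (Eventually.of_forall fun s => ?_)
      simp only
      rw [show -(y ^ 2 * s) = -s * y ^ 2 by ring]
      ring
    · filter_upwards [ae_restrict_mem measurableSet_Ioi] with s hs
      have : 0 < s := hs
      positivity
  have h3 : ∀ s ∈ Set.Ioi (0 : ℝ),
      ∫⁻ y in Set.Ioi (0 : ℝ), ENNReal.ofReal ((1 / Real.Gamma ((1 + α) / 2)) *
          (s ^ ((1 + α) / 2 - 1) * ((1 - Real.cos y) * Real.exp (-s * y ^ 2))))
      = ENNReal.ofReal (√Real.pi / 2 / Real.Gamma ((1 + α) / 2))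
        * ENNReal.ofReal (s ^ (α / 2 - 1) * (1 - Real.exp (-(1 / (4 * s))))) := by
    intro s hs
    have hs : 0 < s := hs
    rw [← ofReal_integral_eq_lintegral_ofReal]
    · rw [integral_const_mul, integral_const_mul, integral_one_sub_cos_mul_gaussian hs,
        ← ENNReal.ofReal_mul (by positivity)]
      congr 1
      rw [show α / 2 - 1 = ((1 + α) / 2 - 1) + (-(1 / 2)) by ring, Real.rpow_add hs]
      ring
    · exact (((integrable_one_sub_cos_mul_gaussian hs).integrableOn).const_mul _).const_mul _
    · refine Eventually.of_forall fun y => ?_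
      have hc : 0 ≤ 1 - Real.cos y := by linarith [Real.cos_le_one y]
      positivity
  rw [setLIntegral_congr_fun measurableSet_Ioi h1, lintegral_lintegral_swap,
    setLIntegral_congr_fun measurableSet_Ioi h3, lintegral_const_mul' _ _ ENNReal.ofReal_ne_top,
    lintegral_one_sub_exp_mul_rpow (by linarith) (by linarith),
    ← ENNReal.ofReal_mul (by positivity)]
  · congr 1
    have e1 : (4 : ℝ) ^ (-(α / 2)) = (2 ^ α)⁻¹ := by
      rw [show (4 : ℝ) = 2 ^ (2 : ℝ) by norm_num, ← Real.rpow_mul (by norm_num),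
        ← Real.rpow_neg (by norm_num)]
      congr 1; ring
    have e2 : (2 : ℝ) ^ (α - 1) = 2 ^ α / 2 := by
      rw [Real.rpow_sub_one (by norm_num)]
    have e3 : Real.pi ^ (-(1 / 2) : ℝ) = (√Real.pi)⁻¹ := by
      rw [Real.rpow_neg Real.pi_pos.le, Real.sqrt_eq_rpow]
    have : 0 < √Real.pi := Real.sqrt_pos.2 Real.pi_pos
    rw [stableConst, e1, e2, e3]
    field_simp
    try norm_num
  · refine Measurable.aemeasurable ?_
    fun_prop

lemma one_sub_cos_mul_rpow_le {α y : ℝ} (hy : 0 < y) :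
    (1 - Real.cos y) * y ^ (-α - 1) ≤ 1 / 2 * y ^ (1 - α) := by
  have h := Real.one_sub_sq_div_two_le_cos (x := y)
  calc (1 - Real.cos y) * y ^ (-α - 1) ≤ (y ^ 2 / 2) * y ^ (-α - 1) := by gcongr; linarith
    _ = 1 / 2 * y ^ (1 - α) := by
      rw [show 1 - α = (-α - 1) + 2 by ring, Real.rpow_add hy, Real.rpow_two]; ring

lemma integrableOn_one_sub_cos_mul_rpow {α : ℝ} (h0 : 0 < α) (h2 : α < 2) :
    IntegrableOn (fun y : ℝ => (1 - Real.cos y) * y ^ (-α - 1)) (Set.Ioi 0) := by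
  refine ⟨by fun_prop, ?_⟩
  rw [hasFiniteIntegral_iff_ofReal, lintegral_one_sub_cos_mul_rpow h0 h2]
  · exact ENNReal.ofReal_lt_top
  · filter_upwards [ae_restrict_mem measurableSet_Ioi] with y hy
    have hy : 0 < y := hy
    have hc : 0 ≤ 1 - Real.cos y := by linarith [Real.cos_le_one y]
    positivity

lemma stableConst_pos {α : ℝ} (h0 : 0 < α) (h2 : α < 2) : 0 < stableConst α := by
  have hΓ : 0 < Real.Gamma ((1 + α) / 2) := Real.Gamma_pos_of_pos (by linarith)
  have hΓ' : 0 < Real.Gamma (1 - α / 2) := Real.Gamma_pos_of_pos (by linarith)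
  have := Real.pi_pos
  unfold stableConst
  positivity

lemma integral_one_sub_cos_mul_rpow {α : ℝ} (h0 : 0 < α) (h2 : α < 2) :
    ∫ y in Set.Ioi (0 : ℝ), (1 - Real.cos y) * y ^ (-α - 1) = 1 / (2 * stableConst α) := by
  have hpos : 0 ≤ᵐ[volume.restrict (Set.Ioi (0 : ℝ))]
      fun y : ℝ => (1 - Real.cos y) * y ^ (-α - 1) := by
    filter_upwards [ae_restrict_mem measurableSet_Ioi] with y hy
    have hy : 0 < y := hy
    have hc : 0 ≤ 1 - Real.cos y := by linarith [Real.cos_le_one y]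
    positivity
  have := stableConst_pos h0 h2
  rw [← ENNReal.ofReal_eq_ofReal_iff (integral_nonneg_of_ae hpos) (by positivity),
    ofReal_integral_eq_lintegral_ofReal (integrableOn_one_sub_cos_mul_rpow h0 h2) hpos,
    lintegral_one_sub_cos_mul_rpow h0 h2]

lemma charFun_symmParetoLaw {α : ℝ} (h0 : 0 < α) (t : ℝ) :
    charFun (symmParetoLaw α) t
      = ((1 - α * ∫ z in Set.Ioi (1 : ℝ), (1 - Real.cos (t * z)) * z ^ (-α - 1) : ℝ) : ℂ) := by
  have := isProbabilityMeasure_symmParetoLaw h0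
  have hi : Integrable (fun z : ℝ => Complex.exp (t * z * Complex.I)) (symmParetoLaw α) := by
    refine Integrable.of_bound (C := 1) (by fun_prop) (Eventually.of_forall fun z => ?_)
    rw [← Complex.ofReal_mul, Complex.norm_exp_ofReal_mul_I]
  have h1 : ∫ z, (1 : ℝ) ∂(symmParetoLaw α) = 1 := by simp
  rw [integral_symmParetoLaw h0 (integrable_const _)] at h1
  have hr := (integrableOn_Ioi_rpow_of_lt (a := -α - 1) (by linarith) one_pos)
  have hc : IntegrableOn (fun z : ℝ => α * (Real.cos (t * z) * z ^ (-α - 1))) (Set.Ioi 1) := by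
    refine (hr.bdd_mul (c := 1) (by fun_prop) (Eventually.of_forall fun z => ?_)).const_mul _
    exact Real.abs_cos_le_one _
  rw [charFun_apply_real, integral_symmParetoLaw h0 hi]
  have e1 : ∀ z : ℝ, ((α / 2 * z ^ (-α - 1)) : ℝ) • (Complex.exp (t * z * Complex.I)
      + Complex.exp (t * (-z : ℝ) * Complex.I))
      = ((α * (Real.cos (t * z) * z ^ (-α - 1)) : ℝ) : ℂ) := fun z => by
    have h := Complex.two_cos (t * z)
    rw [Complex.ofReal_neg, mul_neg, ← h, Complex.real_smul]
    push_cast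
    ring
  simp only [e1]
  rw [← integral_const_mul, integral_complex_ofReal]
  congr 1
  have hd : IntegrableOn (fun z : ℝ => α * ((1 - Real.cos (t * z)) * z ^ (-α - 1)))
      (Set.Ioi 1) := by
    have h : IntegrableOn (fun z : ℝ => α * z ^ (-α - 1)) (Set.Ioi 1) := hr.const_mul α
    refine (h.sub hc).congr (Eventually.of_forall fun z => ?_)
    simp only [Pi.sub_apply]
    ring
  rw [eq_sub_iff_add_eq, ← integral_add hc hd]
  refine Eq.trans (integral_congr_ae (Eventually.of_forall fun z => ?_)) h1
  simp only [smul_eq_mul]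
  ring

lemma integral_Ioi_one_sub_cos_scaled {α t : ℝ} (h0 : 0 < α) (h2 : α < 2) (ht : 0 < t) :
    ∫ z in Set.Ioi (1 : ℝ), (1 - Real.cos (t * z)) * z ^ (-α - 1)
      = t ^ α * (1 / (2 * stableConst α)
        - ∫ y in Set.Ioc 0 t, (1 - Real.cos y) * y ^ (-α - 1)) := by
  have e1 := integral_comp_mul_left_Ioi (fun y => (1 - Real.cos y) * (y / t) ^ (-α - 1)) 1 ht
  simp only [mul_div_cancel_left₀ _ ht.ne', mul_one] at e1
  rw [e1]
  have e2 : Set.EqOn (fun y => (1 - Real.cos y) * (y / t) ^ (-α - 1))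
      (fun y => t ^ (α + 1) * ((1 - Real.cos y) * y ^ (-α - 1))) (Set.Ioi t) := fun y hy => by
    have hy : 0 < y := ht.trans hy
    simp only
    rw [Real.div_rpow hy.le ht.le, show -α - 1 = -(α + 1) by ring, Real.rpow_neg ht.le (α + 1)]
    field_simp
  rw [setIntegral_congr_fun measurableSet_Ioi e2, integral_const_mul,
    ← integral_one_sub_cos_mul_rpow h0 h2]
  have hI := integrableOn_one_sub_cos_mul_rpow h0 h2
  have e3 : ∫ y in Set.Ioi (0 : ℝ), (1 - Real.cos y) * y ^ (-α - 1)
      = (∫ y in Set.Ioc 0 t, (1 - Real.cos y) * y ^ (-α - 1))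
        + ∫ y in Set.Ioi t, (1 - Real.cos y) * y ^ (-α - 1) := by
    rw [← Set.Ioc_union_Ioi_eq_Ioi ht.le, setIntegral_union Set.Ioc_disjoint_Ioi_same
      measurableSet_Ioi (hI.mono_set Set.Ioc_subset_Ioi_self)
      (hI.mono_set (Set.Ioi_subset_Ioi ht.le))]
  rw [e3, add_sub_cancel_left, smul_eq_mul, Real.rpow_add_one ht.ne']
  field_simp

lemma integral_Ioc_one_sub_cos_le {α t : ℝ} (h0 : 0 < α) (h2 : α < 2) (ht : 0 < t) :
    ∫ y in Set.Ioc 0 t, (1 - Real.cos y) * y ^ (-α - 1) ≤ t ^ (2 - α) / (2 * (2 - α)) := by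
  have hI := integrableOn_one_sub_cos_mul_rpow h0 h2
  have hr : IntegrableOn (fun y : ℝ => 1 / 2 * y ^ (1 - α)) (Set.Ioc 0 t) :=
    ((intervalIntegrable_iff_integrableOn_Ioc_of_le ht.le).1
      (intervalIntegral.intervalIntegrable_rpow' (by linarith))).const_mul _
  refine (setIntegral_mono_on (hI.mono_set Set.Ioc_subset_Ioi_self) hr measurableSet_Ioc
    fun y hy => one_sub_cos_mul_rpow_le hy.1).trans (le_of_eq ?_)
  rw [integral_const_mul, ← intervalIntegral.integral_of_le ht.le,
    integral_rpow (Or.inl (by linarith)), show 1 - α + 1 = 2 - α by ring,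
    Real.zero_rpow (by linarith)]
  field_simp
  ring

lemma le_integral_Ioc_one_sub_cos {α t : ℝ} (h0 : 0 < α) (h2 : α < 2) (ht : 0 < t) (ht1 : t ≤ 1) :
    2 / Real.pi ^ 2 * (t ^ (2 - α) / (2 - α))
      ≤ ∫ y in Set.Ioc 0 t, (1 - Real.cos y) * y ^ (-α - 1) := by
  have hI := integrableOn_one_sub_cos_mul_rpow h0 h2
  have hr : IntegrableOn (fun y : ℝ => 2 / Real.pi ^ 2 * y ^ (1 - α)) (Set.Ioc 0 t) :=
    ((intervalIntegrable_iff_integrableOn_Ioc_of_le ht.le).1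
      (intervalIntegral.intervalIntegrable_rpow' (by linarith))).const_mul _
  refine le_trans (le_of_eq ?_) (setIntegral_mono_on hr (hI.mono_set Set.Ioc_subset_Ioi_self)
    measurableSet_Ioc fun y hy => ?_)
  · rw [integral_const_mul, ← intervalIntegral.integral_of_le ht.le,
      integral_rpow (Or.inl (by linarith)), show 1 - α + 1 = 2 - α by ring,
      Real.zero_rpow (by linarith), sub_zero]
  · have hy0 : 0 < y := hy.1
    have h := Real.cos_le_one_sub_mul_cos_sq (x := y)
      (by rw [abs_of_pos hy0]; linarith [hy.2, Real.pi_gt_three])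
    rw [show 1 - α = 2 + (-α - 1) by ring, Real.rpow_add hy0, Real.rpow_two, ← mul_assoc]
    gcongr
    linarith

/-- The symmetric Pareto law divided by `β`, which is in the domain of normal attraction of the
standard symmetric stable law. -/
noncomputable def unitPareto (α : ℝ) : Measure ℝ :=
  (symmParetoLaw α).map (fun z => (paretoScale α)⁻¹ * z)

lemma isProbabilityMeasure_unitPareto {α : ℝ} (h0 : 0 < α) :
    IsProbabilityMeasure (unitPareto α) := by
  have := isProbabilityMeasure_symmParetoLaw h0
  exact Measure.isProbabilityMeasure_map (by fun_prop)

lemma paretoScale_pos {α : ℝ} (h0 : 0 < α) (h2 : α < 2) : 0 < paretoScale α := by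
  have := stableConst_pos h0 h2
  unfold paretoScale
  positivity

/-- The characteristic function of the scaled Pareto law is that of the stable law up to a
positive quadratic correction. It is this correction that determines the rate. -/
lemma exists_charFun_unitPareto {α : ℝ} (h0 : 0 < α) (h2 : α < 2) :
    ∃ (c C : ℝ) (q : ℝ → ℝ), 0 < c ∧ 0 < C ∧
      (∀ t, charFun (unitPareto α) t = ((1 - |t| ^ α + q t : ℝ) : ℂ)) ∧
      (∀ t, 0 ≤ q t ∧ q t ≤ C * t ^ 2) ∧ (∀ t, |t| ≤ paretoScale α → c * t ^ 2 ≤ q t) := by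
  set β := paretoScale α with hβ
  have hβ0 : 0 < β := paretoScale_pos h0 h2
  have hd := stableConst_pos h0 h2
  have hβα : β ^ α = α / (2 * stableConst α) := by
    rw [hβ, paretoScale, ← Real.rpow_mul (by positivity), one_div_mul_cancel h0.ne', Real.rpow_one]
  have h2α : 0 < 2 - α := by linarith
  have hpi := Real.pi_pos
  have hsq : ∀ t : ℝ, 0 < t → α * (β⁻¹ * t) ^ α * ((β⁻¹ * t) ^ (2 - α))
      = α * β⁻¹ ^ 2 * t ^ 2 := fun t ht => by
    rw [mul_assoc, ← Real.rpow_add (by positivity), show α + (2 - α) = 2 by ring, Real.rpow_two]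
    ring
  refine ⟨2 / Real.pi ^ 2 * (α * β⁻¹ ^ 2 / (2 - α)), α * β⁻¹ ^ 2 / (2 * (2 - α)),
    fun t => α * (β⁻¹ * |t|) ^ α *
      ∫ y in Set.Ioc 0 (β⁻¹ * |t|), (1 - Real.cos y) * y ^ (-α - 1),
    by positivity, by positivity, fun t => ?_, fun t => ⟨?_, ?_⟩, fun t ht => ?_⟩
  · rw [unitPareto, charFun_map_mul, charFun_symmParetoLaw h0]
    congr 1
    rcases eq_or_ne t 0 with rfl | ht
    · simp [Real.zero_rpow h0.ne']
    have ht' : 0 < |t| := abs_pos.2 ht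
    have e : ∀ z, Real.cos (β⁻¹ * t * z) = Real.cos (β⁻¹ * |t| * z) := fun z => by
      rcases abs_choice t with h | h <;> rw [h]
      rw [← Real.cos_neg]
      congr 1; ring
    simp only [← hβ, e]
    rw [integral_Ioi_one_sub_cos_scaled h0 h2 (by positivity),
      Real.mul_rpow (by positivity) ht'.le, Real.inv_rpow hβ0.le, hβα]
    field_simp
    ring
  · refine mul_nonneg (by positivity) (setIntegral_nonneg measurableSet_Ioc fun y hy => ?_)
    have hy0 : 0 < y := hy.1
    have hc : 0 ≤ 1 - Real.cos y := by linarith [Real.cos_le_one y]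
    positivity
  · rcases eq_or_ne t 0 with rfl | ht
    · simp
    have ht' : 0 < |t| := abs_pos.2 ht
    calc _ ≤ α * (β⁻¹ * |t|) ^ α * ((β⁻¹ * |t|) ^ (2 - α) / (2 * (2 - α))) := by
          refine mul_le_mul_of_nonneg_left ?_ (by positivity)
          exact integral_Ioc_one_sub_cos_le h0 h2 (by positivity)
      _ = _ := by
          rw [← mul_div_assoc, hsq _ ht', sq_abs]
          ring
  · rcases eq_or_ne t 0 with rfl | ht0
    · simp
    have ht' : 0 < |t| := abs_pos.2 ht0
    calc _ = α * (β⁻¹ * |t|) ^ α * (2 / Real.pi ^ 2 * ((β⁻¹ * |t|) ^ (2 - α) / (2 - α))) := by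
          rw [mul_left_comm, ← mul_div_assoc (α * (β⁻¹ * |t|) ^ α), hsq _ ht', sq_abs]
          ring
      _ ≤ _ := by
          refine mul_le_mul_of_nonneg_left ?_ (by positivity)
          refine le_integral_Ioc_one_sub_cos h0 h2 (by positivity) ?_
          rw [inv_mul_le_iff₀ hβ0, mul_one]
          exact ht

/-! ### Convolutions and smoothing -/

lemma integrable_of_continuous_of_abs_le {μ : Measure ℝ} [IsFiniteMeasure μ] {φ : ℝ → ℝ} {B : ℝ}
    (hφ : Continuous φ) (hB : ∀ x, |φ x| ≤ B) : Integrable φ μ :=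
  Integrable.of_bound hφ.aestronglyMeasurable B (Eventually.of_forall hB)

lemma abs_integral_le_of_abs_le {μ : Measure ℝ} [IsFiniteMeasure μ] {φ : ℝ → ℝ} {B : ℝ}
    (hB : ∀ x, |φ x| ≤ B) : |∫ x, φ x ∂μ| ≤ B * μ.real Set.univ :=
  norm_integral_le_of_norm_le_const (f := φ) (Eventually.of_forall hB)

lemma continuous_integral_comp_add {μ : Measure ℝ} [IsFiniteMeasure μ] {φ : ℝ → ℝ} {B : ℝ}
    (hφ : Continuous φ) (hB : ∀ x, |φ x| ≤ B) : Continuous fun x => ∫ y, φ (x + y) ∂μ :=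
  continuous_of_dominated (bound := fun _ => B) (fun x => by fun_prop)
    (fun x => Eventually.of_forall fun y => hB _) (integrable_const _)
    (Eventually.of_forall fun y => by fun_prop)

lemma integral_conv_of_continuous {μ ν : Measure ℝ} [IsFiniteMeasure μ] [IsFiniteMeasure ν]
    {φ : ℝ → ℝ} {B : ℝ} (hφ : Continuous φ) (hB : ∀ x, |φ x| ≤ B) :
    ∫ x, φ x ∂(μ ∗ ν) = ∫ x, ∫ y, φ (x + y) ∂ν ∂μ :=
  integral_conv (integrable_of_continuous_of_abs_le hφ hB)

lemma conv_real_univ (μ ν : Measure ℝ) [IsFiniteMeasure μ] [IsFiniteMeasure ν] :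
    (μ ∗ ν).real Set.univ = μ.real Set.univ * ν.real Set.univ := by
  rw [Measure.conv, measureReal_def, Measure.map_apply measurable_add MeasurableSet.univ,
    Set.preimage_univ, Measure.prod_apply MeasurableSet.univ]
  simp [measureReal_def, mul_comm]

/-- The shifts of `μ` are Lipschitz in total variation with constant `L`, tested on continuous
functions. For a law with a density of bounded variation, `L` is the total variation of the
density. -/
def ShiftLip (L : ℝ) (μ : Measure ℝ) : Prop :=
  ∀ φ : ℝ → ℝ, Continuous φ → (∀ x, |φ x| ≤ 1) → ∀ a, |∫ x, (φ (x + a) - φ x) ∂μ| ≤ L * |a|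

namespace ShiftLip

variable {L M : ℝ} {μ ν : Measure ℝ}

lemma mono (h : ShiftLip L μ) (hLM : L ≤ M) : ShiftLip M μ := fun φ hφ h1 a =>
  (h φ hφ h1 a).trans (by gcongr)

lemma nonneg (h : ShiftLip L μ) : 0 ≤ L := by
  simpa using (abs_nonneg _).trans (h (fun _ => 0) continuous_const (by simp) 1)

lemma integrable_shift_sub [IsFiniteMeasure μ] {φ : ℝ → ℝ} (hφ : Continuous φ)
    (h1 : ∀ x, |φ x| ≤ 1) (a : ℝ) : Integrable (fun x => φ (x + a) - φ x) μ :=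
  (integrable_of_continuous_of_abs_le (φ := fun x => φ (x + a)) (by fun_prop)
    (fun x => h1 _)).sub (integrable_of_continuous_of_abs_le hφ h1)

lemma add [IsFiniteMeasure μ] [IsFiniteMeasure ν] (hμ : ShiftLip L μ) (hν : ShiftLip M ν) :
    ShiftLip (L + M) (μ + ν) := fun φ hφ h1 a => by
  rw [integral_add_measure (integrable_shift_sub hφ h1 a) (integrable_shift_sub hφ h1 a), add_mul]
  exact (abs_add_le _ _).trans (add_le_add (hμ φ hφ h1 a) (hν φ hφ h1 a))

lemma of_add [IsFiniteMeasure μ] [IsFiniteMeasure ν] (h : ShiftLip L (μ + ν))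
    (hν : ShiftLip M ν) : ShiftLip (L + M) μ := fun φ hφ h1 a => by
  have h2 := h φ hφ h1 a
  rw [integral_add_measure (integrable_shift_sub hφ h1 a) (integrable_shift_sub hφ h1 a)] at h2
  have h3 := hν φ hφ h1 a
  rw [abs_le] at h2 h3 ⊢
  rw [add_mul]
  constructor <;> linarith [h2.1, h2.2, h3.1, h3.2]

lemma conv_right [IsFiniteMeasure μ] [IsFiniteMeasure ν] (h : ShiftLip L μ) :
    ShiftLip (L * ν.real Set.univ) (ν ∗ μ) := fun φ hφ h1 a => by
  have hB : ∀ x, |φ (x + a) - φ x| ≤ 1 + 1 := fun x =>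
    (abs_sub _ _).trans (add_le_add (h1 _) (h1 _))
  rw [integral_conv_of_continuous (φ := fun x => φ (x + a) - φ x) (by fun_prop) hB,
    mul_right_comm]
  refine abs_integral_le_of_abs_le fun y => ?_
  have := h (fun x => φ (y + x)) (by fun_prop) (fun x => h1 _) a
  simpa only [← add_assoc] using this

lemma conv_left [IsFiniteMeasure μ] [IsFiniteMeasure ν] (h : ShiftLip L μ) :
    ShiftLip (L * ν.real Set.univ) (μ ∗ ν) := by
  rw [Measure.conv_comm]
  exact h.conv_right

lemma map_mul (h : ShiftLip L μ) {c : ℝ} (hc : c ≠ 0) :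
    ShiftLip (L * |c|⁻¹) (μ.map (fun x => c * x)) := fun φ hφ h1 a => by
  rw [integral_map (by fun_prop) (by fun_prop)]
  have := h (fun x => φ (c * x)) (by fun_prop) (fun x => h1 _) (c⁻¹ * a)
  simp only [mul_add, mul_inv_cancel_left₀ hc] at this
  rw [abs_mul, abs_inv, ← mul_assoc] at this
  exact this

end ShiftLip

/-- A nonincreasing weight on a half-line shifts in `L¹` at the rate given by its largest value. -/
lemma abs_integral_Ioi_mul_shift_sub_le {w : ℝ → ℝ} {r W : ℝ} (hw0 : ∀ z, r < z → 0 ≤ w z)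
    (hwW : ∀ z, r < z → w z ≤ W) (hanti : ∀ y z, r < y → y ≤ z → w z ≤ w y)
    (hint : IntegrableOn w (Set.Ioi r)) {ψ : ℝ → ℝ} (hψ : Continuous ψ) (h1 : ∀ x, |ψ x| ≤ 1)
    (a : ℝ) : |∫ z in Set.Ioi r, w z * (ψ (z + a) - ψ z)| ≤ 2 * W * |a| := by
  wlog ha : 0 ≤ a generalizing a ψ
  · have := this (ψ := fun x => ψ (x + a)) (by fun_prop) (fun x => h1 _) (-a) (by linarith)
    simp only [neg_add_cancel_right, abs_neg] at this
    rw [← abs_neg, ← integral_neg]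
    convert this using 4
    ring
  rw [abs_of_nonneg ha]
  set V : ℝ → ℝ := (Set.Ioi r).indicator w with hV
  have hVi : Integrable V := (integrable_indicator_iff measurableSet_Ioi).2 hint
  have hVs : Integrable fun y => V (y - a) := hVi.comp_sub_right a
  have hmul : ∀ {U : ℝ → ℝ}, Integrable U → ∀ {χ : ℝ → ℝ}, Continuous χ → (∀ x, |χ x| ≤ 1) →
      Integrable fun y => U y * χ y := fun hU χ hχ hχ1 =>
    hU.mul_bdd (c := 1) hχ.aestronglyMeasurable (Eventually.of_forall hχ1)
  have e1 : ∫ z in Set.Ioi r, w z * (ψ (z + a) - ψ z) = ∫ y, (V (y - a) - V y) * ψ y := by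
    rw [← integral_indicator measurableSet_Ioi]
    have : (Set.Ioi r).indicator (fun z => w z * (ψ (z + a) - ψ z))
        = fun z => V z * ψ (z + a) - V z * ψ z := by
      ext z
      simp only [hV, Set.indicator_apply]
      split_ifs <;> ring
    rw [this, integral_sub (hmul hVi (χ := fun z => ψ (z + a)) (by fun_prop) fun x => h1 _)
      (hmul hVi hψ h1), ← integral_sub_right_eq_self (fun z => V z * ψ (z + a)) a,
      ← integral_sub]
    · congr 1
      ext y
      rw [sub_add_cancel, sub_mul]
    · simpa using hmul hVs hψ h1
    · exact hmul hVi hψ h1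
  have hIoc : IntegrableOn w (Set.Ioc r (r + a)) := hint.mono_set Set.Ioc_subset_Ioi_self
  -- off `(r, r + a]` the shift by `a` only increases the weight, and the increments have total `0`
  have e2 : ∀ y, |(V (y - a) - V y) * ψ y|
      ≤ (V (y - a) - V y) + 2 * (Set.Ioc r (r + a)).indicator w y := fun y => by
    have hle : |(V (y - a) - V y) * ψ y| ≤ |V (y - a) - V y| := by
      rw [abs_mul]
      exact mul_le_of_le_one_right (abs_nonneg _) (h1 y)
    refine hle.trans (le_of_eq ?_)
    simp only [hV, Set.indicator_apply, Set.mem_Ioi, Set.mem_Ioc]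
    by_cases hy : r < y
    · by_cases hya : r < y - a
      · rw [if_pos hya, if_pos hy, if_neg (by intro h; linarith [h.2]),
          abs_of_nonneg (by linarith [hanti (y - a) y hya (by linarith)])]
        ring
      · rw [if_neg hya, if_pos hy, if_pos ⟨hy, by linarith⟩, abs_of_nonpos (by linarith [hw0 y hy])]
        ring
    · rw [if_neg (by intro h; linarith), if_neg hy, if_neg (by intro h; exact hy h.1)]
      simp
  rw [e1]
  have hIi : Integrable ((Set.Ioc r (r + a)).indicator w) :=
    (integrable_indicator_iff measurableSet_Ioc).2 hIoc
  have hsub : Integrable fun y => V (y - a) - V y := hVs.sub hVi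
  calc |∫ y, (V (y - a) - V y) * ψ y|
      ≤ ∫ y, ((V (y - a) - V y) + 2 * (Set.Ioc r (r + a)).indicator w y) :=
        norm_integral_le_of_norm_le (f := fun y => (V (y - a) - V y) * ψ y)
          (hsub.add (hIi.const_mul 2)) (Eventually.of_forall e2)
    _ = 2 * ∫ y in Set.Ioc r (r + a), w y := by
        rw [integral_add hsub (hIi.const_mul 2), integral_sub hVs hVi,
          integral_sub_right_eq_self V a, sub_self, zero_add, integral_const_mul,
          integral_indicator measurableSet_Ioc]
    _ ≤ 2 * (W * a) := by
        gcongr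
        calc ∫ y in Set.Ioc r (r + a), w y ≤ ∫ y in Set.Ioc r (r + a), W :=
              setIntegral_mono_on hIoc (by simp) measurableSet_Ioc fun y hy => hwW y hy.1
          _ = W * a := by simp [ha, mul_comm]
    _ = 2 * W * a := by ring

/-- The part of the Pareto law beyond `r` has mass `r ^ (-α)` and is smooth at the scale `r`. -/
lemma shiftLip_symmParetoLaw_restrict {α r : ℝ} (h0 : 0 < α) (hr : 1 ≤ r) :
    ShiftLip (2 * α * r ^ (-α - 1)) ((symmParetoLaw α).restrict {z | r < |z|}) := by
  intro φ hφ h1 a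
  have := isProbabilityMeasure_symmParetoLaw h0
  have hr0 : 0 < r := by linarith
  have hm : MeasurableSet {z : ℝ | r < |z|} := measurableSet_lt measurable_const (by fun_prop)
  rw [← integral_indicator hm, integral_symmParetoLaw h0
    ((ShiftLip.integrable_shift_sub hφ h1 a).indicator hm)]
  set w : ℝ → ℝ := fun z => α / 2 * z ^ (-α - 1) with hw
  have hwi : IntegrableOn w (Set.Ioi r) :=
    (integrableOn_Ioi_rpow_of_lt (a := -α - 1) (by linarith) hr0).const_mul _
  have hE : Set.EqOn (fun z : ℝ => (α / 2 * z ^ (-α - 1)) •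
        ({z : ℝ | r < |z|}.indicator (fun x => φ (x + a) - φ x) z
          + {z : ℝ | r < |z|}.indicator (fun x => φ (x + a) - φ x) (-z)))
      ((Set.Ioi r).indicator (fun z => w z * (φ (z + a) - φ z)
        + w z * (φ (-(z + -a)) - φ (-z)))) (Set.Ioi 1) := fun z hz => by
    have hz : (1 : ℝ) < z := hz
    simp only [Set.indicator_apply, Set.mem_ofPred_eq, abs_neg, abs_of_pos (one_pos.trans hz),
      Set.mem_Ioi, smul_eq_mul, hw, neg_add, neg_neg]
    split_ifs <;> ring
  rw [setIntegral_congr_fun measurableSet_Ioi hE, setIntegral_indicator measurableSet_Ioi,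
    Set.Ioi_inter_Ioi, max_eq_right hr]
  have hint : ∀ {ψ : ℝ → ℝ}, Continuous ψ → (∀ x, |ψ x| ≤ 1) → ∀ b : ℝ,
      IntegrableOn (fun z => w z * (ψ (z + b) - ψ z)) (Set.Ioi r) := fun hψ hψ1 b =>
    Integrable.mul_bdd (c := 1 + 1) hwi (Continuous.aestronglyMeasurable (by fun_prop))
      (Eventually.of_forall fun z => (abs_sub _ _).trans (add_le_add (hψ1 _) (hψ1 _)))
  have hbound : ∀ {ψ : ℝ → ℝ}, Continuous ψ → (∀ x, |ψ x| ≤ 1) → ∀ b : ℝ,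
      |∫ z in Set.Ioi r, w z * (ψ (z + b) - ψ z)| ≤ 2 * (α / 2 * r ^ (-α - 1)) * |b| :=
    fun hψ hψ1 b => by
      refine abs_integral_Ioi_mul_shift_sub_le (fun z hz => ?_) (fun z hz => ?_)
        (fun y z hy hyz => ?_) hwi hψ hψ1 b
      · have : 0 < z := hr0.trans hz
        positivity
      · exact mul_le_mul_of_nonneg_left
          (Real.rpow_le_rpow_of_nonpos hr0 hz.le (by linarith)) (by positivity)
      · exact mul_le_mul_of_nonneg_left
          (Real.rpow_le_rpow_of_nonpos (hr0.trans hy) hyz (by linarith)) (by positivity)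
  have hφn : Continuous fun z => φ (-z) := by fun_prop
  rw [integral_add (hint hφ h1 a) (hint hφn (fun x => h1 _) (-a))]
  have b1 := hbound hφ h1 a
  have b2 := hbound hφn (fun x => h1 _) (-a)
  rw [abs_neg] at b2
  refine (abs_add_le _ _).trans ((add_le_add b1 b2).trans (le_of_eq ?_))
  ring

/-- The `2 ^ n`-fold convolution power of `μ`. -/
noncomputable def dyadicConv (μ : Measure ℝ) : ℕ → Measure ℝ
  | 0 => μ
  | n + 1 => dyadicConv μ n ∗ dyadicConv μ n

instance isFiniteMeasure_dyadicConv (μ : Measure ℝ) [IsFiniteMeasure μ] (n : ℕ) :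
    IsFiniteMeasure (dyadicConv μ n) := by
  induction n with
  | zero => assumption
  | succ n ih => exact Measure.finite_of_finite_conv _ _

instance isProbabilityMeasure_dyadicConv (μ : Measure ℝ) [IsProbabilityMeasure μ] (n : ℕ) :
    IsProbabilityMeasure (dyadicConv μ n) := by
  induction n with
  | zero => assumption
  | succ n ih => exact Measure.probabilitymeasure_of_probabilitymeasures_conv _ _

lemma dyadicConv_real_univ (μ : Measure ℝ) [IsFiniteMeasure μ] (n : ℕ) :
    (dyadicConv μ n).real Set.univ = μ.real Set.univ ^ 2 ^ n := by
  induction n with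
  | zero => simp [dyadicConv]
  | succ n ih => rw [dyadicConv, conv_real_univ, ih, ← pow_add, pow_succ, mul_two]

/-- In a convolution power of `A + B`, all terms in which `B` occurs are as smooth as `B`. -/
lemma exists_dyadicConv_add_eq {A B : Measure ℝ} [IsFiniteMeasure A] [IsFiniteMeasure B]
    (hAB : (A + B).real Set.univ ≤ 1) {L : ℝ} (hB : ShiftLip L B) (n : ℕ) :
    ∃ D : Measure ℝ, IsFiniteMeasure D ∧ dyadicConv (A + B) n = dyadicConv A n + D ∧
      ShiftLip (2 ^ n * L) D := by
  have hA : A.real Set.univ ≤ 1 := by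
    rw [measureReal_add_apply] at hAB
    linarith [measureReal_nonneg (μ := B) (s := Set.univ)]
  induction n with
  | zero => exact ⟨B, inferInstance, rfl, by simpa using hB⟩
  | succ n ih =>
    obtain ⟨D, hD, hdec, hL⟩ := ih
    refine ⟨dyadicConv A n ∗ D + D ∗ dyadicConv (A + B) n, inferInstance, ?_, ?_⟩
    · rw [dyadicConv, dyadicConv, ← add_assoc, ← Measure.conv_add, ← hdec]
      conv_lhs => enter [1]; rw [hdec]
      rw [Measure.add_conv]
    · have h1 := (hL.conv_right (ν := dyadicConv A n)).add
        (hL.conv_left (ν := dyadicConv (A + B) n))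
      refine h1.mono ?_
      have m1 : (dyadicConv A n).real Set.univ ≤ 1 := by
        rw [dyadicConv_real_univ]; exact pow_le_one₀ measureReal_nonneg hA
      have m2 : (dyadicConv (A + B) n).real Set.univ ≤ 1 := by
        rw [dyadicConv_real_univ]; exact pow_le_one₀ measureReal_nonneg hAB
      have := hL.nonneg
      rw [pow_succ]
      nlinarith

/-- The sum of `2 ^ n` Pareto variables is smooth at its natural scale `2 ^ (n / α)`. With
probability at least `1 - 1 / e` one of the first `2 ^ n` summands exceeds that scale, which is
smooth enough; on the complement the other `2 ^ n` summands give the bound of the previous step.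
The induction closes because `2 ^ (1 / α) / e < 1`. -/
lemma shiftLip_dyadicConv_symmParetoLaw {α : ℝ} (h1 : 1 < α) (n : ℕ) :
    ShiftLip (40 * α * 2 ^ (-(n : ℝ) / α)) (dyadicConv (symmParetoLaw α) n) := by
  have h0 : 0 < α := by linarith
  have := isProbabilityMeasure_symmParetoLaw h0
  have hms : ∀ r : ℝ, MeasurableSet {z : ℝ | r < |z|} := fun r =>
    measurableSet_lt measurable_const (by fun_prop)
  induction n with
  | zero =>
    have h := shiftLip_symmParetoLaw_restrict h0 le_rfl
    rw [Measure.restrict_eq_self_of_ae_mem] at h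
    · refine h.mono ?_
      simp only [Real.one_rpow, CharP.cast_eq_zero, neg_zero, zero_div, Real.rpow_zero]
      linarith
    · have h2 := symmParetoLaw_real_tail h0 le_rfl
      rw [Real.one_rpow] at h2
      change (symmParetoLaw α) {z : ℝ | 1 < |z|}ᶜ = 0
      rw [prob_compl_eq_zero_iff (hms 1),
        ← ENNReal.ofReal_toReal (measure_ne_top _ {z : ℝ | 1 < |z|}), ← measureReal_def, h2,
        ENNReal.ofReal_one]
  | succ n ih =>
    set r : ℝ := 2 ^ ((n : ℝ) / α) with hr
    have hr1 : 1 ≤ r := Real.one_le_rpow (by norm_num) (by positivity)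
    have hr0 : 0 < r := by linarith
    set l : ℝ := 2 ^ (-(n : ℝ) / α) with hl
    have hl0 : 0 < l := by positivity
    have hrl : r⁻¹ = l := by rw [hr, hl, ← Real.rpow_neg (by norm_num), neg_div]
    have hrα : r ^ (-α) = (2 ^ n)⁻¹ := by
      rw [hr, ← Real.rpow_mul (by norm_num), ← Real.rpow_natCast, ← Real.rpow_neg (by norm_num)]
      congr 1
      field_simp
    set A := (symmParetoLaw α).restrict {z : ℝ | r < |z|}ᶜ
    set B := (symmParetoLaw α).restrict {z : ℝ | r < |z|}
    have hdec : symmParetoLaw α = A + B := by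
      rw [add_comm]; exact (Measure.restrict_add_restrict_compl (hms r)).symm
    have hBm : B.real Set.univ = (2 ^ n)⁻¹ := by
      rw [measureReal_restrict_apply_univ, symmParetoLaw_real_tail h0 hr1, hrα]
    have hAB : (A + B).real Set.univ = 1 := by rw [← hdec]; simp
    have hAm : A.real Set.univ = 1 - (2 ^ n)⁻¹ := by
      rw [measureReal_add_apply, hBm] at hAB
      linarith
    have hB := shiftLip_symmParetoLaw_restrict h0 hr1
    obtain ⟨D, hD, hd, hDL⟩ := exists_dyadicConv_add_eq hAB.le hB n
    obtain ⟨D', hD', hd', hDL'⟩ := exists_dyadicConv_add_eq hAB.le hB (n + 1)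
    rw [← hdec] at hd hd'
    have hLB : 2 ^ n * (2 * α * r ^ (-α - 1)) = 2 * α * l := by
      rw [Real.rpow_sub_one hr0.ne', hrα, div_eq_mul_inv, hrl]
      field_simp
    have hLB' : 2 ^ (n + 1) * (2 * α * r ^ (-α - 1)) = 4 * α * l := by
      rw [pow_succ, mul_right_comm, hLB]; ring
    rw [hLB] at hDL
    rw [hLB'] at hDL'
    rw [hd] at ih
    have hA := (ih.of_add hDL).conv_left (ν := dyadicConv A n)
    have hmass : (dyadicConv A n).real Set.univ ≤ 0.37 := by
      rw [dyadicConv_real_univ, hAm]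
      have e1 : 1 - ((2 : ℝ) ^ n)⁻¹ ≤ Real.exp (-((2 : ℝ) ^ n)⁻¹) := by
        linarith [Real.add_one_le_exp (-((2 : ℝ) ^ n)⁻¹)]
      have e0 : 0 ≤ 1 - ((2 : ℝ) ^ n)⁻¹ := by rw [← hAm]; exact measureReal_nonneg
      calc (1 - ((2 : ℝ) ^ n)⁻¹) ^ 2 ^ n ≤ Real.exp (-((2 : ℝ) ^ n)⁻¹) ^ 2 ^ n := by gcongr
        _ = Real.exp (-1) := by
          rw [← Real.exp_nat_mul]
          congr 1
          push_cast
          field_simp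
        _ ≤ 0.37 := by linarith [Real.exp_neg_one_lt_d9]
    rw [hd']
    refine (hA.add hDL').mono ?_
    have hstep : l ≤ 2 * 2 ^ (-((n + 1 : ℕ) : ℝ) / α) := by
      have : (2 : ℝ) * 2 ^ (-((n + 1 : ℕ) : ℝ) / α) = 2 ^ (1 + -((n + 1 : ℕ) : ℝ) / α) := by
        rw [Real.rpow_add (by norm_num), Real.rpow_one]
      rw [this, hl]
      refine Real.rpow_le_rpow_of_exponent_le (by norm_num) ?_
      push_cast
      rw [show 1 + -((n : ℝ) + 1) / α = -(n : ℝ) / α + (1 - 1 / α) by ring]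
      have : 1 / α ≤ 1 := by rw [div_le_one h0]; exact h1.le
      linarith
    have hnn : 0 ≤ 40 * α * l + 2 * α * l := by positivity
    have hαl : 0 < α * l := by positivity
    -- `0.37` is an upper bound of `1 / e`, and `(40 + 2) * 0.37 + 4 ≤ 20`
    calc _ ≤ (40 * α * l + 2 * α * l) * 0.37 + 4 * α * l := by gcongr
      _ ≤ 20 * α * l := by nlinarith
      _ ≤ 20 * α * (2 * 2 ^ (-((n + 1 : ℕ) : ℝ) / α)) := by gcongr
      _ = _ := by ring

/-! ### Comparison of the Pareto and the stable law on twice differentiable functions -/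

/-- All second differences of `g` are bounded as if `|g''| ≤ K`. -/
def SecondDiffLe (K : ℝ) (g : ℝ → ℝ) : Prop :=
  ∀ x a b, |g (x + a + b) - g (x + a) - g (x + b) + g x| ≤ K * |a| * |b|

lemma SecondDiffLe.nonneg {K : ℝ} {g : ℝ → ℝ} (h : SecondDiffLe K g) : 0 ≤ K := by
  simpa using (abs_nonneg _).trans (h 0 1 1)

lemma SecondDiffLe.comp_const_add {K : ℝ} {g : ℝ → ℝ} (h : SecondDiffLe K g) (y : ℝ) :
    SecondDiffLe K fun x => g (y + x) := fun x a b => by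
  simpa only [← add_assoc] using h (y + x) a b

lemma SecondDiffLe.comp_const_mul {K : ℝ} {g : ℝ → ℝ} (h : SecondDiffLe K g) (c : ℝ) :
    SecondDiffLe (c ^ 2 * K) fun x => g (c * x) := fun x a b => by
  simp only [mul_add]
  refine (h (c * x) (c * a) (c * b)).trans (le_of_eq ?_)
  rw [abs_mul, abs_mul, ← sq_abs c]
  ring

/-- The Zolotarev distance of order two of `μ` and `ν` is at most `C`, tested on bounded continuous
functions. -/
def ZetaTwoLe (C : ℝ) (μ ν : Measure ℝ) : Prop :=
  ∀ (K : ℝ) (g : ℝ → ℝ), Continuous g → (∃ B, ∀ x, |g x| ≤ B) → SecondDiffLe K g →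
    |∫ x, g x ∂μ - ∫ x, g x ∂ν| ≤ C * K

namespace ZetaTwoLe

variable {C C' : ℝ} {μ ν ρ : Measure ℝ}

lemma trans (h : ZetaTwoLe C μ ν) (h' : ZetaTwoLe C' ν ρ) : ZetaTwoLe (C + C') μ ρ :=
  fun K g hg hB hK => by
    have h1 := h K g hg hB hK
    have h2 := h' K g hg hB hK
    rw [abs_le] at h1 h2 ⊢
    rw [add_mul]
    constructor <;> linarith [h1.1, h1.2, h2.1, h2.2]

lemma map_mul (h : ZetaTwoLe C μ ν) (c : ℝ) :
    ZetaTwoLe (c ^ 2 * C) (μ.map (fun x => c * x)) (ν.map (fun x => c * x)) :=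
  fun K g hg ⟨B, hB⟩ hK => by
    rw [integral_map (by fun_prop) (by fun_prop), integral_map (by fun_prop) (by fun_prop)]
    refine (h _ _ (by fun_prop) ⟨B, fun x => hB _⟩ (hK.comp_const_mul c)).trans (le_of_eq ?_)
    ring

lemma conv_left [IsProbabilityMeasure μ] [IsProbabilityMeasure ν] [IsProbabilityMeasure ρ]
    (h : ZetaTwoLe C μ ν) : ZetaTwoLe C (ρ ∗ μ) (ρ ∗ ν) := fun K g hg ⟨B, hB⟩ hK => by
  rw [integral_conv_of_continuous hg hB, integral_conv_of_continuous hg hB, ← integral_sub]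
  · refine (abs_integral_le_of_abs_le fun x =>
      h K _ (by fun_prop) ⟨B, fun y => hB _⟩ (hK.comp_const_add x)).trans (le_of_eq ?_)
    simp
  all_goals
    refine integrable_of_continuous_of_abs_le (continuous_integral_comp_add hg hB) (B := B)
      fun x => (abs_integral_le_of_abs_le fun y => hB (x + y)).trans (le_of_eq (by simp))

lemma dyadicConv [IsProbabilityMeasure μ] [IsProbabilityMeasure ν] (h : ZetaTwoLe C μ ν) (n : ℕ) :
    ZetaTwoLe (2 ^ n * C) (dyadicConv μ n) (dyadicConv ν n) := by
  induction n with
  | zero => simpa [_root_.dyadicConv] using h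
  | succ n ih =>
    have h1 := ih.conv_left (ρ := _root_.dyadicConv μ n)
    have h2 := ih.conv_left (ρ := _root_.dyadicConv ν n)
    rw [Measure.conv_comm (_root_.dyadicConv ν n) (_root_.dyadicConv μ n)] at h2
    have := h1.trans h2
    rw [_root_.dyadicConv, _root_.dyadicConv, pow_succ]
    convert this using 1
    ring

end ZetaTwoLe

lemma dyadicConv_map_mul (μ : Measure ℝ) [IsFiniteMeasure μ] (c : ℝ) (n : ℕ) :
    dyadicConv (μ.map (fun x => c * x)) n = (dyadicConv μ n).map (fun x => c * x) := by
  induction n with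
  | zero => rfl
  | succ n ih =>
    rw [dyadicConv, ih, dyadicConv]
    exact (Measure.map_conv_addMonoidHom (AddMonoidHom.mulLeft c) (measurable_const_mul c)).symm

lemma dyadicConv_conv_self (μ : Measure ℝ) (n : ℕ) :
    dyadicConv (μ ∗ μ) n = dyadicConv μ (n + 1) := by
  induction n with
  | zero => rfl
  | succ n ih => rw [dyadicConv, ih]; rfl

lemma charFun_dyadicConv (μ : Measure ℝ) [IsFiniteMeasure μ] (n : ℕ) (t : ℝ) :
    charFun (dyadicConv μ n) t = charFun μ t ^ 2 ^ n := by
  induction n with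
  | zero => simp [dyadicConv]
  | succ n ih => rw [dyadicConv, charFun_conv, ih, ← pow_add, pow_succ, mul_two]

/-- The annulus between the radii `a` and `1` contributes a second order term. -/
lemma abs_integral_annulus_le {α a K : ℝ} (h0 : 0 < α) (h2 : α < 2) (ha0 : 0 < a)
    {g : ℝ → ℝ} (hK : SecondDiffLe K g) :
    |∫ z in Set.Ioc a 1, (α / 2 * z ^ (-α - 1)) * (g z + g (-z) - 2 * g 0)|
      ≤ α / 2 / (2 - α) * K := by
  have hK0 := hK.nonneg
  have hr : IntegrableOn (fun z : ℝ => α / 2 * K * z ^ (1 - α)) (Set.Ioc 0 1) :=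
    ((intervalIntegrable_iff_integrableOn_Ioc_of_le zero_le_one).1
      (intervalIntegral.intervalIntegrable_rpow' (by linarith))).const_mul _
  have hsub : Set.Ioc a 1 ⊆ Set.Ioc 0 1 := Set.Ioc_subset_Ioc_left ha0.le
  calc |∫ z in Set.Ioc a 1, (α / 2 * z ^ (-α - 1)) * (g z + g (-z) - 2 * g 0)|
      ≤ ∫ z in Set.Ioc a 1, α / 2 * K * z ^ (1 - α) := by
        refine norm_integral_le_of_norm_le
          (f := fun z => (α / 2 * z ^ (-α - 1)) * (g z + g (-z) - 2 * g 0)) (hr.mono_set hsub) ?_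
        filter_upwards [ae_restrict_mem measurableSet_Ioc] with z hz
        have hz0 : 0 < z := ha0.trans hz.1
        have h := hK (-z) z z
        rw [neg_add_cancel, zero_add, abs_of_pos hz0] at h
        have e : g z - g 0 - g 0 + g (-z) = g z + g (-z) - 2 * g 0 := by ring
        rw [e] at h
        rw [norm_mul, Real.norm_of_nonneg (by positivity), Real.norm_eq_abs,
          show 1 - α = 2 + (-α - 1) by ring, Real.rpow_add hz0, Real.rpow_two]
        calc α / 2 * z ^ (-α - 1) * |g z + g (-z) - 2 * g 0|
            ≤ α / 2 * z ^ (-α - 1) * (K * z * z) := by gcongr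
          _ = _ := by ring
    _ ≤ ∫ z in Set.Ioc 0 1, α / 2 * K * z ^ (1 - α) := by
        refine setIntegral_mono_set hr ?_ hsub.eventuallyLE
        filter_upwards [ae_restrict_mem measurableSet_Ioc] with z hz
        have hz0 : 0 < z := hz.1
        positivity
    _ = α / 2 / (2 - α) * K := by
        rw [integral_const_mul, ← intervalIntegral.integral_of_le zero_le_one,
          integral_rpow (Or.inl (by linarith)), show 1 - α + 1 = 2 - α by ring,
          Real.zero_rpow (by linarith), Real.one_rpow]
        field_simp
        ring

/-- Rescaling the Pareto law by `a` multiplies its tail measure by `a ^ α` and adds the annulus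
between `a` and `1`. -/
lemma integral_symmParetoLaw_scaled {α a : ℝ} (h0 : 0 < α) (ha0 : 0 < a) (ha1 : a ≤ 1)
    {g : ℝ → ℝ} (hg : Continuous g) {B : ℝ} (hB : ∀ x, |g x| ≤ B) :
    a ^ (-α) * (∫ z, g (a * z) ∂(symmParetoLaw α) - g 0)
      = (∫ z, g z ∂(symmParetoLaw α) - g 0)
        + ∫ z in Set.Ioc a 1, (α / 2 * z ^ (-α - 1)) * (g z + g (-z) - 2 * g 0) := by
  have := isProbabilityMeasure_symmParetoLaw h0
  have hcent : ∀ c : ℝ, ∫ z, g (c * z) ∂(symmParetoLaw α) - g 0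
      = ∫ z in Set.Ioi 1, (α / 2 * z ^ (-α - 1)) * (g (c * z) + g (-(c * z)) - 2 * g 0) := by
    intro c
    have hi : Integrable (fun z => g (c * z)) (symmParetoLaw α) :=
      integrable_of_continuous_of_abs_le (by fun_prop) (fun x => hB _)
    have h1 : ∫ z, (g (c * z) - g 0) ∂(symmParetoLaw α)
        = ∫ z, g (c * z) ∂(symmParetoLaw α) - g 0 := by
      rw [integral_sub hi (integrable_const _)]
      simp
    have hi' : Integrable (fun z => g (c * z) - g 0) (symmParetoLaw α) :=
      hi.sub (integrable_const _)
    rw [← h1, integral_symmParetoLaw h0 hi']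
    congr 1
    ext z
    rw [smul_eq_mul, mul_neg]
    ring
  have h1 := hcent 1
  simp only [one_mul] at h1
  have hint : IntegrableOn (fun z : ℝ => (α / 2 * z ^ (-α - 1)) * (g z + g (-z) - 2 * g 0))
      (Set.Ioi a) := by
    have hw : IntegrableOn (fun z : ℝ => α / 2 * z ^ (-α - 1)) (Set.Ioi a) :=
      (integrableOn_Ioi_rpow_of_lt (by linarith) ha0).const_mul _
    refine Integrable.mul_bdd (c := B + B + 2 * B) hw
      (Continuous.aestronglyMeasurable (by fun_prop)) (Eventually.of_forall fun z => ?_)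
    rw [Real.norm_eq_abs]
    have b1 := abs_le.1 (hB z)
    have b2 := abs_le.1 (hB (-z))
    have b3 := abs_le.1 (hB 0)
    rw [abs_le]
    constructor <;> linarith [b1.1, b1.2, b2.1, b2.2, b3.1, b3.2]
  have e1 := integral_comp_mul_left_Ioi
    (fun y => (α / 2 * (y / a) ^ (-α - 1)) * (g y + g (-y) - 2 * g 0)) 1 ha0
  simp only [mul_div_cancel_left₀ _ ha0.ne', mul_one] at e1
  have e2 : Set.EqOn (fun y => (α / 2 * (y / a) ^ (-α - 1)) * (g y + g (-y) - 2 * g 0))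
      (fun y => a ^ (α + 1) * ((α / 2 * y ^ (-α - 1)) * (g y + g (-y) - 2 * g 0)))
      (Set.Ioi a) := fun y hy => by
    have hy : 0 < y := ha0.trans hy
    simp only
    rw [Real.div_rpow hy.le ha0.le, show -α - 1 = -(α + 1) by ring, Real.rpow_neg ha0.le (α + 1)]
    field_simp
  rw [hcent a, e1, setIntegral_congr_fun measurableSet_Ioi e2, integral_const_mul, h1,
    ← Set.Ioc_union_Ioi_eq_Ioi ha1, setIntegral_union Set.Ioc_disjoint_Ioi_same
      measurableSet_Ioi (hint.mono_set Set.Ioc_subset_Ioi_self)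
      (hint.mono_set (Set.Ioi_subset_Ioi ha1)), smul_eq_mul, Real.rpow_add_one ha0.ne',
    Real.rpow_neg ha0.le]
  have : a ^ α ≠ 0 := (Real.rpow_pos_of_pos ha0 α).ne'
  field_simp
  ring

lemma integral_sub_const_sub_add_const {μ : Measure ℝ} [IsProbabilityMeasure μ] {f h : ℝ → ℝ}
    (hf : Integrable f μ) (hh : Integrable h μ) (b c : ℝ) :
    ∫ x, (f x - b - h x + c) ∂μ = ∫ x, f x ∂μ - b - ∫ x, h x ∂μ + c := by
  have h1 : Integrable (fun x => f x - b) μ := hf.sub (integrable_const _)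
  have h2 : Integrable (fun x => f x - b - h x) μ := h1.sub hh
  rw [integral_add h2 (integrable_const _), integral_sub h1 hh,
    integral_sub hf (integrable_const _)]
  simp

/-- One Pareto variable and the normalised sum of two are at finite distance. The diagonal terms
agree up to the annulus by the scaling of the tail, and the interaction is a second difference. -/
lemma exists_zetaTwoLe_symmParetoLaw {α : ℝ} (h1 : 1 < α) (h2 : α < 2) :
    ∃ C, 0 ≤ C ∧ ZetaTwoLe C (symmParetoLaw α)
      ((symmParetoLaw α ∗ symmParetoLaw α).map (fun x => 2 ^ (-1 / α) * x)) := by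
  have h0 : 0 < α := by linarith
  have := isProbabilityMeasure_symmParetoLaw h0
  set a : ℝ := 2 ^ (-1 / α) with ha
  have ha0 : 0 < a := by positivity
  have ha1 : a ≤ 1 := Real.rpow_le_one_of_one_le_of_nonpos (by norm_num)
    (div_nonpos_of_nonpos_of_nonneg (by norm_num) h0.le)
  have haα : a ^ (-α) = 2 := by
    rw [ha, ← Real.rpow_mul (by norm_num), show -1 / α * -α = 1 by field_simp, Real.rpow_one]
  set m : ℝ := ∫ z, |z| ∂(symmParetoLaw α) with hm
  have hm0 : 0 ≤ m := integral_nonneg fun z => abs_nonneg _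
  have hmi : Integrable (fun z => |z|) (symmParetoLaw α) := (integrable_id_symmParetoLaw h1).abs
  refine ⟨α / 2 / (2 - α) + m * m, ?_, fun K g hg hgB hK => ?_⟩
  · have : 0 < 2 - α := by linarith
    positivity
  obtain ⟨B, hB⟩ := hgB
  have hK0 := hK.nonneg
  rw [integral_map (by fun_prop) (by fun_prop),
    integral_conv_of_continuous (φ := fun x => g (a * x)) (by fun_prop) (fun x => hB _)]
  have hs := integral_symmParetoLaw_scaled h0 ha0 ha1 hg hB
  rw [haα] at hs
  have hann := abs_integral_annulus_le h0 h2 ha0 hK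
  have hi : ∀ b c : ℝ, Integrable (fun z => g (b + c * z)) (symmParetoLaw α) := fun b c =>
    integrable_of_continuous_of_abs_le (by fun_prop) (fun x => hB _)
  have hi1 := hi 0 a
  simp only [zero_add] at hi1
  have hcross : |∫ x, ∫ y, (g (a * x + a * y) - g (a * x) - g (a * y) + g 0)
      ∂(symmParetoLaw α) ∂(symmParetoLaw α)| ≤ K * (m * m) := by
    have hin : ∀ x, |∫ y, (g (a * x + a * y) - g (a * x) - g (a * y) + g 0) ∂(symmParetoLaw α)|
        ≤ K * m * |x| := fun x => by
      have : K * m * |x| = ∫ y, K * |x| * |y| ∂(symmParetoLaw α) := by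
        rw [integral_const_mul, ← hm]; ring
      rw [this]
      refine norm_integral_le_of_norm_le
        (f := fun y => g (a * x + a * y) - g (a * x) - g (a * y) + g 0) (hmi.const_mul _)
        (Eventually.of_forall fun y => ?_)
      have := hK 0 (a * x) (a * y)
      simp only [zero_add] at this
      refine this.trans ?_
      rw [abs_mul, abs_mul, abs_of_pos ha0]
      have hx := abs_nonneg x
      have hy := abs_nonneg y
      have : a * |x| ≤ |x| := mul_le_of_le_one_left hx ha1
      have : a * |y| ≤ |y| := mul_le_of_le_one_left hy ha1
      gcongr
    have : K * (m * m) = ∫ x, K * m * |x| ∂(symmParetoLaw α) := by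
      rw [integral_const_mul, ← hm]; ring
    rw [this]
    exact norm_integral_le_of_norm_le
      (f := fun x => ∫ y, (g (a * x + a * y) - g (a * x) - g (a * y) + g 0) ∂(symmParetoLaw α))
      (hmi.const_mul _) (Eventually.of_forall hin)
  have hexp : ∫ x, ∫ y, (g (a * x + a * y) - g (a * x) - g (a * y) + g 0)
      ∂(symmParetoLaw α) ∂(symmParetoLaw α)
      = (∫ x, ∫ y, g (a * (x + y)) ∂(symmParetoLaw α) ∂(symmParetoLaw α))
        - 2 * ∫ z, g (a * z) ∂(symmParetoLaw α) + g 0 := by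
    have e1 : ∀ x, ∫ y, (g (a * x + a * y) - g (a * x) - g (a * y) + g 0) ∂(symmParetoLaw α)
        = (∫ y, g (a * (x + y)) ∂(symmParetoLaw α)) - g (a * x)
          - (∫ y, g (a * y) ∂(symmParetoLaw α)) + g 0 := fun x => by
      rw [integral_sub_const_sub_add_const (hi (a * x) a) hi1]
      simp only [mul_add]
    simp only [e1]
    have hc : Integrable (fun x => ∫ y, g (a * (x + y)) ∂(symmParetoLaw α)) (symmParetoLaw α) :=
      integrable_of_continuous_of_abs_le
        (continuous_integral_comp_add (φ := fun x => g (a * x)) (by fun_prop) (fun x => hB _))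
        (B := B) fun x => (abs_integral_le_of_abs_le fun y => hB (a * (x + y))).trans
          (le_of_eq (by simp))
    simp only [sub_right_comm _ (g _)]
    rw [integral_sub_const_sub_add_const hc hi1]
    ring
  -- by `hs`, `∫ g - g 0` and its rescaled version, taken twice, differ by the annulus term
  rw [hexp] at hcross
  rw [abs_le] at hcross hann ⊢
  rw [add_mul]
  constructor <;> linarith [hcross.1, hcross.2, hann.1, hann.2]

/-! ### The stable law as the limit of normalised Pareto sums -/

/-- The law of the normalised sum of `2 ^ n` independent scaled Pareto variables. -/
noncomputable def paretoSum (α : ℝ) (n : ℕ) : Measure ℝ :=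
  (dyadicConv (unitPareto α) n).map (fun x => 2 ^ (-(n : ℝ) / α) * x)

lemma isProbabilityMeasure_paretoSum {α : ℝ} (h0 : 0 < α) (n : ℕ) :
    IsProbabilityMeasure (paretoSum α n) := by
  have := isProbabilityMeasure_unitPareto h0
  exact Measure.isProbabilityMeasure_map (by fun_prop)

lemma map_mul_map_mul (μ : Measure ℝ) (c d : ℝ) :
    (μ.map (fun x => c * x)).map (fun x => d * x) = μ.map (fun x => d * c * x) := by
  rw [Measure.map_map (by fun_prop) (by fun_prop)]
  congr 1
  ext x
  simp [mul_assoc]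

lemma shiftLip_paretoSum {α : ℝ} (h1 : 1 < α) (h2 : α < 2) (n : ℕ) :
    ShiftLip (40 * α * paretoScale α) (paretoSum α n) := by
  have h0 : 0 < α := by linarith
  have := isProbabilityMeasure_symmParetoLaw h0
  have hβ := paretoScale_pos h0 h2
  have hl : (0 : ℝ) < 2 ^ (-(n : ℝ) / α) := by positivity
  rw [paretoSum, unitPareto, dyadicConv_map_mul]
  have h := ((shiftLip_dyadicConv_symmParetoLaw h1 n).map_mul (inv_ne_zero hβ.ne')).map_mul hl.ne'
  refine h.mono (le_of_eq ?_)
  rw [abs_of_pos hl, abs_of_pos (inv_pos.2 hβ), inv_inv]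
  field_simp

lemma exists_zetaTwoLe_paretoSum {α : ℝ} (h1 : 1 < α) (h2 : α < 2) :
    ∃ C, 0 ≤ C ∧ ∀ n, ZetaTwoLe C (unitPareto α) (paretoSum α n) := by
  have h0 : 0 < α := by linarith
  have := isProbabilityMeasure_symmParetoLaw h0
  have := isProbabilityMeasure_unitPareto h0
  have hβ := paretoScale_pos h0 h2
  obtain ⟨C, hC0, hC⟩ := exists_zetaTwoLe_symmParetoLaw h1 h2
  set β := paretoScale α with hβd
  have hbase : ZetaTwoLe (β⁻¹ ^ 2 * C) (unitPareto α)
      ((unitPareto α ∗ unitPareto α).map (fun x => 2 ^ (-1 / α) * x)) := by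
    have h := hC.map_mul β⁻¹
    have hu : (unitPareto α ∗ unitPareto α)
        = (symmParetoLaw α ∗ symmParetoLaw α).map (fun x => β⁻¹ * x) :=
      dyadicConv_map_mul (symmParetoLaw α) β⁻¹ 1
    rw [map_mul_map_mul] at h
    rwa [hu, map_mul_map_mul, mul_comm (2 ^ (-1 / α)) β⁻¹]
  set q : ℝ := 2 ^ (1 - 2 / α) with hq
  have hq0 : 0 < q := by positivity
  have hq1 : q < 1 := by
    refine Real.rpow_lt_one_of_one_lt_of_neg (by norm_num) ?_
    rw [sub_neg, lt_div_iff₀ h0]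
    linarith
  have hstep : ∀ n, ZetaTwoLe (q ^ n * (β⁻¹ ^ 2 * C)) (paretoSum α n) (paretoSum α (n + 1)) := by
    intro n
    have hm : IsProbabilityMeasure
        ((unitPareto α ∗ unitPareto α).map (fun x => (2 : ℝ) ^ (-1 / α) * x)) :=
      Measure.isProbabilityMeasure_map (by fun_prop)
    have h := (hbase.dyadicConv n).map_mul (2 ^ (-(n : ℝ) / α))
    have e1 : (dyadicConv ((unitPareto α ∗ unitPareto α).map (fun x => (2 : ℝ) ^ (-1 / α) * x))
        n).map (fun x => 2 ^ (-(n : ℝ) / α) * x) = paretoSum α (n + 1) := by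
      rw [dyadicConv_map_mul, dyadicConv_conv_self, map_mul_map_mul, paretoSum,
        ← Real.rpow_add (by norm_num)]
      congr 3
      push_cast
      ring_nf
    rw [e1] at h
    have e2 : q ^ n = ((2 : ℝ) ^ (-(n : ℝ) / α)) ^ 2 * 2 ^ n := by
      rw [hq, ← Real.rpow_natCast _ n, ← Real.rpow_natCast _ n, ← Real.rpow_natCast _ 2,
        ← Real.rpow_mul (by norm_num), ← Real.rpow_mul (by norm_num), ← Real.rpow_add (by norm_num)]
      congr 1
      push_cast
      ring
    rw [e2, mul_assoc]
    exact h
  have hsum : ∀ n, ZetaTwoLe ((∑ i ∈ Finset.range n, q ^ i) * (β⁻¹ ^ 2 * C))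
      (unitPareto α) (paretoSum α n) := by
    intro n
    induction n with
    | zero =>
      have : paretoSum α 0 = unitPareto α := by
        simp [paretoSum, dyadicConv]
      rw [this]
      intro K g _ _ _
      simp
    | succ n ih =>
      rw [Finset.sum_range_succ, add_mul]
      exact ih.trans (hstep n)
  refine ⟨(1 - q)⁻¹ * (β⁻¹ ^ 2 * C), ?_, fun n K g hg hB hK => ?_⟩
  · have : 0 < 1 - q := by linarith
    positivity
  · refine (hsum n K g hg hB hK).trans ?_
    have := hK.nonneg
    gcongr
    rw [← tsum_geometric_of_lt_one hq0.le hq1]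
    exact (summable_geometric_of_lt_one hq0.le hq1).sum_le_tsum _ (fun i _ => by positivity)

lemma tendsto_charFun_paretoSum {α : ℝ} (h0 : 0 < α) (h2 : α < 2) (t : ℝ) :
    Tendsto (fun n => charFun (paretoSum α n) t) atTop
      (𝓝 ((Real.exp (-|t| ^ α) : ℝ) : ℂ)) := by
  have := isProbabilityMeasure_unitPareto h0
  obtain ⟨c, C, q, hc, hC, hφ, hq, -⟩ := exists_charFun_unitPareto h0 h2
  have e : ∀ n : ℕ, charFun (paretoSum α n) t
      = (((1 + (-|(2 ^ n : ℝ) ^ (-1 / α) * t| ^ α + q ((2 ^ n : ℝ) ^ (-1 / α) * t))) ^ ((2 : ℝ) ^ n)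
        : ℝ) : ℂ) := fun n => by
    rw [paretoSum, charFun_map_mul, charFun_dyadicConv, hφ]
    have : (2 : ℝ) ^ (-(n : ℝ) / α) = (2 ^ n : ℝ) ^ (-1 / α) := by
      rw [← Real.rpow_natCast, ← Real.rpow_mul (by norm_num)]
      congr 1; ring
    rw [this, show ((2 : ℝ) ^ n) = ((2 ^ n : ℕ) : ℝ) by push_cast; rfl, Real.rpow_natCast,
      ← Complex.ofReal_pow]
    congr 2
    push_cast
    ring
  simp only [e]
  refine (Complex.continuous_ofReal.tendsto _).comp ?_
  have hg : Tendsto (fun x : ℝ => x * (-|x ^ (-1 / α) * t| ^ α + q (x ^ (-1 / α) * t))) atTop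
      (𝓝 (-|t| ^ α)) := by
    have h1 : Tendsto (fun x : ℝ => -|t| ^ α + x * q (x ^ (-1 / α) * t)) atTop
        (𝓝 (-|t| ^ α + 0)) := by
      refine tendsto_const_nhds.add ?_
      have h3 : Tendsto (fun x : ℝ => C * t ^ 2 * x ^ (-(2 / α - 1))) atTop
          (𝓝 (C * t ^ 2 * 0)) := by
        refine (tendsto_rpow_neg_atTop ?_).const_mul _
        rw [sub_pos, lt_div_iff₀ h0]
        linarith
      rw [mul_zero] at h3
      refine squeeze_zero' ?_ ?_ h3
      · filter_upwards [eventually_gt_atTop 0] with x hx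
        exact mul_nonneg hx.le (hq _).1
      · filter_upwards [eventually_gt_atTop 0] with x hx
        calc x * q (x ^ (-1 / α) * t) ≤ x * (C * (x ^ (-1 / α) * t) ^ 2) := by
              gcongr; exact (hq _).2
          _ = C * t ^ 2 * (x * (x ^ (-1 / α)) ^ 2) := by ring
          _ = C * t ^ 2 * x ^ (-(2 / α - 1)) := by
              rw [← Real.rpow_natCast (x ^ (-1 / α)) 2, ← Real.rpow_mul hx.le,
                ← Real.rpow_one_add' hx.le]
              · congr 2; push_cast; ring
              · push_cast
                have : 1 < 2 / α := by rw [lt_div_iff₀ h0]; linarith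
                intro h
                have : -1 / α * 2 = -(2 / α) := by ring
                linarith
    rw [add_zero] at h1
    refine h1.congr' ?_
    filter_upwards [eventually_gt_atTop 0] with x hx
    have hx' : (0 : ℝ) < x ^ (-1 / α) := by positivity
    rw [abs_mul, abs_of_pos hx', Real.mul_rpow hx'.le (abs_nonneg t), ← Real.rpow_mul hx.le,
      div_mul_cancel₀ _ h0.ne', Real.rpow_neg_one, mul_add, mul_neg, mul_inv_cancel_left₀ hx.ne']
  have h3 := Real.tendsto_one_add_rpow_exp_of_tendsto hg
  exact h3.comp (tendsto_pow_atTop_atTop_of_one_lt (by norm_num : (1 : ℝ) < 2))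

section StableLimit

variable {α : ℝ} {S : Measure ℝ} [IsProbabilityMeasure S]

lemma tendsto_integral_paretoSum (h0 : 0 < α) (h2 : α < 2)
    (hS : ∀ u, charFun S u = ((Real.exp (-|u| ^ α) : ℝ) : ℂ)) {f : ℝ → ℝ} (hf : Continuous f)
    {B : ℝ} (hB : ∀ x, |f x| ≤ B) :
    Tendsto (fun n => ∫ x, f x ∂(paretoSum α n)) atTop (𝓝 (∫ x, f x ∂S)) := by
  have hp := isProbabilityMeasure_paretoSum h0
  let μ : ℕ → ProbabilityMeasure ℝ := fun n => ⟨paretoSum α n, hp n⟩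
  let μ₀ : ProbabilityMeasure ℝ := ⟨S, inferInstance⟩
  have h : Tendsto μ atTop (𝓝 μ₀) := by
    refine ProbabilityMeasure.tendsto_of_tendsto_charFun fun t => ?_
    change Tendsto (fun n => charFun (paretoSum α n) t) atTop (𝓝 (charFun S t))
    rw [hS]
    exact tendsto_charFun_paretoSum h0 h2 t
  rw [ProbabilityMeasure.tendsto_iff_forall_integral_tendsto] at h
  exact h (BoundedContinuousFunction.ofNormedAddCommGroup f hf B hB)

/-- The stable law has shifts that are Lipschitz in total variation, that is, a density of
bounded variation. -/
lemma shiftLip_stable (h1 : 1 < α) (h2 : α < 2)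
    (hS : ∀ u, charFun S u = ((Real.exp (-|u| ^ α) : ℝ) : ℂ)) :
    ShiftLip (40 * α * paretoScale α) S := fun φ hφ hφ1 a => by
  have ht := tendsto_integral_paretoSum (f := fun x => φ (x + a) - φ x) (by linarith) h2 hS
    (by fun_prop) (B := 1 + 1) fun x => (abs_sub _ _).trans (add_le_add (hφ1 _) (hφ1 _))
  exact le_of_tendsto ht.abs (Eventually.of_forall fun n => shiftLip_paretoSum h1 h2 n φ hφ hφ1 a)

/-- The Pareto and the stable law are at finite Zolotarev distance of order two. -/
lemma exists_zetaTwoLe_stable (h1 : 1 < α) (h2 : α < 2)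
    (hS : ∀ u, charFun S u = ((Real.exp (-|u| ^ α) : ℝ) : ℂ)) :
    ∃ C, 0 ≤ C ∧ ZetaTwoLe C (unitPareto α) S := by
  obtain ⟨C, hC0, hC⟩ := exists_zetaTwoLe_paretoSum h1 h2
  refine ⟨C, hC0, fun K g hg ⟨B, hB⟩ hK => ?_⟩
  have ht := (tendsto_const_nhds (x := ∫ x, g x ∂(unitPareto α))).sub
    (tendsto_integral_paretoSum (by linarith) h2 hS hg hB)
  exact le_of_tendsto ht.abs (Eventually.of_forall fun n => hC n K g hg ⟨B, hB⟩ hK)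

lemma stable_real_tail_le (h0 : 0 < α)
    (hS : ∀ u, charFun S u = ((Real.exp (-|u| ^ α) : ℝ) : ℂ)) {r : ℝ} (hr : 0 < r) :
    S.real {x | r < |x|} ≤ 2 * 2 ^ α * r ^ (-α) := by
  refine (measureReal_abs_gt_le_integral_charFun hr).trans ?_
  have h : ‖∫ t in (-2 * r⁻¹)..(2 * r⁻¹), 1 - charFun S t‖
      ≤ (2 * r⁻¹) ^ α * |2 * r⁻¹ - -2 * r⁻¹| := by
    refine intervalIntegral.norm_integral_le_of_norm_le_const fun t ht => ?_
    rw [Set.uIoc_of_le (by have := inv_pos.2 hr; linarith)] at ht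
    have ht' : |t| ≤ 2 * r⁻¹ := abs_le.2 ⟨by linarith [ht.1], ht.2⟩
    rw [hS, ← Complex.ofReal_one, ← Complex.ofReal_sub, Complex.norm_real, Real.norm_of_nonneg]
    · have h1 := Real.add_one_le_exp (-|t| ^ α)
      have h2 : |t| ^ α ≤ (2 * r⁻¹) ^ α := by gcongr
      linarith
    · rw [sub_nonneg, Real.exp_le_one_iff, neg_nonpos]
      positivity
  calc 2⁻¹ * r * ‖∫ t in (-2 * r⁻¹)..(2 * r⁻¹), 1 - charFun S t‖
      ≤ 2⁻¹ * r * ((2 * r⁻¹) ^ α * |2 * r⁻¹ - -2 * r⁻¹|) := by gcongr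
    _ = 2 * 2 ^ α * r ^ (-α) := by
      rw [show 2 * r⁻¹ - -2 * r⁻¹ = 4 * r⁻¹ by ring, abs_of_pos (by positivity),
        Real.mul_rpow (by norm_num) (by positivity), Real.inv_rpow hr.le, Real.rpow_neg hr.le]
      field_simp
      norm_num

lemma integrable_id_stable (h1 : 1 < α)
    (hS : ∀ u, charFun S u = ((Real.exp (-|u| ^ α) : ℝ) : ℂ)) : Integrable (fun x => x) S := by
  have h0 : 0 < α := by linarith
  rw [← integrable_norm_iff (by fun_prop)]
  refine ⟨by fun_prop, ?_⟩
  rw [hasFiniteIntegral_iff_ofReal (Eventually.of_forall fun x => norm_nonneg x),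
    lintegral_eq_lintegral_meas_lt S (Eventually.of_forall fun x => norm_nonneg x) (by fun_prop),
    ← Set.Ioc_union_Ioi_eq_Ioi zero_le_one]
  refine (lintegral_union_le _ _ _).trans_lt (ENNReal.add_lt_top.2 ⟨?_, ?_⟩)
  · calc ∫⁻ t in Set.Ioc 0 1, S {x | t < ‖x‖} ≤ ∫⁻ t in Set.Ioc (0 : ℝ) 1, 1 :=
          lintegral_mono fun t => prob_le_one
      _ < ⊤ := by simp
  · have hi : IntegrableOn (fun t : ℝ => 2 * 2 ^ α * t ^ (-α)) (Set.Ioi 1) :=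
      (integrableOn_Ioi_rpow_of_lt (by linarith) one_pos).const_mul _
    refine lt_of_le_of_lt (setLIntegral_mono' measurableSet_Ioi fun t ht => ?_) hi.lintegral_lt_top
    have ht : (1 : ℝ) < t := ht
    rw [← ENNReal.ofReal_toReal (measure_ne_top S {x | t < ‖x‖})]
    exact ENNReal.ofReal_le_ofReal (stable_real_tail_le h0 hS (by linarith))

end StableLimit

/-! ### The Ornstein-Uhlenbeck process -/

/-- Càdlàg paths are locally bounded. -/
lemma IsCadlagPath.exists_abs_le {f : ℝ≥0 → ℝ} (hf : IsCadlagPath f) (T : ℝ≥0) :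
    ∃ M, ∀ s ≤ T, |f s| ≤ M := by
  suffices h : ∃ M, ∀ s ∈ Set.Icc 0 T, |f s| ≤ M by
    obtain ⟨M, hM⟩ := h
    exact ⟨M, fun s hs => hM s ⟨zero_le, hs⟩⟩
  refine IsCompact.induction_on (p := fun S => ∃ M, ∀ s ∈ S, |f s| ≤ M) isCompact_Icc
    ⟨0, by simp⟩ (fun S S' hSS' ⟨M, hM⟩ => ⟨M, fun s hs => hM s (hSS' hs)⟩)
    (fun S S' ⟨M, hM⟩ ⟨M', hM'⟩ => ⟨max M M', fun s hs => ?_⟩) (fun t _ => ?_)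
  · rcases hs with hs | hs
    · exact (hM s hs).trans (le_max_left _ _)
    · exact (hM' s hs).trans (le_max_right _ _)
  · obtain ⟨hr, l, hl⟩ := hf t
    have h1 : ∀ᶠ s in 𝓝[≥] t, |f s| ≤ |f t| + 1 :=
      (Tendsto.abs hr).eventually_le_const (by linarith)
    have h2 : ∀ᶠ s in 𝓝[<] t, |f s| ≤ |l| + 1 := hl.abs.eventually_le_const (by linarith)
    have h3 : ∀ᶠ s in 𝓝 t, |f s| ≤ max (|f t| + 1) (|l| + 1) := by
      rw [← nhdsLT_sup_nhdsGE, eventually_sup]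
      exact ⟨h2.mono fun s hs => hs.trans (le_max_right _ _),
        h1.mono fun s hs => hs.trans (le_max_left _ _)⟩
    exact ⟨_, mem_nhdsWithin_of_mem_nhds h3, _, fun s hs => hs⟩

lemma continuousWithinAt_comp_toNNReal {z : ℝ≥0 → ℝ} (hz : ∀ t, ContinuousWithinAt z (Set.Ici t) t)
    (s : ℝ) : ContinuousWithinAt (fun s : ℝ => z s.toNNReal) (Set.Ici s) s :=
  (hz s.toNNReal).comp continuous_real_toNNReal.continuousWithinAt fun _ hr => Real.toNNReal_mono hr

/-- Variation of constants for `x_t = x - ∫_0^t x_s ds + z_t` with a right-continuous path `z`.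
The function `e^t ∫_0^t x_s ds - ∫_0^t e^s (x + z_s) ds` has vanishing right derivative. -/
lemma eq_of_integral_equation {x : ℝ} {X z : ℝ≥0 → ℝ}
    (hz : ∀ t, ContinuousWithinAt z (Set.Ici t) t)
    (hX : ∀ t : ℝ≥0, IntervalIntegrable (fun s : ℝ => X s.toNNReal) volume 0 t ∧
      X t = x - (∫ s in (0 : ℝ)..t, X s.toNNReal) + z t) (t : ℝ≥0) :
    X t = Real.exp (-(t : ℝ)) * x
      + (z t - Real.exp (-(t : ℝ)) * ∫ s in (0 : ℝ)..t, Real.exp s * z s.toNNReal) := by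
  set T : ℝ := NNReal.toReal t with hT
  have hT0 : 0 ≤ T := t.2
  set xx : ℝ → ℝ := fun s => X s.toNNReal with hxx
  set zz : ℝ → ℝ := fun s => z s.toNNReal with hzz
  set y : ℝ → ℝ := fun s => ∫ r in (0 : ℝ)..s, xx r with hy
  have hxi : IntervalIntegrable xx volume 0 T := (hX t).1
  have huIcc : Set.uIcc 0 T = Set.Icc 0 T := Set.uIcc_of_le hT0
  have hycont : ContinuousOn y (Set.Icc 0 T) := by
    rw [← huIcc]
    exact intervalIntegral.continuousOn_primitive_interval' hxi Set.left_mem_uIcc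
  have heq : ∀ s, 0 ≤ s → xx s = x - y s + zz s := fun s hs => by
    have h := (hX s.toNNReal).2
    rw [Real.coe_toNNReal s hs] at h
    exact h
  have hzi : IntervalIntegrable zz volume 0 T := by
    have h1 : IntervalIntegrable (fun s => xx s - x + y s) volume 0 T :=
      (hxi.sub intervalIntegrable_const).add (hycont.mono (by rw [huIcc])).intervalIntegrable
    refine h1.congr fun s hs => ?_
    rw [Set.uIoc_of_le hT0] at hs
    rw [heq s hs.1.le]
    ring
  have hgi : IntervalIntegrable (fun s => Real.exp s * (x + zz s)) volume 0 T :=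
    (intervalIntegrable_const.add hzi).continuousOn_mul (by fun_prop)
  have hzc : ∀ s, ContinuousWithinAt zz (Set.Ici s) s := continuousWithinAt_comp_toNNReal hz
  have hmeas : ∀ {f : ℝ → ℝ}, IntervalIntegrable f volume 0 T → ∀ s ∈ Set.Ico 0 T,
      StronglyMeasurableAtFilter f (𝓝[>] s) := fun hf s hs => by
    refine ⟨Set.Ioc 0 T, ?_, hf.1.aestronglyMeasurable⟩
    exact mem_of_superset (Ioc_mem_nhdsGT hs.2) (Set.Ioc_subset_Ioc_left hs.1)
  have hsub : ∀ {f : ℝ → ℝ}, IntervalIntegrable f volume 0 T → ∀ s ∈ Set.Ico 0 T,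
      IntervalIntegrable f volume 0 s := fun hf s hs =>
    hf.mono_set (by rw [Set.uIcc_of_le hs.1, huIcc]; exact Set.Icc_subset_Icc_right hs.2.le)
  have hxc : ∀ s ∈ Set.Ico 0 T, ContinuousWithinAt xx (Set.Ioi s) s := fun s hs => by
    have hyc : ContinuousWithinAt y (Set.Ioi s) s := by
      have h1 : ContinuousWithinAt y (Set.Icc 0 T) s := hycont s ⟨hs.1, hs.2.le⟩
      refine (h1.mono (Set.Ioc_subset_Icc_self.trans (Set.Icc_subset_Icc_left hs.1)) :
        ContinuousWithinAt y (Set.Ioc s T) s).mono_of_mem_nhdsWithin (Ioc_mem_nhdsGT hs.2)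
    have h2 : ContinuousWithinAt (fun s => x - y s + zz s) (Set.Ioi s) s :=
      (continuousWithinAt_const.sub hyc).add ((hzc s).mono Set.Ioi_subset_Ici_self)
    exact h2.congr (fun r hr => heq r (hs.1.trans (le_of_lt hr))) (heq s hs.1)
  have hconst := constant_of_has_deriv_right_zero
    (f := fun s => Real.exp s * y s - ∫ r in (0 : ℝ)..s, Real.exp r * (x + zz r)) (a := 0) (b := T)
    (by
      refine (Real.continuous_exp.continuousOn.mul hycont).sub ?_
      rw [← huIcc]
      exact intervalIntegral.continuousOn_primitive_interval' hgi Set.left_mem_uIcc)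
    (by
      intro s hs
      have d1 : HasDerivWithinAt y (xx s) (Set.Ici s) s :=
        intervalIntegral.integral_hasDerivWithinAt_right (hsub hxi s hs) (hmeas hxi s hs)
          (hxc s hs)
      have d2 : HasDerivWithinAt (fun s => ∫ r in (0 : ℝ)..s, Real.exp r * (x + zz r))
          (Real.exp s * (x + zz s)) (Set.Ici s) s := by
        refine intervalIntegral.integral_hasDerivWithinAt_right (hsub hgi s hs) (hmeas hgi s hs) ?_
        exact Real.continuous_exp.continuousWithinAt.mul
          (continuousWithinAt_const.add ((hzc s).mono Set.Ioi_subset_Ici_self))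
      have d3 := ((Real.hasDerivAt_exp s).hasDerivWithinAt (s := Set.Ici s)).mul d1
      refine (d3.sub d2).congr_deriv ?_
      rw [heq s hs.1]
      ring)
    T ⟨hT0, le_rfl⟩
  simp only [hy, intervalIntegral.integral_same, mul_zero, sub_zero] at hconst
  have hsplit : ∫ r in (0 : ℝ)..T, Real.exp r * (x + zz r)
      = (Real.exp T - 1) * x + ∫ r in (0 : ℝ)..T, Real.exp r * zz r := by
    simp only [mul_add]
    rw [intervalIntegral.integral_add, intervalIntegral.integral_mul_const, integral_exp,
      Real.exp_zero]
    · exact (Continuous.intervalIntegrable (by fun_prop) _ _)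
    · exact hzi.continuousOn_mul (by fun_prop)
  rw [hsplit] at hconst
  have hXt : X t = x - y T + z t := (hX t).2
  have hyT : y T = Real.exp (-T)
      * ((Real.exp T - 1) * x + ∫ r in (0 : ℝ)..T, Real.exp r * zz r) := by
    rw [← sub_eq_zero.1 hconst, ← mul_assoc, ← Real.exp_add]
    simp [hy]
  have he : Real.exp (-T) * Real.exp T = 1 := by rw [← Real.exp_add]; simp
  rw [hXt, hyT]
  linear_combination (-x) * he

/-- The Riemann-Stieltjes sums of `∫_0^t e^s dz_s` along the uniform partition into `m + 1`
intervals. -/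
noncomputable def stieltjesSum (z : ℝ≥0 → ℝ) (t : ℝ≥0) (m : ℕ) : ℝ :=
  ∑ i ∈ Finset.range (m + 1), Real.exp (i * (t / (m + 1)))
    * (z ((i + 1 : ℕ) * (t / (m + 1))) - z (i * (t / (m + 1))))

/-- Summation by parts. -/
lemma stieltjesSum_eq (z : ℝ≥0 → ℝ) (t : ℝ≥0) (m : ℕ) :
    stieltjesSum z t m = Real.exp t * z t - z 0
      - ∑ i ∈ Finset.range (m + 1), z ((i + 1 : ℕ) * (t / (m + 1)))
          * (Real.exp ((i + 1 : ℕ) * (t / (m + 1) : ℝ)) - Real.exp (i * (t / (m + 1) : ℝ))) := by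
  have h := Finset.sum_range_sub (fun i : ℕ => Real.exp (i * (t / (m + 1) : ℝ))
    * z (i * (t / (m + 1)))) (m + 1)
  have e1 : ((m + 1 : ℕ) : ℝ) * (t / (m + 1)) = t := by push_cast; field_simp
  have e2 : ((m + 1 : ℕ) : ℝ≥0) * (t / (m + 1)) = t := by push_cast; field_simp
  simp only [e1, e2, Nat.cast_zero, zero_mul, Real.exp_zero, one_mul] at h
  rw [← h, stieltjesSum, ← Finset.sum_sub_distrib]
  refine Finset.sum_congr rfl fun i _ => ?_
  ring

/-- The limit of the sums is the integral of `e^s` against `z`, integrated by parts. -/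
lemma tendsto_stieltjesSum {z : ℝ≥0 → ℝ} (hz : IsCadlagPath z) (t : ℝ≥0) :
    Tendsto (fun m => stieltjesSum z t m) atTop
      (𝓝 (Real.exp t * z t - z 0 - ∫ s in (0 : ℝ)..t, Real.exp s * z s.toNNReal)) := by
  simp only [stieltjesSum_eq]
  refine tendsto_const_nhds.sub ?_
  rcases eq_or_lt_of_le (show 0 ≤ t from zero_le) with ht | ht
  · simp [← ht]
  have ht' : (0 : ℝ) < t := ht
  -- the right endpoint of the partition interval that contains `s`
  let c : ℕ → ℝ → ℝ≥0 := fun m s => (⌈s / (t / (m + 1))⌉₊ : ℝ≥0) * (t / (m + 1))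
  have hstep : ∀ m : ℕ, (0 : ℝ) < t / (m + 1) := fun m => by positivity
  have hcle : ∀ (m : ℕ) (s : ℝ), s ≤ c m s := fun m s => by
    have := Nat.le_ceil (s / (t / (m + 1)))
    simp only [c, NNReal.coe_mul, NNReal.coe_natCast, NNReal.coe_div, NNReal.coe_add,
      NNReal.coe_one]
    rwa [div_le_iff₀ (hstep m)] at this
  have hclt : ∀ (m : ℕ) (s : ℝ), 0 ≤ s → c m s < s + t / (m + 1) := fun m s hs => by
    have := Nat.ceil_lt_add_one (div_nonneg hs (hstep m).le)
    simp only [c, NNReal.coe_mul, NNReal.coe_natCast, NNReal.coe_div, NNReal.coe_add,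
      NNReal.coe_one]
    rw [← lt_div_iff₀ (hstep m), add_div, div_self (hstep m).ne']
    exact this
  have hct : ∀ (m : ℕ) (s : ℝ), s ≤ t → c m s ≤ t := fun m s hs => by
    have h1 : ⌈s / (t / (m + 1))⌉₊ ≤ m + 1 := by
      rw [Nat.ceil_le, div_le_iff₀ (hstep m)]
      push_cast
      rwa [mul_div_cancel₀ _ (by positivity)]
    calc c m s ≤ ((m + 1 : ℕ) : ℝ≥0) * (t / (m + 1)) := by
          simp only [c]; gcongr
      _ = t := by push_cast; field_simp
  have hsum : ∀ m : ℕ, ∑ i ∈ Finset.range (m + 1), z ((i + 1 : ℕ) * (t / (m + 1)))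
          * (Real.exp ((i + 1 : ℕ) * (t / (m + 1) : ℝ)) - Real.exp (i * (t / (m + 1) : ℝ)))
      = ∫ s in (0 : ℝ)..t, Real.exp s * z (c m s) := by
    intro m
    have hle : ∀ i : ℕ, (i : ℝ) * (t / (m + 1)) ≤ ((i + 1 : ℕ) : ℝ) * (t / (m + 1)) := fun i => by
      push_cast
      have := hstep m
      nlinarith
    have hEq : ∀ i : ℕ, Set.EqOn (fun s : ℝ => Real.exp s * z ((i + 1 : ℕ) * (t / (m + 1))))
        (fun s => Real.exp s * z (c m s))
        (Set.uIoc ((i : ℝ) * (t / (m + 1))) (((i + 1 : ℕ) : ℝ) * (t / (m + 1)))) := by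
      intro i s hs
      rw [Set.uIoc_of_le (hle i)] at hs
      have : ⌈s / (t / (m + 1))⌉₊ = i + 1 := by
        rw [Nat.ceil_eq_iff (by omega), lt_div_iff₀ (hstep m), div_le_iff₀ (hstep m)]
        simpa using hs
      simp only [c, this]
    have h := intervalIntegral.sum_integral_adjacent_intervals (μ := volume)
      (f := fun s => Real.exp s * z (c m s)) (a := fun i : ℕ => (i : ℝ) * (t / (m + 1)))
      (n := m + 1) fun i _ => ?_
    · have e1 : ((m + 1 : ℕ) : ℝ) * (t / (m + 1)) = t := by push_cast; field_simp
      simp only [e1, Nat.cast_zero, zero_mul] at h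
      rw [← h]
      refine Finset.sum_congr rfl fun i _ => ?_
      rw [← intervalIntegral.integral_congr_ae (Eventually.of_forall (hEq i)),
        intervalIntegral.integral_mul_const, integral_exp, mul_comm]
    · exact IntervalIntegrable.congr (hEq i)
        (Continuous.intervalIntegrable (by fun_prop) _ _)
  simp only [hsum]
  obtain ⟨M, hM⟩ := hz.exists_abs_le t
  refine intervalIntegral.tendsto_integral_filter_of_dominated_convergence
    (fun _ => Real.exp t * M) (Eventually.of_forall fun m => ?_) (Eventually.of_forall fun m => ?_)
    (by simp) (Eventually.of_forall fun s hs => ?_)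
  · have h1 : Measurable fun s : ℝ => z (c m s) := by
      have h2 : Measurable fun k : ℕ => z ((k : ℝ≥0) * (t / (m + 1))) := measurable_from_top
      exact h2.comp (Nat.measurable_ceil.comp (by fun_prop))
    exact (Measurable.mul (by fun_prop) h1).aestronglyMeasurable
  · refine Eventually.of_forall fun s hs => ?_
    rw [Set.uIoc_of_le ht'.le] at hs
    rw [norm_mul, Real.norm_of_nonneg (Real.exp_pos _).le]
    have h1 : Real.exp s ≤ Real.exp t := Real.exp_le_exp.2 hs.2
    have h2 := hM (c m s) (hct m s hs.2)
    exact mul_le_mul h1 h2 (abs_nonneg _) (Real.exp_pos _).le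
  · rw [Set.uIoc_of_le ht'.le] at hs
    refine Tendsto.const_mul _ ((hz s.toNNReal).1.tendsto.comp ?_)
    refine tendsto_nhdsWithin_iff.2 ⟨?_, Eventually.of_forall fun m => ?_⟩
    · rw [← NNReal.tendsto_coe, Real.coe_toNNReal s hs.1.le]
      have hlim : Tendsto (fun m : ℕ => s + t / ((m : ℝ) + 1)) atTop (𝓝 (s + 0)) := by
        refine tendsto_const_nhds.add ?_
        exact tendsto_const_nhds.div_atTop
          (tendsto_atTop_add_const_right _ _ tendsto_natCast_atTop_atTop)
      rw [add_zero] at hlim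
      exact tendsto_of_tendsto_of_tendsto_of_le_of_le tendsto_const_nhds hlim
        (fun m => hcle m s) (fun m => (hclt m s hs.1.le).le)
    · exact Real.toNNReal_le_iff_le_coe.2 (hcle m s)

lemma tendsto_riemannSum_exp {α : ℝ} (h0 : 0 < α) (t : ℝ≥0) :
    Tendsto (fun m : ℕ => ∑ i ∈ Finset.range (m + 1),
      (t / (m + 1) : ℝ) * Real.exp (α * (i * (t / (m + 1))))) atTop
      (𝓝 ((Real.exp (α * t) - 1) / α)) := by
  rcases eq_or_lt_of_le (show 0 ≤ t from zero_le) with ht | ht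
  · simp [← ht]
  have ht' : (0 : ℝ) < t := ht
  have hstep : ∀ m : ℕ, (0 : ℝ) < t / (m + 1) := fun m => by positivity
  have hslope : Tendsto (fun y : ℝ => y⁻¹ * (Real.exp y - 1)) (𝓝[≠] 0) (𝓝 1) := by
    have h := (Real.hasDerivAt_exp 0).tendsto_slope_zero
    simpa using h
  have hlim : Tendsto (fun m : ℕ => α * (t / (m + 1) : ℝ)) atTop (𝓝[≠] 0) := by
    refine tendsto_nhdsWithin_iff.2 ⟨?_, Eventually.of_forall fun m => ?_⟩
    · have : Tendsto (fun m : ℕ => (t / ((m : ℝ) + 1) : ℝ)) atTop (𝓝 0) :=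
        tendsto_const_nhds.div_atTop
          (tendsto_atTop_add_const_right _ _ tendsto_natCast_atTop_atTop)
      simpa using this.const_mul α
    · exact (mul_pos h0 (hstep m)).ne'
  have h1 := (hslope.comp hlim).inv₀ one_ne_zero
  have h2 := h1.const_mul ((Real.exp (α * t) - 1) / α)
  rw [inv_one, mul_one] at h2
  refine h2.congr fun m => ?_
  set h : ℝ := t / (m + 1) with hh
  have hpos := hstep m
  rw [← hh] at hpos
  have hr : Real.exp (α * h) ≠ 1 := by
    rw [Ne, Real.exp_eq_one_iff]
    exact (mul_pos h0 hpos).ne'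
  have hr' : Real.exp (α * h) - 1 ≠ 0 := sub_ne_zero.2 hr
  have hgeom := geom_sum_eq hr (m + 1)
  have hpow : Real.exp (α * h) ^ (m + 1) = Real.exp (α * t) := by
    rw [← Real.exp_nat_mul, hh]
    congr 1
    push_cast
    field_simp
  have hterm : ∀ i : ℕ, h * Real.exp (α * (i * h)) = h * Real.exp (α * h) ^ i := fun i => by
    rw [← Real.exp_nat_mul]
    congr 2
    ring
  rw [Finset.sum_congr rfl fun i _ => hterm i, ← Finset.mul_sum, hgeom, hpow]
  simp only [Function.comp_def]
  rw [← hh]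
  clear_value h
  have hne : h ≠ 0 := hpos.ne'
  field_simp

section OrnsteinUhlenbeck

variable {Ω : Type*} [MeasurableSpace Ω] {P : Measure Ω} {α : ℝ}
  {Z : ℝ≥0 → Ω → ℝ}

lemma charFun_stieltjesSum (hZ : IsSymmetricStableProcess α Z P) (t : ℝ≥0) (m : ℕ)
    (u : ℝ) :
    charFun (P.map fun ω => Real.exp (-(t : ℝ)) * stieltjesSum (fun s => Z s ω) t m) u
      = ((Real.exp (-(|u| ^ α * Real.exp (-(α * t)) * ∑ i ∈ Finset.range (m + 1),
          (t / (m + 1) : ℝ) * Real.exp (α * (i * (t / (m + 1)))))) : ℝ) : ℂ) := by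
  set τ : ℕ → ℝ≥0 := fun i => (i : ℝ≥0) * (t / (m + 1)) with hτ
  have hmono : Monotone τ := fun i j hij => by
    simp only [hτ]
    gcongr
  set D : ℕ → Ω → ℝ := fun i ω =>
    Real.exp (-(t : ℝ)) * Real.exp (i * (t / (m + 1))) * (Z (τ (i + 1)) ω - Z (τ i) ω) with hD
  have hind : iIndepFun D P :=
    (hZ.indep_increments.nat hmono).comp
      (fun i x => Real.exp (-(t : ℝ)) * Real.exp (i * (t / (m + 1))) * x)
      (fun i => measurable_const_mul _)
  have hsub : ∀ i, AEMeasurable (fun ω => Z (τ (i + 1)) ω - Z (τ i) ω) P := fun i =>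
    (hZ.aemeasurable _).sub (hZ.aemeasurable _)
  have hmeas : ∀ i, AEMeasurable (D i) P := fun i => (hsub i).const_mul _
  have e1 : (fun ω => Real.exp (-(t : ℝ)) * stieltjesSum (fun s => Z s ω) t m)
      = fun ω => ∑ i ∈ Finset.range (m + 1), D i ω := by
    ext ω
    rw [stieltjesSum, Finset.mul_sum]
    refine Finset.sum_congr rfl fun i _ => ?_
    simp only [hD, hτ]
    ring
  rw [e1, (hind.restrict _).charFun_map_fun_finsetSum_eq_prod fun i _ => hmeas i,
    Finset.prod_apply]
  have e2 : ∀ i, charFun (P.map (D i)) u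
      = ((Real.exp (-(|u| ^ α * Real.exp (-(α * t)) *
          ((t / (m + 1) : ℝ) * Real.exp (α * (i * (t / (m + 1))))))) : ℝ) : ℂ) := fun i => by
    rw [hD, charFun_map_mul_comp (hsub i), hZ.charFun_increment _ _ (hmono i.le_succ)]
    congr 2
    have : ((τ (i + 1) : ℝ≥0) : ℝ) - τ i = t / (m + 1) := by
      simp only [hτ]
      push_cast
      ring
    rw [this, ← Real.exp_add, abs_mul, abs_of_pos (Real.exp_pos _),
      Real.mul_rpow (Real.exp_pos _).le (abs_nonneg _), ← Real.exp_mul, add_mul, Real.exp_add,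
      show -(t : ℝ) * α = -(α * t) by ring, mul_comm α ((i : ℝ) * _)]
    ring
  simp only [e2]
  rw [← Complex.ofReal_prod, ← Real.exp_sum, Finset.sum_neg_distrib, ← Finset.mul_sum]

variable [IsProbabilityMeasure P] {X : ℝ → ℝ≥0 → Ω → ℝ}

/-- The law of the Ornstein-Uhlenbeck process started at the origin. -/
lemma charFun_ou_zero (hZ : IsSymmetricStableProcess α Z P) (h0 : 0 < α)
    (hX : IsOUSolution Z P 0 (X 0)) (t : ℝ≥0) (u : ℝ) :
    charFun (P.map (X 0 t)) u
      = ((Real.exp (-(|u| ^ α * ((1 - Real.exp (-(α * t))) / α))) : ℝ) : ℂ) := by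
  have hlim : ∀ᵐ ω ∂P, Tendsto
      (fun m => Real.exp (-(t : ℝ)) * stieltjesSum (fun s => Z s ω) t m) atTop
      (𝓝 (X 0 t ω)) := by
    filter_upwards [hX.equation, hZ.cadlag, hZ.zero] with ω h1 h2 h3
    have h4 := eq_of_integral_equation (X := fun t => X 0 t ω) (z := fun t => Z t ω)
      (fun t => (h2 t).1) h1 t
    have h5 := (tendsto_stieltjesSum h2 t).const_mul (Real.exp (-(t : ℝ)))
    convert h5 using 2
    rw [h4, h3]
    have he : Real.exp (-(t : ℝ)) * Real.exp t = 1 := by rw [← Real.exp_add]; simp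
    linear_combination (-Z t ω) * he
  have hm : ∀ m, AEMeasurable
      (fun ω => Real.exp (-(t : ℝ)) * stieltjesSum (fun s => Z s ω) t m) P := fun m => by
    unfold stieltjesSum
    refine AEMeasurable.const_mul (Finset.aemeasurable_fun_sum _ fun i _ => ?_) _
    exact ((hZ.aemeasurable _).sub (hZ.aemeasurable _)).const_mul _
  have hc1 : Tendsto (fun m => charFun
      (P.map fun ω => Real.exp (-(t : ℝ)) * stieltjesSum (fun s => Z s ω) t m) u) atTop
      (𝓝 (charFun (P.map (X 0 t)) u)) := by
    simp only [charFun_apply_real]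
    rw [integral_map (hX.aemeasurable t) (by fun_prop)]
    have hmap : ∀ m, ∫ x, Complex.exp (u * x * Complex.I)
        ∂(P.map fun ω => Real.exp (-(t : ℝ)) * stieltjesSum (fun s => Z s ω) t m)
        = ∫ ω, Complex.exp (u * ((Real.exp (-(t : ℝ)) * stieltjesSum (fun s => Z s ω) t m : ℝ) : ℂ)
          * Complex.I) ∂P := fun m => integral_map (hm m) (by fun_prop)
    simp only [hmap]
    refine tendsto_integral_of_dominated_convergence (fun _ => 1) (fun m => ?_)
      (integrable_const _) (fun m => Eventually.of_forall fun ω => ?_) ?_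
    · have hcont : Continuous fun x : ℝ => Complex.exp (u * x * Complex.I) := by fun_prop
      exact (hcont.measurable.comp_aemeasurable (hm m)).aestronglyMeasurable
    · rw [← Complex.ofReal_mul, Complex.norm_exp_ofReal_mul_I]
    · filter_upwards [hlim] with ω hω
      have hcont : Continuous fun x : ℝ => Complex.exp (u * x * Complex.I) := by fun_prop
      exact (hcont.tendsto _).comp hω
  have hc2 : Tendsto (fun m => charFun
      (P.map fun ω => Real.exp (-(t : ℝ)) * stieltjesSum (fun s => Z s ω) t m) u) atTop
      (𝓝 ((Real.exp (-(|u| ^ α * Real.exp (-(α * t)) * ((Real.exp (α * t) - 1) / α))) : ℝ)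
        : ℂ)) := by
    simp only [charFun_stieltjesSum hZ]
    refine (Complex.continuous_ofReal.tendsto _).comp ((Real.continuous_exp.tendsto _).comp ?_)
    exact ((tendsto_riemannSum_exp h0 t).const_mul _).neg
  rw [tendsto_nhds_unique hc1 hc2]
  congr 3
  have he : Real.exp (-(α * t)) * Real.exp (α * t) = 1 := by rw [← Real.exp_add]; simp
  field_simp
  linear_combination (|u| ^ α) * he

/-- The invariant law is the stable law with scale `α ^ (-1 / α)`. -/
theorem charFun_invariantLaw (hZ : IsSymmetricStableProcess α Z P) (h0 : 0 < α)
    (hX : ∀ x, IsOUSolution Z P x (X x)) {ν : Measure ℝ} (hν : IsInvariantLaw P X ν) (u : ℝ) :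
    charFun ν u = ((Real.exp (-(|u| ^ α / α)) : ℝ) : ℂ) := by
  have hνp := hν.isProbabilityMeasure
  have hXm : ∀ t, IsProbabilityMeasure (P.map (X 0 t)) := fun t =>
    Measure.isProbabilityMeasure_map ((hX 0).aemeasurable t)
  have hlaw : ∀ (t : ℝ≥0) (x : ℝ),
      P.map (X x t) = (P.map (X 0 t)).map (fun y => Real.exp (-(t : ℝ)) * x + y) := by
    intro t x
    rw [AEMeasurable.map_map_of_aemeasurable (by fun_prop) ((hX 0).aemeasurable t)]
    refine Measure.map_congr ?_
    filter_upwards [(hX x).equation, (hX 0).equation, hZ.cadlag] with ω h1 h2 h3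
    have e1 := eq_of_integral_equation (X := fun t => X x t ω) (z := fun t => Z t ω)
      (fun t => (h3 t).1) h1 t
    have e2 := eq_of_integral_equation (X := fun t => X 0 t ω) (z := fun t => Z t ω)
      (fun t => (h3 t).1) h2 t
    rw [Function.comp_apply, e1, e2]
    ring
  have hconv : ∀ t : ℝ≥0,
      ν = (ν.map (fun x => Real.exp (-(t : ℝ)) * x)) ∗ (P.map (X 0 t)) := by
    intro t
    ext A hA
    rw [← hν.invariant t A hA, ← lintegral_indicator_one hA,
      Measure.lintegral_conv (measurable_one.indicator hA), lintegral_map _ (by fun_prop)]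
    · refine lintegral_congr fun x => ?_
      rw [hlaw t x, ← lintegral_indicator_one hA,
        lintegral_map (measurable_one.indicator hA) (by fun_prop)]
    · exact (measurable_one.indicator hA |>.comp measurable_add).lintegral_prod_right'
  -- invariance as a functional equation, in which the time then tends to infinity
  have hfun : ∀ t : ℝ≥0, charFun ν u = charFun ν (Real.exp (-(t : ℝ)) * u)
      * ((Real.exp (-(|u| ^ α * ((1 - Real.exp (-(α * t))) / α))) : ℝ) : ℂ) := by
    intro t
    have hm : IsProbabilityMeasure (ν.map (fun x => Real.exp (-(t : ℝ)) * x)) :=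
      Measure.isProbabilityMeasure_map (by fun_prop)
    conv_lhs => rw [hconv t]
    rw [charFun_conv, charFun_map_mul, charFun_ou_zero hZ h0 (hX 0)]
  have hexp : ∀ c : ℝ, 0 < c → Tendsto (fun n : ℕ => Real.exp (-(c * n))) atTop (𝓝 0) :=
    fun c hc => Real.tendsto_exp_neg_atTop_nhds_zero.comp
      (tendsto_natCast_atTop_atTop.const_mul_atTop hc)
  have hl1 : Tendsto (fun n : ℕ => charFun ν (Real.exp (-(1 * n : ℝ)) * u)) atTop (𝓝 1) := by
    have h := (continuous_charFun (μ := ν)).tendsto 0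
    rw [charFun_zero] at h
    simp only [probReal_univ, Complex.ofReal_one] at h
    refine h.comp ?_
    simpa using (hexp 1 one_pos).mul_const u
  have hl2 : Tendsto (fun n : ℕ =>
      ((Real.exp (-(|u| ^ α * ((1 - Real.exp (-(α * n))) / α))) : ℝ) : ℂ)) atTop
      (𝓝 ((Real.exp (-(|u| ^ α * ((1 - 0) / α))) : ℝ) : ℂ)) := by
    refine (Complex.continuous_ofReal.tendsto _).comp ((Real.continuous_exp.tendsto _).comp ?_)
    exact (((tendsto_const_nhds.sub (hexp α h0)).div_const α).const_mul _).neg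
  have hl := hl1.mul hl2
  have hconst : Tendsto (fun _ : ℕ => charFun ν u) atTop (𝓝 (charFun ν u)) := tendsto_const_nhds
  have := tendsto_nhds_unique hconst (hl.congr fun n => by
    have := hfun (n : ℝ≥0)
    simp only [NNReal.coe_natCast] at this
    rw [one_mul]
    exact this.symm)
  rw [this, one_mul, sub_zero, mul_one_div]

end OrnsteinUhlenbeck

/-! ### The laws of the Euler scheme -/

lemma exists_measurable_paretoEuler_eq {Ω' : Type*} (α : ℝ) (γ : ℕ → ℝ)
    (ξ : ℕ → Ω' → ℝ) (x : ℝ) (n : ℕ) :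
    ∃ F : (Finset.range n → ℝ) → ℝ, Measurable F ∧
      ∀ ω, paretoEuler α γ ξ x n ω = F (fun i => ξ (i + 1) ω) := by
  induction n with
  | zero => exact ⟨fun _ => x, measurable_const, fun ω => rfl⟩
  | succ n ih =>
    obtain ⟨F, hF, hFω⟩ := ih
    have hsub : ∀ i : Finset.range n, (i : ℕ) ∈ Finset.range (n + 1) := fun i =>
      Finset.mem_range.2 ((Finset.mem_range.1 i.2).trans n.lt_succ_self)
    refine ⟨fun v => F (fun i => v ⟨i, hsub i⟩) - γ (n + 1) * F (fun i => v ⟨i, hsub i⟩)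
      + γ (n + 1) ^ (1 / α) / paretoScale α * v ⟨n, Finset.self_mem_range_succ n⟩, ?_, fun ω => ?_⟩
    · have h1 : Measurable fun v : Finset.range (n + 1) → ℝ => F (fun i => v ⟨i, hsub i⟩) :=
        hF.comp (measurable_pi_lambda _ fun i => measurable_pi_apply _)
      exact (h1.sub (h1.const_mul _)).add ((measurable_pi_apply _).const_mul _)
    · simp only [paretoEuler, hFω]

section EulerLaw

variable {Ω' : Type*} [MeasurableSpace Ω'] {P' : Measure Ω'} {α : ℝ} {ξ : ℕ → Ω' → ℝ}

lemma aemeasurable_paretoEuler (γ : ℕ → ℝ) (x : ℝ)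
    (hξ : ∀ n, 1 ≤ n → HasLaw (ξ n) (symmParetoLaw α) P') (n : ℕ) :
    AEMeasurable (paretoEuler α γ ξ x n) P' := by
  induction n with
  | zero => exact aemeasurable_const
  | succ n ih =>
    exact (ih.sub (ih.const_mul _)).add
      ((hξ (n + 1) (Nat.le_add_left 1 n)).aemeasurable.const_mul _)

/-- One step of the scheme contracts the law and convolves it with a rescaled unit Pareto law. -/
lemma map_paretoEuler_succ [IsProbabilityMeasure P'] (γ : ℕ → ℝ) (x : ℝ)
    (hξ_indep : iIndepFun (fun n : ℕ => ξ (n + 1)) P')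
    (hξ : ∀ n, 1 ≤ n → HasLaw (ξ n) (symmParetoLaw α) P') (n : ℕ) :
    P'.map (paretoEuler α γ ξ x (n + 1))
      = ((P'.map (paretoEuler α γ ξ x n)).map fun y => (1 - γ (n + 1)) * y)
        ∗ ((unitPareto α).map fun z => γ (n + 1) ^ (1 / α) * z) := by
  obtain ⟨F, hF, hFω⟩ := exists_measurable_paretoEuler_eq α γ ξ x n
  have hY := aemeasurable_paretoEuler γ x hξ n
  have hξn := hξ (n + 1) (Nat.le_add_left 1 n)
  have hind : IndepFun (paretoEuler α γ ξ x n) (ξ (n + 1)) P' := by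
    have h := hξ_indep.indepFun_finset₀ (Finset.range n) {n} (by simp)
      fun i => (hξ (i + 1) (Nat.le_add_left 1 i)).aemeasurable
    have h2 := h.comp hF (measurable_pi_apply (⟨n, Finset.mem_singleton_self n⟩ : ({n} : Finset ℕ)))
    have e : paretoEuler α γ ξ x n = F ∘ fun ω (i : Finset.range n) => ξ (i + 1) ω :=
      funext hFω
    rw [e]
    exact h2
  have h3 := hind.comp (measurable_const_mul (1 - γ (n + 1)))
    (measurable_const_mul (γ (n + 1) ^ (1 / α) / paretoScale α))
  have h4 := h3.map_add_eq_map_conv_map₀ (hY.const_mul _) (hξn.aemeasurable.const_mul _)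
  have e1 : paretoEuler α γ ξ x (n + 1)
      = ((fun y => (1 - γ (n + 1)) * y) ∘ paretoEuler α γ ξ x n)
        + ((fun z => γ (n + 1) ^ (1 / α) / paretoScale α * z) ∘ ξ (n + 1)) := by
    ext ω
    simp only [paretoEuler, Pi.add_apply, Function.comp_apply]
    ring
  rw [e1]
  refine h4.trans ?_
  rw [unitPareto, map_mul_map_mul, ← hξn.map_eq,
    AEMeasurable.map_map_of_aemeasurable (by fun_prop) hY,
    AEMeasurable.map_map_of_aemeasurable (by fun_prop) hξn.aemeasurable]
  rfl

lemma integrable_id_map_paretoEuler [IsProbabilityMeasure P'] (h1 : 1 < α) (γ : ℕ → ℝ) (x : ℝ)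
    (hξ : ∀ n, 1 ≤ n → HasLaw (ξ n) (symmParetoLaw α) P') (n : ℕ) :
    Integrable (fun y => y) (P'.map (paretoEuler α γ ξ x n)) := by
  rw [integrable_map_measure (by fun_prop) (aemeasurable_paretoEuler γ x hξ n)]
  simp only [Function.comp_def]
  induction n with
  | zero => exact integrable_const x
  | succ n ih =>
    have hξn := hξ (n + 1) (Nat.le_add_left 1 n)
    have h : Integrable (ξ (n + 1)) P' := by
      have h2 := integrable_id_symmParetoLaw h1
      rw [← hξn.map_eq, integrable_map_measure (by fun_prop) hξn.aemeasurable] at h2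
      exact h2
    exact (ih.sub (ih.const_mul _)).add (h.const_mul _)

end EulerLaw

/-! ### Step sizes -/

/-- The factor by which the deterministic part of the scheme contracts between the times `k` and
`n`. -/
noncomputable def decay (γ : ℕ → ℝ) (k n : ℕ) : ℝ := ∏ j ∈ Finset.Ioc k n, (1 - γ j)

/-- The time at which the stable process has the same law as the noise accumulated between the
times `k` and `n` by the scheme with stable innovations. -/
noncomputable def noiseTime (α : ℝ) (γ : ℕ → ℝ) (k n : ℕ) : ℝ :=
  ∑ j ∈ Finset.Ioc k n, γ j * decay γ j n ^ α

/-- From the index `N` on, the steps are positive, at most `1 / 2`, decreasing, and `γ ^ θ`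
decreases from one step to the next by a factor of at most `1 + w γ`. -/
structure SlowSteps (γ : ℕ → ℝ) (θ w : ℝ) (N : ℕ) : Prop where
  pos : ∀ k, N ≤ k → 0 < γ k
  le_half : ∀ k, N ≤ k → γ k ≤ 1 / 2
  succ_le : ∀ k, N ≤ k → γ (k + 1) ≤ γ k
  rpow_le : ∀ k, N ≤ k → γ k ^ θ ≤ γ (k + 1) ^ θ * (1 + w * γ (k + 1))

@[simp] lemma decay_self (γ : ℕ → ℝ) (n : ℕ) : decay γ n n = 1 := by simp [decay]

@[simp] lemma noiseTime_self (α : ℝ) (γ : ℕ → ℝ) (n : ℕ) : noiseTime α γ n n = 0 := by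
  simp [noiseTime]

lemma decay_succ_right (γ : ℕ → ℝ) {k n : ℕ} (h : k ≤ n) :
    decay γ k (n + 1) = decay γ k n * (1 - γ (n + 1)) :=
  Finset.prod_Ioc_succ_top h _

lemma decay_eq_succ_left (γ : ℕ → ℝ) {k n : ℕ} (h : k < n) :
    decay γ k n = (1 - γ (k + 1)) * decay γ (k + 1) n := by
  unfold decay
  rw [← Finset.prod_insert (f := fun j => 1 - γ j) (by simp)]
  congr 1
  ext j
  simp only [Finset.mem_insert, Finset.mem_Ioc]
  omega

lemma noiseTime_eq_succ_left (α : ℝ) (γ : ℕ → ℝ) {k n : ℕ} (h : k < n) :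
    noiseTime α γ k n = γ (k + 1) * decay γ (k + 1) n ^ α + noiseTime α γ (k + 1) n := by
  unfold noiseTime
  rw [← Finset.sum_insert (f := fun j => γ j * decay γ j n ^ α) (by simp)]
  congr 1
  ext j
  simp only [Finset.mem_insert, Finset.mem_Ioc]
  omega

namespace SlowSteps

variable {γ : ℕ → ℝ} {θ w : ℝ} {N : ℕ}

lemma antitone (h : SlowSteps γ θ w N) {j k : ℕ} (hj : N ≤ j) (hjk : j ≤ k) : γ k ≤ γ j := by
  induction k, hjk using Nat.le_induction with
  | base => exact le_rfl
  | succ k hk ih => exact (h.succ_le k (hj.trans hk)).trans ih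

lemma decay_pos (h : SlowSteps γ θ w N) {k : ℕ} (hk : N ≤ k) (n : ℕ) : 0 < decay γ k n :=
  Finset.prod_pos fun j hj => by
    have := h.le_half j (hk.trans (Finset.mem_Ioc.1 hj).1.le)
    linarith

lemma decay_le_one (h : SlowSteps γ θ w N) {k : ℕ} (hk : N ≤ k) (n : ℕ) : decay γ k n ≤ 1 :=
  Finset.prod_le_one (fun j hj => by
    have := h.le_half j (hk.trans (Finset.mem_Ioc.1 hj).1.le)
    linarith) (fun j hj => by
    have := h.pos j (hk.trans (Finset.mem_Ioc.1 hj).1.le)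
    linarith)

lemma noiseTime_succ_right (h : SlowSteps γ θ w N) (α : ℝ) {k n : ℕ} (hk : N ≤ k) (hkn : k ≤ n) :
    noiseTime α γ k (n + 1) = (1 - γ (n + 1)) ^ α * noiseTime α γ k n + γ (n + 1) := by
  unfold noiseTime
  rw [Finset.sum_Ioc_succ_top hkn, decay_self, Real.one_rpow, mul_one, Finset.mul_sum]
  congr 1
  refine Finset.sum_congr rfl fun j hj => ?_
  have hj := Finset.mem_Ioc.1 hj
  rw [decay_succ_right γ hj.2, Real.mul_rpow (h.decay_pos (hk.trans hj.1.le) n).le]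
  · ring
  · have := h.le_half (n + 1) (by omega)
    linarith

/-- The contraction between the times `k` and `n` beats the decrease of `γ ^ θ` by an exponential
factor. -/
lemma rpow_mul_decay_mul_exp_le (h : SlowSteps γ θ w N) {k n : ℕ} (hk : N ≤ k)
    (hkn : k ≤ n) :
    γ k ^ θ * decay γ k n * Real.exp ((1 - w) * ∑ j ∈ Finset.Ioc k n, γ j) ≤ γ n ^ θ := by
  induction n, hkn using Nat.le_induction with
  | base => simp
  | succ n hn ih =>
    rw [decay_succ_right γ hn, Finset.sum_Ioc_succ_top hn, mul_add, Real.exp_add]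
    have hp := h.pos (n + 1) (by omega)
    have hh := h.le_half (n + 1) (by omega)
    have hr := h.rpow_le n (hk.trans hn)
    set g := γ (n + 1)
    have e1 : (1 + w * g) * (1 - g) ≤ Real.exp (-((1 - w) * g)) := by
      have h1 : 1 + w * g ≤ Real.exp (w * g) := by linarith [Real.add_one_le_exp (w * g)]
      have h2 : 1 - g ≤ Real.exp (-g) := by linarith [Real.add_one_le_exp (-g)]
      calc (1 + w * g) * (1 - g) ≤ Real.exp (w * g) * Real.exp (-g) := by
            gcongr
            linarith
        _ = _ := by rw [← Real.exp_add]; ring_nf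
    have e2 : Real.exp (-((1 - w) * g)) * Real.exp ((1 - w) * g) = 1 := by
      rw [← Real.exp_add]; simp
    have hg0 : 0 ≤ g ^ θ := Real.rpow_nonneg hp.le _
    have h1g : 0 ≤ 1 - g := by linarith
    calc γ k ^ θ * (decay γ k n * (1 - g)) * (Real.exp ((1 - w) * ∑ j ∈ Finset.Ioc k n, γ j)
          * Real.exp ((1 - w) * g))
        = (γ k ^ θ * decay γ k n * Real.exp ((1 - w) * ∑ j ∈ Finset.Ioc k n, γ j))
          * ((1 - g) * Real.exp ((1 - w) * g)) := by ring
      _ ≤ (g ^ θ * (1 + w * g)) * ((1 - g) * Real.exp ((1 - w) * g)) := by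
          refine mul_le_mul_of_nonneg_right (ih.trans hr) (by positivity)
      _ = g ^ θ * (((1 + w * g) * (1 - g)) * Real.exp ((1 - w) * g)) := by ring
      _ ≤ g ^ θ * (Real.exp (-((1 - w) * g)) * Real.exp ((1 - w) * g)) := by gcongr
      _ = g ^ θ := by rw [e2, mul_one]

lemma rpow_mul_decay_le (h : SlowSteps γ θ w N) (hw1 : w ≤ 1) {k n : ℕ} (hk : N ≤ k)
    (hkn : k ≤ n) : γ k ^ θ * decay γ k n ≤ γ n ^ θ := by
  refine le_trans ?_ (h.rpow_mul_decay_mul_exp_le hk hkn)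
  refine le_mul_of_one_le_right
    (mul_nonneg (Real.rpow_nonneg (h.pos k hk).le _) (h.decay_pos hk n).le) ?_
  rw [Real.one_le_exp_iff]
  exact mul_nonneg (by linarith) (Finset.sum_nonneg fun j hj =>
    (h.pos j (hk.trans (Finset.mem_Ioc.1 hj).1.le)).le)

/-- The influence of the starting point is negligible with respect to `γ ^ θ`. -/
lemma eventually_decay_le (h : SlowSteps γ θ w N) (hw1 : w < 1)
    (hsum : Tendsto (fun n => ∑ j ∈ Finset.Ioc N n, γ j) atTop atTop) {ε : ℝ} (hε : 0 < ε) :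
    ∀ᶠ n in atTop, decay γ N n ≤ ε * γ n ^ θ := by
  have hN : 0 < γ N ^ θ := Real.rpow_pos_of_pos (h.pos N le_rfl) _
  have h1 : Tendsto (fun n => Real.exp ((1 - w) * ∑ j ∈ Finset.Ioc N n, γ j)) atTop atTop :=
    Real.tendsto_exp_atTop.comp (hsum.const_mul_atTop (by linarith))
  filter_upwards [h1.eventually_ge_atTop (1 / (ε * γ N ^ θ)), eventually_ge_atTop N] with n hn hNn
  have h2 := h.rpow_mul_decay_mul_exp_le le_rfl hNn
  have hd := h.decay_pos le_rfl n
  have h3 : γ N ^ θ * decay γ N n * (1 / (ε * γ N ^ θ)) ≤ γ n ^ θ :=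
    le_trans (by gcongr) h2
  have h4 : γ N ^ θ * decay γ N n * (1 / (ε * γ N ^ θ)) = decay γ N n / ε := by
    field_simp
  rw [h4, div_le_iff₀ hε] at h3
  linarith

variable {α : ℝ}

/-- A lower bound of the noise time, which tends to `1 / α` as the starting point is forgotten. -/
lemma one_sub_decay_rpow_le (h : SlowSteps γ θ w N) (h1 : 1 ≤ α) {k n : ℕ} (hk : N ≤ k)
    (hkn : k ≤ n) : 1 - decay γ k n ^ α ≤ α * noiseTime α γ k n := by
  induction n, hkn using Nat.le_induction with
  | base => simp
  | succ n hn ih =>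
    have hp := h.pos (n + 1) (by omega)
    have hh := h.le_half (n + 1) (by omega)
    have hb : 1 + α * (-γ (n + 1)) ≤ (1 + -γ (n + 1)) ^ α :=
      one_add_mul_self_le_rpow_one_add (by linarith) h1
    rw [← sub_eq_add_neg] at hb
    rw [decay_succ_right γ hn, h.noiseTime_succ_right α hk hn,
      Real.mul_rpow (h.decay_pos hk n).le (by linarith)]
    have h0 : 0 ≤ (1 - γ (n + 1)) ^ α := Real.rpow_nonneg (by linarith) _
    nlinarith [mul_le_mul_of_nonneg_left ih h0]

/-- The discretisation of the drift increases the noise time by a multiple of `γ ^ θ` that is small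
when the steps are small from the start. -/
lemma noiseTime_sub_inv_le (h : SlowSteps γ θ w N) (h1 : 1 < α) (h2 : α < 2) (hw : w ≤ 1)
    (hθ : θ ≤ 1) {n : ℕ} (hn : N ≤ n) :
    noiseTime α γ N n - 1 / α ≤ γ N ^ (1 - θ) / (α - 1) * γ n ^ θ := by
  have hα : 0 < α - 1 := by linarith
  have hB : 0 ≤ γ N ^ (1 - θ) / (α - 1) :=
    div_nonneg (Real.rpow_nonneg (h.pos N le_rfl).le _) hα.le
  induction n, hn using Nat.le_induction with
  | base =>
    rw [noiseTime_self, zero_sub]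
    have : 0 < 1 / α := by positivity
    have := mul_nonneg hB (Real.rpow_nonneg (h.pos N le_rfl).le θ)
    linarith
  | succ n hn ih =>
    have hp := h.pos (n + 1) (by omega)
    have hh := h.le_half (n + 1) (by omega)
    have hr := h.rpow_le n hn
    have hanti := h.antitone le_rfl (hn.trans n.le_succ)
    rw [h.noiseTime_succ_right α le_rfl hn]
    set g := γ (n + 1)
    set B := γ N ^ (1 - θ) / (α - 1)
    have hg0 : 0 < g ^ θ := Real.rpow_pos_of_pos hp _
    -- Bernoulli's inequality for the exponent `α - 1`, which is at most `1`
    have hpow : (1 - g) ^ α ≤ (1 - g) * (1 - (α - 1) * g) := by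
      have e := rpow_one_add_le_one_add_mul_self (show -1 ≤ -g by linarith)
        (show 0 ≤ α - 1 by linarith) (show α - 1 ≤ 1 by linarith)
      rw [← sub_eq_add_neg] at e
      have e2 : (1 - g) ^ α = (1 - g) * (1 - g) ^ (α - 1) := by
        rw [← Real.rpow_one_add' (by linarith) (by linarith)]
        congr 1
        ring
      rw [e2]
      refine mul_le_mul_of_nonneg_left (e.trans (le_of_eq (by ring))) (by linarith)
    have hpow0 : 0 ≤ (1 - g) ^ α := Real.rpow_nonneg (by linarith) _
    have hrem : g - (1 - (1 - g) ^ α) / α ≤ g ^ 2 := by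
      rw [sub_le_iff_le_add, ← sub_le_iff_le_add', le_div_iff₀ (by linarith)]
      nlinarith
    have hsq : g ^ 2 ≤ B * g ^ θ * ((α - 1) * g) := by
      have e1 : g ^ (1 - θ) ≤ γ N ^ (1 - θ) := Real.rpow_le_rpow hp.le hanti (by linarith)
      have e2 : g ^ (1 - θ) * g ^ θ = g := by
        rw [← Real.rpow_add hp]; simp
      calc g ^ 2 = g ^ (1 - θ) * g ^ θ * g := by rw [e2]; ring
        _ ≤ γ N ^ (1 - θ) * g ^ θ * g := by gcongr
        _ = _ := by simp only [B]; field_simp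
    have hwg : (1 - g) ^ α * (1 + w * g) ≤ 1 - (α - 1) * g := by
      calc (1 - g) ^ α * (1 + w * g) ≤ (1 - g) * (1 - (α - 1) * g) * (1 + g) := by
            have : 1 + w * g ≤ 1 + g := by nlinarith
            have h3 : 0 ≤ 1 - (α - 1) * g := by nlinarith
            have h4 : 0 ≤ (1 - g) * (1 - (α - 1) * g) := mul_nonneg (by linarith) h3
            exact (mul_le_mul_of_nonneg_left this hpow0).trans
              (mul_le_mul_of_nonneg_right hpow (by linarith))
        _ = (1 - (α - 1) * g) * (1 - g ^ 2) := by ring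
        _ ≤ (1 - (α - 1) * g) * 1 := by
            refine mul_le_mul_of_nonneg_left ?_ (by nlinarith)
            nlinarith
        _ = _ := mul_one _
    calc (1 - g) ^ α * noiseTime α γ N n + g - 1 / α
        = (1 - g) ^ α * (noiseTime α γ N n - 1 / α) + (g - (1 - (1 - g) ^ α) / α) := by ring
      _ ≤ (1 - g) ^ α * (B * (g ^ θ * (1 + w * g))) + g ^ 2 := by
          gcongr
          exact ih.trans (by gcongr)
      _ = B * g ^ θ * ((1 - g) ^ α * (1 + w * g)) + g ^ 2 := by ring
      _ ≤ B * g ^ θ * (1 - (α - 1) * g) + B * g ^ θ * ((α - 1) * g) := by gcongr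
      _ = B * g ^ θ := by ring

/-- The quadratic part of the accumulated noise, which the stable innovations do not have, is at
least of order `γ ^ θ`. -/
lemma le_sum_rpow_mul_decay_sq (h : SlowSteps γ θ w N) (hθ : 0 ≤ θ) {n : ℕ} (hn : N ≤ n) :
    γ n ^ θ * ((1 - decay γ N n ^ 2) / 2)
      ≤ ∑ k ∈ Finset.Ioc N n, γ k ^ (1 + θ) * decay γ k n ^ 2 := by
  have key : (1 - decay γ N n ^ 2) / 2 ≤ ∑ k ∈ Finset.Ioc N n, γ k * decay γ k n ^ 2 := by
    induction n, hn using Nat.le_induction with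
    | base => simp
    | succ n hn ih =>
      rw [Finset.sum_Ioc_succ_top hn, decay_self]
      have e : ∑ k ∈ Finset.Ioc N n, γ k * decay γ k (n + 1) ^ 2
          = (1 - γ (n + 1)) ^ 2 * ∑ k ∈ Finset.Ioc N n, γ k * decay γ k n ^ 2 := by
        rw [Finset.mul_sum]
        refine Finset.sum_congr rfl fun k hk => ?_
        rw [decay_succ_right γ (Finset.mem_Ioc.1 hk).2]
        ring
      rw [e, decay_succ_right γ hn]
      nlinarith [mul_le_mul_of_nonneg_left ih (sq_nonneg (1 - γ (n + 1))),
        sq_nonneg (γ (n + 1))]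
  refine (mul_le_mul_of_nonneg_left key (Real.rpow_nonneg (h.pos n hn).le _)).trans ?_
  rw [Finset.mul_sum]
  refine Finset.sum_le_sum fun k hk => ?_
  have hk := Finset.mem_Ioc.1 hk
  have hkp := h.pos k hk.1.le
  rw [Real.rpow_add hkp, Real.rpow_one]
  have : γ n ^ θ ≤ γ k ^ θ :=
    Real.rpow_le_rpow (h.pos n hn).le (h.antitone hk.1.le hk.2) hθ
  calc γ n ^ θ * (γ k * decay γ k n ^ 2) ≤ γ k ^ θ * (γ k * decay γ k n ^ 2) := by gcongr
    _ = _ := by ring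

lemma le_mul_succ (h : SlowSteps γ θ w N) (hθ : 0 < θ) (hw : w ≤ 1) {k : ℕ} (hk : N ≤ k) :
    γ k ≤ 2 ^ (1 / θ) * γ (k + 1) := by
  have hp := h.pos k hk
  have hp' := h.pos (k + 1) (by omega)
  have hh := h.le_half (k + 1) (by omega)
  have h1 : γ k ^ θ ≤ 2 * γ (k + 1) ^ θ := by
    refine (h.rpow_le k hk).trans ?_
    rw [mul_comm]
    have : 0 ≤ γ (k + 1) ^ θ := Real.rpow_nonneg hp'.le _
    gcongr
    nlinarith
  have h2 := Real.rpow_le_rpow (Real.rpow_nonneg hp.le _) h1 (show 0 ≤ 1 / θ by positivity)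
  rwa [Real.mul_rpow (by norm_num) (Real.rpow_nonneg hp'.le _), ← Real.rpow_mul hp.le,
    ← Real.rpow_mul hp'.le, mul_one_div_cancel hθ.ne', Real.rpow_one, Real.rpow_one] at h2

end SlowSteps

/-- Concavity of `y ↦ y ^ b`. -/
lemma sub_mul_rpow_sub_one_le {y z b : ℝ} (hz : 0 ≤ z) (hy : 0 < y) (hb0 : 0 < b)
    (hb1 : b ≤ 1) : (y - z) * y ^ (b - 1) ≤ (y ^ b - z ^ b) / b := by
  have h := rpow_one_add_le_one_add_mul_self (s := z / y - 1)
    (by have : 0 ≤ z / y := by positivity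
        linarith) hb0.le hb1
  rw [add_sub_cancel, Real.div_rpow hz hy.le] at h
  have hyb : 0 < y ^ b := Real.rpow_pos_of_pos hy _
  rw [div_le_iff₀ hyb] at h
  rw [le_div_iff₀ hb0, Real.rpow_sub_one hy.ne']
  have e : (1 + b * (z / y - 1)) * y ^ b = y ^ b - (y - z) * (y ^ b / y) * b := by
    field_simp
    ring
  linarith

namespace SlowSteps

variable {γ : ℕ → ℝ} {θ w : ℝ} {N : ℕ} {α : ℝ}

/-- A Riemann sum for `∫ (1 - p) ^ (-1 / α) dp` over `[0, 1]`, in the variable `p = decay γ k n`. -/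
lemma sum_mul_decay_mul_rpow_le (h : SlowSteps γ θ w N) (hθ : 0 < θ) (hw : w ≤ 1) (h1 : 1 < α)
    {m : ℕ} (hm : N ≤ m) :
    ∑ k ∈ Finset.Ico N m, γ (k + 1) * decay γ (k + 1) (m + 1)
        * (1 - decay γ (k + 1) (m + 1)) ^ (-(1 / α))
      ≤ (1 + 2 ^ (1 / θ)) ^ (1 / α) / (1 - 1 / α) := by
  set y : ℕ → ℝ := fun k => 1 - decay γ k (m + 1) with hy
  set D : ℝ := 1 + 2 ^ (1 / θ) with hD
  have hD0 : 0 < D := by positivity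
  have hα0 : 0 < α := by linarith
  have hb0 : 0 < 1 - 1 / α := by
    rw [sub_pos, div_lt_one hα0]
    exact h1
  have hb1 : 1 - 1 / α ≤ 1 := by
    have : 0 < 1 / α := by positivity
    linarith
  have hy1 : ∀ k, N ≤ k → y k ≤ 1 := fun k hk => by
    have := h.decay_pos hk (m + 1)
    simp only [hy]
    linarith
  have hyγ : ∀ k, N ≤ k → k < m + 1 → γ (k + 1) ≤ y k := fun k hk hkm => by
    simp only [hy]
    rw [decay_eq_succ_left γ hkm]
    have e1 := h.decay_le_one (show N ≤ k + 1 by omega) (m + 1)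
    have e2 := h.le_half (k + 1) (by omega)
    nlinarith
  have hterm : ∀ k ∈ Finset.Ico N m, γ (k + 1) * decay γ (k + 1) (m + 1)
        * (1 - decay γ (k + 1) (m + 1)) ^ (-(1 / α))
      ≤ D ^ (1 / α) / (1 - 1 / α) * (y k ^ (1 - 1 / α) - y (k + 1) ^ (1 - 1 / α)) := by
    intro k hk
    have hk := Finset.mem_Ico.1 hk
    have hp := h.pos (k + 1) (by omega)
    have hp2 := h.pos (k + 2) (by omega)
    have hd0 := h.decay_pos (show N ≤ k + 1 by omega) (m + 1)
    have hd1 := h.decay_le_one (show N ≤ k + 1 by omega) (m + 1)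
    have e1 : γ (k + 1) * decay γ (k + 1) (m + 1) = y k - y (k + 1) := by
      simp only [hy]
      rw [decay_eq_succ_left γ (show k < m + 1 by omega)]
      ring
    have e2 : γ (k + 2) ≤ y (k + 1) := hyγ (k + 1) (by omega) (by omega)
    have hy0 : 0 < y (k + 1) := hp2.trans_le e2
    have e3 : y (k + 1) ≤ y k := by
      have : 0 ≤ γ (k + 1) * decay γ (k + 1) (m + 1) := by positivity
      linarith
    -- consecutive nodes are comparable, so the upper node may replace the lower one
    have e4 : y k ≤ D * y (k + 1) := by
      have h3 := h.le_mul_succ hθ hw (show N ≤ k + 1 by omega)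
      have h4 : γ (k + 1) * decay γ (k + 1) (m + 1) ≤ γ (k + 1) :=
        mul_le_of_le_one_right hp.le hd1
      have h5 : (2 : ℝ) ^ (1 / θ) * γ (k + 1 + 1) ≤ 2 ^ (1 / θ) * y (k + 1) := by gcongr
      rw [hD]
      linarith
    have hyk : 0 < y k := hy0.trans_le e3
    have e5 : y (k + 1) ^ (-(1 / α)) ≤ D ^ (1 / α) * y k ^ (-(1 / α)) := by
      have : D ^ (1 / α) * y k ^ (-(1 / α)) = (y k / D) ^ (-(1 / α)) := by
        rw [Real.div_rpow hyk.le hD0.le, Real.rpow_neg hD0.le (1 / α)]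
        field_simp
      rw [this]
      refine Real.rpow_le_rpow_of_nonpos (by positivity) ?_ (by
        have : 0 < 1 / α := by positivity
        linarith)
      rw [div_le_iff₀ hD0]
      linarith
    have e6 := sub_mul_rpow_sub_one_le hy0.le hyk hb0 hb1
    rw [show 1 - 1 / α - 1 = -(1 / α) by ring] at e6
    rw [e1]
    calc (y k - y (k + 1)) * y (k + 1) ^ (-(1 / α))
        ≤ (y k - y (k + 1)) * (D ^ (1 / α) * y k ^ (-(1 / α))) := by
          refine mul_le_mul_of_nonneg_left e5 (by linarith)
      _ = D ^ (1 / α) * ((y k - y (k + 1)) * y k ^ (-(1 / α))) := by ring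
      _ ≤ D ^ (1 / α) * ((y k ^ (1 - 1 / α) - y (k + 1) ^ (1 - 1 / α)) / (1 - 1 / α)) := by gcongr
      _ = _ := by ring
  refine (Finset.sum_le_sum hterm).trans ?_
  have hsum : ∑ k ∈ Finset.Ico N m, (y k ^ (1 - 1 / α) - y (k + 1) ^ (1 - 1 / α))
      = y N ^ (1 - 1 / α) - y m ^ (1 - 1 / α) := by
    rw [← neg_sub (y m ^ (1 - 1 / α)), ← Finset.sum_Ico_sub (fun k => y k ^ (1 - 1 / α)) hm,
      ← Finset.sum_neg_distrib]
    simp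
  rw [← Finset.mul_sum, hsum]
  have hyN : 0 ≤ y N := (h.pos (N + 1) (by omega)).le.trans (hyγ N le_rfl (by omega))
  have hym : 0 ≤ y m := (h.pos (m + 1) (by omega)).le.trans (hyγ m hm (by omega))
  refine mul_le_of_le_one_right (by positivity) ?_
  have := Real.rpow_le_one hyN (hy1 N le_rfl) hb0.le
  have := Real.rpow_nonneg hym (1 - 1 / α)
  linarith

end SlowSteps

/-! ### Replacing Pareto by stable innovations -/

/-- Convolution with a smoothing law turns a Lipschitz function into one with a bounded second
derivative. -/
lemma ShiftLip.secondDiffLe {L : ℝ} {κ : Measure ℝ} [IsFiniteMeasure κ] (h : ShiftLip L κ)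
    {f : ℝ → ℝ} (hf : LipschitzWith 1 f) {B : ℝ} (hB : ∀ x, |f x| ≤ B) :
    SecondDiffLe L fun z => ∫ y, f (z + y) ∂κ := fun x a b => by
  rcases eq_or_ne b 0 with rfl | hb
  · simp
  have hb' : 0 < |b| := abs_pos.2 hb
  have hfc := hf.continuous
  have hint : ∀ z, Integrable (fun y => f (z + y)) κ := fun z =>
    integrable_of_continuous_of_abs_le (by fun_prop) fun y => hB _
  -- the difference quotients of `f` are bounded by `1`
  have h1 := h (fun y => (f (x + b + y) - f (x + y)) / |b|) (by fun_prop) (fun y => by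
    rw [abs_div, abs_abs, div_le_one hb']
    have := hf.dist_le_mul (x + b + y) (x + y)
    rw [Real.dist_eq, Real.dist_eq] at this
    refine this.trans (le_of_eq ?_)
    rw [NNReal.coe_one, one_mul]
    congr 1
    ring) a
  have e : ∫ y, ((f (x + b + (y + a)) - f (x + (y + a))) / |b|
        - (f (x + b + y) - f (x + y)) / |b|) ∂κ
      = (∫ y, f (x + a + b + y) ∂κ - ∫ y, f (x + a + y) ∂κ - ∫ y, f (x + b + y) ∂κ
        + ∫ y, f (x + y) ∂κ) / |b| := by
    rw [← integral_sub (hint _) (hint _),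
      ← integral_sub (f := fun y => f (x + a + b + y) - f (x + a + y)) ((hint _).sub (hint _))
        (hint _),
      ← integral_add (f := fun y => f (x + a + b + y) - f (x + a + y) - f (x + b + y))
        (((hint _).sub (hint _)).sub (hint _)) (hint _), ← integral_div]
    refine integral_congr_ae (Eventually.of_forall fun y => ?_)
    simp only
    rw [show x + b + (y + a) = x + a + b + y by ring, show x + (y + a) = x + a + y by ring]
    ring
  rw [e, abs_div, abs_abs, div_le_iff₀ hb'] at h1
  exact h1

lemma ZetaTwoLe.abs_integral_conv_sub_le {C L : ℝ} {κ ρ ρ' : Measure ℝ} [IsProbabilityMeasure κ]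
    [IsProbabilityMeasure ρ] [IsProbabilityMeasure ρ'] (h : ZetaTwoLe C ρ ρ') (hκ : ShiftLip L κ)
    {f : ℝ → ℝ} (hf : LipschitzWith 1 f) {B : ℝ} (hB : ∀ x, |f x| ≤ B) :
    |∫ x, f x ∂(κ ∗ ρ) - ∫ x, f x ∂(κ ∗ ρ')| ≤ C * L := by
  rw [Measure.conv_comm κ ρ, Measure.conv_comm κ ρ', integral_conv_of_continuous hf.continuous hB,
    integral_conv_of_continuous hf.continuous hB]
  exact h L _ (continuous_integral_comp_add hf.continuous hB)
    ⟨B, fun x => (abs_integral_le_of_abs_le fun y => hB (x + y)).trans (le_of_eq (by simp))⟩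
    (hκ.secondDiffLe hf hB)

lemma abs_integral_conv_sub_le_integral_abs {κ ρ : Measure ℝ} [IsProbabilityMeasure κ]
    [IsProbabilityMeasure ρ] (hρ : Integrable (fun x => x) ρ) {f : ℝ → ℝ} (hf : LipschitzWith 1 f)
    {B : ℝ} (hB : ∀ x, |f x| ≤ B) :
    |∫ x, f x ∂(κ ∗ ρ) - ∫ x, f x ∂κ| ≤ ∫ y, |y| ∂ρ := by
  have hfc := hf.continuous
  rw [integral_conv_of_continuous hfc hB, ← integral_sub
    (integrable_of_continuous_of_abs_le (continuous_integral_comp_add hfc hB) (B := B) fun x =>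
      (abs_integral_le_of_abs_le fun y => hB (x + y)).trans (le_of_eq (by simp)))
    (integrable_of_continuous_of_abs_le hfc hB)]
  refine (abs_integral_le_of_abs_le (B := ∫ y, |y| ∂ρ) fun x => ?_).trans (le_of_eq (by simp))
  have e : f x = ∫ y, f x ∂ρ := by simp
  have hi : Integrable (fun y => f (x + y)) ρ :=
    integrable_of_continuous_of_abs_le (by fun_prop) fun y => hB _
  conv_lhs => rw [e, ← integral_sub hi (integrable_const _)]
  refine abs_integral_le_integral_abs.trans (integral_mono (hi.sub (integrable_const _)).abs hρ.abs
    fun y => ?_)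
  have := hf.dist_le_mul (x + y) x
  rw [Real.dist_eq, Real.dist_eq] at this
  simpa using this

lemma integral_abs_map_mul (μ : Measure ℝ) (c : ℝ) :
    ∫ y, |y| ∂(μ.map fun x => c * x) = |c| * ∫ y, |y| ∂μ := by
  rw [integral_map (by fun_prop) (by fun_prop), ← integral_const_mul]
  simp [abs_mul]

lemma integrable_id_map_mul {μ : Measure ℝ} (hμ : Integrable (fun x => x) μ) (c : ℝ) :
    Integrable (fun x => x) (μ.map fun x => c * x) := by
  rw [integrable_map_measure (by fun_prop) (by fun_prop)]
  exact hμ.const_mul c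

lemma abs_integral_map_mul_sub_le {μ : Measure ℝ} [IsProbabilityMeasure μ]
    (hμ : Integrable (fun x => x) μ) {f : ℝ → ℝ} (hf : LipschitzWith 1 f)
    {B : ℝ} (hB : ∀ x, |f x| ≤ B) (c d : ℝ) :
    |∫ x, f x ∂(μ.map fun x => c * x) - ∫ x, f x ∂(μ.map fun x => d * x)|
      ≤ |c - d| * ∫ y, |y| ∂μ := by
  have hfc := hf.continuous
  have hi : ∀ c : ℝ, Integrable (fun y => f (c * y)) μ := fun c =>
    integrable_of_continuous_of_abs_le (by fun_prop) fun y => hB _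
  rw [integral_map (by fun_prop) (by fun_prop), integral_map (by fun_prop) (by fun_prop),
    ← integral_sub (hi c) (hi d), ← integral_const_mul]
  refine abs_integral_le_integral_abs.trans (integral_mono ((hi c).sub (hi d)).abs
    (hμ.abs.const_mul _) fun y => ?_)
  have := hf.dist_le_mul (c * y) (d * y)
  rw [Real.dist_eq, Real.dist_eq, ← sub_mul, abs_mul] at this
  simpa using this

lemma map_mul_conv (μ ν : Measure ℝ) [IsFiniteMeasure μ] [IsFiniteMeasure ν] (c : ℝ) :
    (μ ∗ ν).map (fun x => c * x) = (μ.map fun x => c * x) ∗ (ν.map fun x => c * x) :=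
  Measure.map_conv_addMonoidHom (AddMonoidHom.mulLeft c) (measurable_const_mul c)

/-- The law at time `s` of the stable process whose law at time `1` is `S`. -/
noncomputable def stableAt (α : ℝ) (S : Measure ℝ) (s : ℝ) : Measure ℝ :=
  S.map fun x => s ^ (1 / α) * x

section StableAt

variable {α : ℝ} {S : Measure ℝ}

instance isProbabilityMeasure_stableAt [IsProbabilityMeasure S] (s : ℝ) :
    IsProbabilityMeasure (stableAt α S s) :=
  Measure.isProbabilityMeasure_map (by fun_prop)

lemma charFun_stableAt (h0 : 0 < α) (hS : ∀ u, charFun S u = ((Real.exp (-|u| ^ α) : ℝ) : ℂ))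
    {s : ℝ} (hs : 0 ≤ s) (u : ℝ) :
    charFun (stableAt α S s) u = ((Real.exp (-(s * |u| ^ α)) : ℝ) : ℂ) := by
  rw [stableAt, charFun_map_mul, hS, abs_mul, abs_of_nonneg (Real.rpow_nonneg hs _),
    Real.mul_rpow (Real.rpow_nonneg hs _) (abs_nonneg u), ← Real.rpow_mul hs,
    one_div_mul_cancel h0.ne', Real.rpow_one]

lemma stableAt_conv [IsProbabilityMeasure S] (h0 : 0 < α)
    (hS : ∀ u, charFun S u = ((Real.exp (-|u| ^ α) : ℝ) : ℂ))
    {s t : ℝ} (hs : 0 ≤ s) (ht : 0 ≤ t) :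
    stableAt α S s ∗ stableAt α S t = stableAt α S (s + t) := by
  refine Measure.ext_of_charFun (funext fun u => ?_)
  rw [charFun_conv, charFun_stableAt h0 hS hs, charFun_stableAt h0 hS ht,
    charFun_stableAt h0 hS (add_nonneg hs ht), ← Complex.ofReal_mul, ← Real.exp_add]
  congr 2
  ring

lemma stableAt_zero [IsProbabilityMeasure S] (h0 : 0 < α) : stableAt α S 0 = Measure.dirac 0 := by
  rw [stableAt, Real.zero_rpow (by positivity)]
  simp [Measure.map_const]

end StableAt

lemma abs_rpow_sub_rpow_le {s a b : ℝ} (hs : 0 ≤ s) (ha : 0 < a) (hb0 : 0 ≤ b) (hb1 : b ≤ 1) :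
    |s ^ b - a ^ b| ≤ a ^ (b - 1) * |s - a| := by
  have hab : 0 < a ^ b := Real.rpow_pos_of_pos ha _
  have hx : 0 ≤ s / a := by positivity
  have e1 : s ^ b - a ^ b = a ^ b * ((s / a) ^ b - 1) := by
    rw [Real.div_rpow hs ha.le]
    field_simp
  have e2 : a ^ (b - 1) * |s - a| = a ^ b * |s / a - 1| := by
    rw [Real.rpow_sub_one ha.ne', div_sub_one ha.ne', abs_div, abs_of_pos ha]
    ring
  rw [e1, e2, abs_mul, abs_of_pos hab]
  refine mul_le_mul_of_nonneg_left ?_ hab.le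
  rcases le_total 1 (s / a) with h | h
  · have h1 := Real.one_le_rpow h hb0
    have h2 := Real.rpow_le_rpow_of_exponent_le h hb1
    rw [Real.rpow_one] at h2
    rw [abs_of_nonneg (by linarith), abs_of_nonneg (by linarith)]
    linarith
  · have h1 := Real.rpow_le_one hx h hb0
    have h2 : s / a ≤ (s / a) ^ b := by
      rcases hx.eq_or_lt with h3 | h3
      · rw [← h3]
        exact Real.rpow_nonneg le_rfl _
      · simpa using Real.rpow_le_rpow_of_exponent_ge h3 h hb1
    rw [abs_of_nonpos (by linarith), abs_of_nonpos (by linarith)]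
    linarith

lemma integrable_id_unitPareto {α : ℝ} (h1 : 1 < α) : Integrable (fun x => x) (unitPareto α) :=
  integrable_id_map_mul (integrable_id_symmParetoLaw h1) _

/-- The probability laws `μ` evolve from the index `N` on as those of the Euler scheme with step
sizes `γ` and Pareto innovations, and `μ N` has a first moment. -/
structure IsEulerLaw (α : ℝ) (γ : ℕ → ℝ) (N : ℕ) (μ : ℕ → Measure ℝ) : Prop where
  isProbabilityMeasure : ∀ k, IsProbabilityMeasure (μ k)
  integrable : Integrable (fun x => x) (μ N)
  succ : ∀ k, N ≤ k → μ (k + 1) = ((μ k).map fun y => (1 - γ (k + 1)) * y)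
    ∗ ((unitPareto α).map fun z => γ (k + 1) ^ (1 / α) * z)

/-- Lindeberg's replacement argument: the Pareto innovations are exchanged one by one for stable
ones. -/
lemma IsEulerLaw.exists_abs_integral_sub_le {α θ w : ℝ} {γ : ℕ → ℝ} {N : ℕ} {μ : ℕ → Measure ℝ}
    {S : Measure ℝ} [IsProbabilityMeasure S] (hμ : IsEulerLaw α γ N μ) (h1 : 1 < α) (h2 : α < 2)
    (hS : ∀ u, charFun S u = ((Real.exp (-|u| ^ α) : ℝ) : ℂ)) (hθα : 1 + θ = 2 / α)
    (h : SlowSteps γ θ w N) (hw : w ≤ 1) :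
    ∃ K, ∀ m, N ≤ m → ∀ f, LipschitzWith 1 f → (∃ B, ∀ x, |f x| ≤ B) →
      |∫ x, f x ∂(μ (m + 1)) - ∫ x, f x ∂(stableAt α S (1 / α))| ≤ K * γ (m + 1) ^ θ := by
  have h0 : 0 < α := by linarith
  have hθ0 : 0 < θ := by
    have : 1 < 2 / α := by rw [lt_div_iff₀ h0]; linarith
    linarith
  have hθ1 : θ ≤ 1 / α := by
    have : 1 / α ≤ 1 := by rw [div_le_one h0]; linarith
    have e : 2 / α = 1 / α + 1 / α := by ring
    linarith
  have hα1 : 1 / α ≤ 1 := by rw [div_le_one h0]; linarith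
  have hα0 : 0 < 1 / α := by positivity
  have hθ1' : θ ≤ 1 := hθ1.trans hα1
  have hp := hμ.isProbabilityMeasure
  have := isProbabilityMeasure_unitPareto h0
  have hSi := integrable_id_stable h1 hS
  obtain ⟨C, hC0, hC⟩ := exists_zetaTwoLe_stable h1 h2 hS
  have hL := shiftLip_stable h1 h2 hS
  set L := 40 * α * paretoScale α
  have hL0 : 0 ≤ L := hL.nonneg
  set MS := ∫ y, |y| ∂S with hMS
  set Mρ := ∫ y, |y| ∂(unitPareto α) with hMρ
  set MN := ∫ y, |y| ∂(μ N) with hMN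
  have hMS0 : 0 ≤ MS := integral_nonneg fun y => abs_nonneg y
  have hMρ0 : 0 ≤ Mρ := integral_nonneg fun y => abs_nonneg y
  have hMN0 : 0 ≤ MN := integral_nonneg fun y => abs_nonneg y
  have hγN : 0 < γ N ^ θ := Real.rpow_pos_of_pos (h.pos N le_rfl) _
  set R := (1 + 2 ^ (1 / θ)) ^ (1 / α) / (1 - 1 / α) with hR
  set E := γ N ^ (1 - θ) / (α - 1) + (γ N ^ θ)⁻¹ with hE
  refine ⟨C * L * α ^ (1 / α) * R + (Mρ + MS) + (γ N ^ θ)⁻¹ * MN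
    + (1 / α) ^ (1 / α - 1) * E * MS, fun m hm f hf ⟨B, hB⟩ => ?_⟩
  set n := m + 1 with hn
  have hγn : 0 < γ n := h.pos n (by omega)
  have hγnθ : 0 < γ n ^ θ := Real.rpow_pos_of_pos hγn _
  -- the scheme with Pareto innovations up to the index `k`, and stable ones from there on
  set A : ℕ → ℝ := fun k => ∫ x, f x ∂(((μ k).map fun y => decay γ k n * y)
    ∗ stableAt α S (noiseTime α γ k n)) with hA
  have hnoise : ∀ k, N ≤ k → 0 ≤ noiseTime α γ k n := fun k hk => Finset.sum_nonneg fun j hj =>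
    mul_nonneg (h.pos j (hk.trans (Finset.mem_Ioc.1 hj).1.le)).le
      (Real.rpow_nonneg (h.decay_pos (hk.trans (Finset.mem_Ioc.1 hj).1.le) n).le _)
  have hAn : A n = ∫ x, f x ∂(μ n) := by
    simp only [hA, decay_self, noiseTime_self, one_mul, stableAt_zero h0, Measure.map_id',
      Measure.conv_dirac_zero]
  -- the terms on both sides of one exchange share the law `κ`
  have hstep : ∀ k, N ≤ k → k < n →
      ∃ κ : Measure ℝ, IsProbabilityMeasure κ ∧
        (k + 1 < n → ShiftLip (L * (noiseTime α γ (k + 1) n ^ (1 / α))⁻¹) κ) ∧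
        A (k + 1) = ∫ x, f x ∂(κ ∗ (unitPareto α).map
          fun z => decay γ (k + 1) n * γ (k + 1) ^ (1 / α) * z) ∧
        A k = ∫ x, f x ∂(κ ∗ S.map
          fun z => decay γ (k + 1) n * γ (k + 1) ^ (1 / α) * z) := by
    intro k hk hkn
    have hd := h.decay_pos (show N ≤ k + 1 by omega) n
    have hg := h.pos (k + 1) (by omega)
    have hm1 : ∀ c : ℝ, IsProbabilityMeasure ((μ k).map fun y => c * y) := fun c =>
      Measure.isProbabilityMeasure_map (by fun_prop)
    have hm2 : ∀ c : ℝ, IsProbabilityMeasure ((unitPareto α).map fun y => c * y) := fun c =>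
      Measure.isProbabilityMeasure_map (by fun_prop)
    have hm3 : ∀ c : ℝ, IsProbabilityMeasure (S.map fun y => c * y) := fun c =>
      Measure.isProbabilityMeasure_map (by fun_prop)
    refine ⟨((μ k).map fun y => decay γ k n * y) ∗ stableAt α S (noiseTime α γ (k + 1) n),
      inferInstance, fun hk2 => ?_, ?_, ?_⟩
    · have hs : 0 < noiseTime α γ (k + 1) n := by
        refine Finset.sum_pos (fun j hj => ?_) ⟨n, Finset.mem_Ioc.2 ⟨hk2, le_rfl⟩⟩
        have hj := Finset.mem_Ioc.1 hj
        exact mul_pos (h.pos j (by omega)) (Real.rpow_pos_of_pos (h.decay_pos (by omega) n) _)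
      have hs' : 0 < noiseTime α γ (k + 1) n ^ (1 / α) := Real.rpow_pos_of_pos hs _
      have e := (hL.map_mul hs'.ne').conv_right (ν := (μ k).map fun y => decay γ k n * y)
      rw [abs_of_pos hs', probReal_univ, mul_one] at e
      exact e
    · simp only [hA]
      rw [hμ.succ k hk, map_mul_conv, map_mul_map_mul, map_mul_map_mul, Measure.conv_assoc,
        Measure.conv_assoc, Measure.conv_comm (stableAt α S _), decay_eq_succ_left γ hkn,
        mul_comm (1 - γ (k + 1))]
    · simp only [hA]
      have e1 : S.map (fun z => decay γ (k + 1) n * γ (k + 1) ^ (1 / α) * z)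
          = stableAt α S (γ (k + 1) * decay γ (k + 1) n ^ α) := by
        rw [stableAt, Real.mul_rpow hg.le (Real.rpow_nonneg hd.le _), ← Real.rpow_mul hd.le,
          mul_one_div_cancel h0.ne', Real.rpow_one, mul_comm (decay γ (k + 1) n)]
      rw [e1, Measure.conv_assoc, stableAt_conv h0 hS (hnoise _ (by omega)) (by positivity),
        noiseTime_eq_succ_left α γ hkn, add_comm (γ (k + 1) * _)]
  have hmid : ∀ k ∈ Finset.Ico N m, dist (A k) (A (k + 1))
      ≤ C * L * α ^ (1 / α) * γ n ^ θ * (γ (k + 1) * decay γ (k + 1) n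
        * (1 - decay γ (k + 1) n) ^ (-(1 / α))) := by
    intro k hk
    have hk := Finset.mem_Ico.1 hk
    obtain ⟨κ, hκ, hκL, e1, e2⟩ := hstep k hk.1 (by omega)
    have hd := h.decay_pos (show N ≤ k + 1 by omega) n
    have hd1 : decay γ (k + 1) n < 1 := by
      rw [decay_eq_succ_left γ (show k + 1 < n by omega)]
      have e1 := h.decay_le_one (show N ≤ k + 1 + 1 by omega) n
      have e2 := h.le_half (k + 1 + 1) (by omega)
      have e3 := h.pos (k + 1 + 1) (by omega)
      nlinarith
    have hg := h.pos (k + 1) (by omega)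
    have hm2 : ∀ c : ℝ, IsProbabilityMeasure ((unitPareto α).map fun y => c * y) := fun c =>
      Measure.isProbabilityMeasure_map (by fun_prop)
    have hm3 : ∀ c : ℝ, IsProbabilityMeasure (S.map fun y => c * y) := fun c =>
      Measure.isProbabilityMeasure_map (by fun_prop)
    rw [dist_comm, Real.dist_eq, e1, e2]
    refine ((hC.map_mul _).abs_integral_conv_sub_le (hκL (by omega)) hf hB).trans ?_
    set p := decay γ (k + 1) n
    set g := γ (k + 1)
    have hnt : (1 - p) / α ≤ noiseTime α γ (k + 1) n := by
      have e3 := h.one_sub_decay_rpow_le h1.le (show N ≤ k + 1 by omega) (show k + 1 ≤ n by omega)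
      have e4 : p ^ α ≤ p := by
        simpa using Real.rpow_le_rpow_of_exponent_ge hd hd1.le h1.le
      rw [div_le_iff₀ h0]
      linarith
    have e5 : (noiseTime α γ (k + 1) n ^ (1 / α))⁻¹ ≤ α ^ (1 / α) * (1 - p) ^ (-(1 / α)) := by
      have hp0 : 0 < 1 - p := by linarith
      rw [Real.rpow_neg hp0.le, ← div_eq_mul_inv, ← inv_div ((1 - p) ^ (1 / α)),
        ← Real.div_rpow hp0.le h0.le]
      gcongr
    have e6 : (p * g ^ (1 / α)) ^ 2 ≤ γ n ^ θ * (g * p) := by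
      have e7 : (g ^ (1 / α)) ^ 2 = g * g ^ θ := by
        rw [← Real.rpow_natCast, ← Real.rpow_mul hg.le, ← Real.rpow_one_add' hg.le (by linarith),
          hθα]
        congr 1
        push_cast
        ring
      rw [mul_pow, e7]
      calc p ^ 2 * (g * g ^ θ) = (g ^ θ * p) * (g * p) := by ring
        _ ≤ γ n ^ θ * (g * p) := by
          refine mul_le_mul_of_nonneg_right
            (h.rpow_mul_decay_le hw (by omega) (by omega)) (by positivity)
    have e8 : 0 ≤ (noiseTime α γ (k + 1) n ^ (1 / α))⁻¹ :=
      inv_nonneg.2 (Real.rpow_nonneg (hnoise _ (by omega)) _)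
    calc (p * g ^ (1 / α)) ^ 2 * C * (L * (noiseTime α γ (k + 1) n ^ (1 / α))⁻¹)
        ≤ (γ n ^ θ * (g * p)) * C * (L * (α ^ (1 / α) * (1 - p) ^ (-(1 / α)))) := by gcongr
      _ = _ := by ring
  -- at the last step there is no smoothing left, and first moments suffice as `θ ≤ 1 / α`
  have hlast : dist (A m) (A n) ≤ (Mρ + MS) * γ n ^ θ := by
    obtain ⟨κ, hκ, -, e1, e2⟩ := hstep m hm (by omega)
    have hm2 : ∀ c : ℝ, IsProbabilityMeasure ((unitPareto α).map fun y => c * y) := fun c =>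
      Measure.isProbabilityMeasure_map (by fun_prop)
    have hm3 : ∀ c : ℝ, IsProbabilityMeasure (S.map fun y => c * y) := fun c =>
      Measure.isProbabilityMeasure_map (by fun_prop)
    set c := decay γ (m + 1) n * γ (m + 1) ^ (1 / α) with hc
    have hcn : c = γ n ^ (1 / α) := by rw [hc, ← hn, decay_self, one_mul]
    have hc0 : 0 ≤ c := by rw [hcn]; exact Real.rpow_nonneg hγn.le _
    have hcθ : c ≤ γ n ^ θ := by
      rw [hcn]
      refine Real.rpow_le_rpow_of_exponent_ge hγn ?_ hθ1
      have := h.le_half n (by omega)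
      linarith
    have e3 := abs_integral_conv_sub_le_integral_abs (κ := κ)
      (integrable_id_map_mul (integrable_id_unitPareto h1) c) hf hB
    have e4 := abs_integral_conv_sub_le_integral_abs (κ := κ) (integrable_id_map_mul hSi c) hf hB
    rw [integral_abs_map_mul, abs_of_nonneg hc0] at e3 e4
    rw [Real.dist_eq, e1, e2]
    have e5 : (Mρ + MS) * c ≤ (Mρ + MS) * γ n ^ θ := by gcongr
    rw [abs_le] at e3 e4 ⊢
    constructor <;> linarith [e3.1, e3.2, e4.1, e4.2]
  have hdecN : decay γ N n ≤ (γ N ^ θ)⁻¹ * γ n ^ θ := by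
    have := h.rpow_mul_decay_le hw le_rfl (show N ≤ n by omega)
    rw [inv_mul_eq_div, le_div_iff₀ hγN]
    linarith
  have hinit : |A N - ∫ x, f x ∂(stableAt α S (1 / α))|
      ≤ ((γ N ^ θ)⁻¹ * MN + (1 / α) ^ (1 / α - 1) * E * MS) * γ n ^ θ := by
    have hm1 : IsProbabilityMeasure ((μ N).map fun y => decay γ N n * y) :=
      Measure.isProbabilityMeasure_map (by fun_prop)
    have e1 := abs_integral_conv_sub_le_integral_abs (κ := stableAt α S (noiseTime α γ N n))
      (integrable_id_map_mul hμ.integrable (decay γ N n)) hf hB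
    have e2 := abs_integral_map_mul_sub_le hSi hf hB (noiseTime α γ N n ^ (1 / α))
      ((1 / α) ^ (1 / α))
    rw [Measure.conv_comm, integral_abs_map_mul, abs_of_pos (h.decay_pos le_rfl n)] at e1
    have e3 : decay γ N n * MN ≤ (γ N ^ θ)⁻¹ * γ n ^ θ * MN := by gcongr
    have e4 : |noiseTime α γ N n - 1 / α| ≤ E * γ n ^ θ := by
      have e5 := h.noiseTime_sub_inv_le h1 h2 hw hθ1' (show N ≤ n by omega)
      have e6 := h.one_sub_decay_rpow_le h1.le le_rfl (show N ≤ n by omega)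
      have e7 : decay γ N n ^ α ≤ decay γ N n := by
        simpa using Real.rpow_le_rpow_of_exponent_ge (h.decay_pos le_rfl n)
          (h.decay_le_one le_rfl n) h1.le
      have e8 : 1 / α - noiseTime α γ N n ≤ decay γ N n := by
        have e9 : (1 - decay γ N n) / α ≤ noiseTime α γ N n := by
          rw [div_le_iff₀ h0]
          linarith
        have e10 : decay γ N n / α ≤ decay γ N n := div_le_self (h.decay_pos le_rfl n).le h1.le
        rw [sub_div] at e9
        linarith
      have e11 : 0 ≤ γ N ^ (1 - θ) / (α - 1) :=
        div_nonneg (Real.rpow_nonneg (h.pos N le_rfl).le _) (by linarith)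
      have e12 : 0 ≤ γ N ^ (1 - θ) / (α - 1) * γ n ^ θ := by positivity
      have e13 : 0 ≤ (γ N ^ θ)⁻¹ * γ n ^ θ := by positivity
      rw [abs_le, hE, add_mul]
      constructor <;> linarith
    have e5 := abs_rpow_sub_rpow_le (hnoise N le_rfl) hα0 hα0.le hα1
    have e6 : |noiseTime α γ N n ^ (1 / α) - (1 / α) ^ (1 / α)| * MS
        ≤ (1 / α) ^ (1 / α - 1) * (E * γ n ^ θ) * MS := by
      gcongr
      exact e5.trans (by gcongr)
    have e7 := e2.trans e6
    calc _ ≤ |A N - ∫ x, f x ∂(stableAt α S (noiseTime α γ N n))|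
          + |∫ x, f x ∂(stableAt α S (noiseTime α γ N n)) - ∫ x, f x ∂(stableAt α S (1 / α))| :=
          abs_sub_le _ _ _
      _ ≤ (γ N ^ θ)⁻¹ * γ n ^ θ * MN + (1 / α) ^ (1 / α - 1) * (E * γ n ^ θ) * MS :=
          add_le_add (e1.trans e3) e7
      _ = _ := by ring
  have hsum : dist (A N) (A n) ≤ (C * L * α ^ (1 / α) * R + (Mρ + MS)) * γ n ^ θ := by
    refine (dist_le_Ico_sum_dist A (show N ≤ n by omega)).trans ?_
    rw [hn, Finset.sum_Ico_succ_top hm, ← hn, add_mul]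
    refine add_le_add ((Finset.sum_le_sum hmid).trans ?_) hlast
    rw [← Finset.mul_sum]
    have e := h.sum_mul_decay_mul_rpow_le hθ0 hw h1 hm
    calc _ ≤ C * L * α ^ (1 / α) * γ n ^ θ * R := by gcongr
      _ = _ := by ring
  rw [← hAn]
  rw [dist_comm, Real.dist_eq] at hsum
  calc _ ≤ |A n - A N| + |A N - ∫ x, f x ∂(stableAt α S (1 / α))| := abs_sub_le _ _ _
    _ ≤ _ := add_le_add hsum hinit
    _ = _ := by ring

/-! ### Separation of the characteristic functions -/

/-- Near the origin, the characteristic function of the unit Pareto law exceeds the stable one by a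
quadratic term. -/
lemma exists_exp_le_norm_charFun_unitPareto {α : ℝ} (h1 : 1 < α) (h2 : α < 2) :
    ∃ c δ : ℝ, 0 < c ∧ 0 < δ ∧ ∀ t, |t| ≤ δ →
      Real.exp (-|t| ^ α + c * t ^ 2) ≤ ‖charFun (unitPareto α) t‖ := by
  have h0 : 0 < α := by linarith
  obtain ⟨c₀, C, q, hc₀, -, hφ, -, hq⟩ := exists_charFun_unitPareto h0 h2
  have hβ := paretoScale_pos h0 h2
  have he : 0 < 2 * α - 2 := by linarith
  -- half of the quadratic term absorbs the second order term of the exponential, of order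
  -- `|t| ^ (2 * α) = o (t ^ 2)`
  refine ⟨min (c₀ / 2) 1, min (min 1 (paretoScale α)) ((c₀ / 2) ^ (1 / (2 * α - 2))),
    by positivity, by positivity, fun t ht => ?_⟩
  set c := min (c₀ / 2) 1
  have hc : 0 < c := by positivity
  have hc1 : c ≤ 1 := min_le_right _ _
  have hc2 : c ≤ c₀ / 2 := min_le_left _ _
  have ht1 : |t| ≤ 1 := ht.trans ((min_le_left _ _).trans (min_le_left _ _))
  have htβ : |t| ≤ paretoScale α := ht.trans ((min_le_left _ _).trans (min_le_right _ _))
  have htc : |t| ≤ (c₀ / 2) ^ (1 / (2 * α - 2)) := ht.trans (min_le_right _ _)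
  have hx0 : 0 ≤ |t| ^ α := by positivity
  have hx1 : |t| ^ α ≤ 1 := Real.rpow_le_one (abs_nonneg t) ht1 h0.le
  have hx2 : t ^ 2 ≤ |t| ^ α := by
    rw [← sq_abs, ← Real.rpow_natCast]
    refine Real.rpow_le_rpow_of_exponent_ge' (abs_nonneg t) ht1 h0.le ?_
    push_cast
    exact h2.le
  have hxx : (|t| ^ α) ^ 2 ≤ c₀ / 2 * t ^ 2 := by
    have e1 : (|t| ^ α) ^ 2 = |t| ^ (2 * α - 2) * t ^ 2 := by
      rw [← sq_abs t, ← Real.rpow_natCast, ← Real.rpow_natCast, ← Real.rpow_mul (abs_nonneg t),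
        ← Real.rpow_add' (abs_nonneg t) (by push_cast; linarith)]
      congr 1
      push_cast
      ring
    rw [e1]
    gcongr
    refine (Real.rpow_le_rpow (abs_nonneg t) htc he.le).trans (le_of_eq ?_)
    rw [← Real.rpow_mul (by positivity), one_div_mul_cancel he.ne', Real.rpow_one]
  have hqt := hq t htβ
  set x := |t| ^ α
  have ht2 : 0 ≤ t ^ 2 := sq_nonneg t
  have hy0 : 0 ≤ x - c * t ^ 2 := by nlinarith
  have hy1 : x - c * t ^ 2 ≤ x := by nlinarith
  have h := Real.abs_exp_sub_one_sub_id_le (x := -x + c * t ^ 2)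
    (by rw [abs_le]; constructor <;> linarith)
  have hsq : (-x + c * t ^ 2) ^ 2 ≤ x ^ 2 := by nlinarith
  rw [hφ, Complex.norm_real]
  refine le_trans ?_ (le_abs_self _)
  have h3 := (abs_le.1 h).2
  have h4 : c * t ^ 2 ≤ c₀ / 2 * t ^ 2 := by gcongr
  linarith

lemma one_sub_mul_le_norm_charFun {μ : Measure ℝ} [IsProbabilityMeasure μ]
    (hμ : Integrable (fun x => x) μ) (p : ℝ) :
    1 - |p| * ∫ y, |y| ∂μ ≤ ‖charFun μ p‖ := by
  have h : ‖charFun μ p - 1‖ ≤ |p| * ∫ y, |y| ∂μ := by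
    have hi : Integrable (fun y : ℝ => Complex.exp (p * y * Complex.I)) μ := by
      refine Integrable.of_bound (by fun_prop) 1 (Eventually.of_forall fun y => ?_)
      rw [← Complex.ofReal_mul, Complex.norm_exp_ofReal_mul_I]
    have e : (1 : ℂ) = ∫ _, (1 : ℂ) ∂μ := by simp
    rw [charFun_apply_real]
    conv_lhs => rw [e, ← integral_sub hi (integrable_const _)]
    rw [← integral_const_mul]
    refine (norm_integral_le_integral_norm _).trans (integral_mono_of_nonneg
      (Eventually.of_forall fun y => norm_nonneg _) (hμ.abs.const_mul _)
      (Eventually.of_forall fun y => ?_))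
    have := Real.norm_exp_I_mul_ofReal_sub_one_le (x := p * y)
    rw [Real.norm_eq_abs, abs_mul] at this
    simpa [mul_comm Complex.I] using this
  have h2 := norm_sub_norm_le (1 : ℂ) (charFun μ p)
  rw [norm_one, norm_sub_rev] at h2
  linarith

namespace IsEulerLaw

variable {α θ w : ℝ} {γ : ℕ → ℝ} {N : ℕ} {μ : ℕ → Measure ℝ}

lemma charFun_eq (hμ : IsEulerLaw α γ N μ) (h0 : 0 < α) {n : ℕ} (hn : N ≤ n) (u : ℝ) :
    charFun (μ n) u = charFun (μ N) (decay γ N n * u)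
      * ∏ k ∈ Finset.Ioc N n, charFun (unitPareto α) (decay γ k n * γ k ^ (1 / α) * u) := by
  induction n, hn using Nat.le_induction generalizing u with
  | base => simp
  | succ n hn ih =>
    have := hμ.isProbabilityMeasure n
    have := isProbabilityMeasure_unitPareto h0
    have : IsProbabilityMeasure ((μ n).map fun y => (1 - γ (n + 1)) * y) :=
      Measure.isProbabilityMeasure_map (by fun_prop)
    have : IsProbabilityMeasure ((unitPareto α).map fun y => γ (n + 1) ^ (1 / α) * y) :=
      Measure.isProbabilityMeasure_map (by fun_prop)
    rw [hμ.succ n hn, charFun_conv, charFun_map_mul, charFun_map_mul, ih,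
      Finset.prod_Ioc_succ_top hn, decay_self, one_mul, decay_succ_right γ hn, mul_assoc, mul_assoc]
    congr 2
    refine Finset.prod_congr rfl fun k hk => ?_
    rw [decay_succ_right γ (Finset.mem_Ioc.1 hk).2]
    congr 1
    ring

/-- The characteristic function at `1` of the scheme is larger than the stable one by an amount of
order `γ ^ θ`. -/
lemma exists_le_norm_charFun_sub (hμ : ∀ N, IsEulerLaw α γ N μ) (h1 : 1 < α) (h2 : α < 2)
    (hθα : 1 + θ = 2 / α) (h : ∀ᶠ N in atTop, SlowSteps γ θ w N) (hw : w < 1)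
    (hγ0 : Tendsto γ atTop (𝓝 0))
    (hsum : ∀ N, Tendsto (fun n => ∑ j ∈ Finset.Ioc N n, γ j) atTop atTop) :
    ∃ κ, 0 < κ ∧ ∀ᶠ n in atTop, κ * γ n ^ θ ≤ ‖charFun (μ n) 1‖ - Real.exp (-(1 / α)) := by
  have h0 : 0 < α := by linarith
  have hα0 : 0 < 1 / α := by positivity
  have hθ0 : 0 < θ := by
    have : 1 < 2 / α := by rw [lt_div_iff₀ h0]; linarith
    linarith
  have hθ1 : 0 < 1 - θ := by
    have : 2 / α < 2 := by rw [div_lt_iff₀ h0]; linarith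
    linarith
  obtain ⟨c, δ, hc, hδ, hcδ⟩ := exists_exp_le_norm_charFun_unitPareto h1 h2
  have hlim : ∀ b : ℝ, 0 < b → Tendsto (fun n => γ n ^ b) atTop (𝓝 0) := fun b hb => by
    have := hγ0.rpow_const (p := b) (Or.inr hb.le)
    rwa [Real.zero_rpow hb.ne'] at this
  have hα1 : 0 < α - 1 := by linarith
  -- `N` is so large that the drift costs at most half of the gain `c / 4` of the exponent
  obtain ⟨N, hN, hNδ, hNB⟩ := (h.and (((hlim (1 / α) hα0).eventually_le_const hδ).and
    ((hlim (1 - θ) hθ1).eventually_le_const (show 0 < c / 8 * (α - 1) by positivity)))).exists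
  have hp := (hμ N).isProbabilityMeasure
  set M := ∫ y, |y| ∂(μ N) with hM
  have hM0 : 0 ≤ M := integral_nonneg fun y => abs_nonneg y
  refine ⟨Real.exp (-(1 / α)) * (c / 16), by positivity, ?_⟩
  filter_upwards [eventually_ge_atTop N,
    hN.eventually_decay_le hw (hsum N) (show 0 < c / (32 * (M + 1)) by positivity),
    hN.eventually_decay_le hw (hsum N) one_pos,
    (hlim θ hθ0).eventually_le_const (show (0 : ℝ) < 1 / 2 by norm_num),
    (hlim θ hθ0).eventually_le_const (show 0 < 8 / c by positivity)] with n hn hd1 hd2 hg1 hg2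
  have hd0 := hN.decay_pos le_rfl n
  have hg0 : 0 < γ n ^ θ := Real.rpow_pos_of_pos (hN.pos n hn) _
  have hquad := hN.le_sum_rpow_mul_decay_sq hθ0.le hn
  have hnoise := hN.noiseTime_sub_inv_le h1 h2 hw.le (by linarith) hn
  have hfirst := one_sub_mul_le_norm_charFun (hμ N).integrable (decay γ N n)
  rw [abs_of_pos hd0, ← hM] at hfirst
  have hprod : Real.exp (-noiseTime α γ N n
        + c * ∑ k ∈ Finset.Ioc N n, γ k ^ (1 + θ) * decay γ k n ^ 2)
      ≤ ‖∏ k ∈ Finset.Ioc N n, charFun (unitPareto α) (decay γ k n * γ k ^ (1 / α))‖ := by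
    rw [norm_prod, noiseTime, Finset.mul_sum, ← Finset.sum_neg_distrib, ← Finset.sum_add_distrib,
      Real.exp_sum]
    refine Finset.prod_le_prod (fun k _ => (Real.exp_pos _).le) fun k hk => ?_
    have hk := Finset.mem_Ioc.1 hk
    have hkp := hN.pos k hk.1.le
    have hkd := hN.decay_pos hk.1.le n
    have hkd1 := hN.decay_le_one hk.1.le n
    have hkp' : 0 < γ k ^ (1 / α) := Real.rpow_pos_of_pos hkp _
    have habs : |decay γ k n * γ k ^ (1 / α)| = decay γ k n * γ k ^ (1 / α) :=
      abs_of_pos (by positivity)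
    refine le_trans (le_of_eq ?_) (hcδ _ ?_)
    · rw [habs, Real.mul_rpow hkd.le hkp'.le, ← Real.rpow_mul hkp.le, one_div_mul_cancel h0.ne',
        Real.rpow_one, mul_pow, ← Real.rpow_natCast (γ k ^ (1 / α)), ← Real.rpow_mul hkp.le, hθα]
      congr 1
      push_cast
      ring_nf
    · rw [habs]
      calc decay γ k n * γ k ^ (1 / α) ≤ 1 * γ N ^ (1 / α) := by
            gcongr
            exact hN.antitone le_rfl hk.1.le
        _ ≤ δ := by rwa [one_mul]
  have hchar := (hμ N).charFun_eq h0 hn 1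
  simp only [mul_one] at hchar
  rw [hchar, norm_mul]
  set g := γ n ^ θ
  set Q := ∑ k ∈ Finset.Ioc N n, γ k ^ (1 + θ) * decay γ k n ^ 2
  have hQ : g / 4 ≤ Q := by
    have : decay γ N n ≤ 1 / 2 := by linarith
    have : decay γ N n ^ 2 ≤ 1 / 2 := by nlinarith
    nlinarith
  have hB : γ N ^ (1 - θ) / (α - 1) ≤ c / 8 := by rwa [div_le_iff₀ hα1]
  have hexp : Real.exp (-(1 / α)) * (1 + c / 8 * g) ≤ Real.exp (-noiseTime α γ N n + c * Q) := by
    have e1 : γ N ^ (1 - θ) / (α - 1) * g ≤ c / 8 * g := by gcongr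
    have e2 : c * (g / 4) ≤ c * Q := by gcongr
    calc Real.exp (-(1 / α)) * (1 + c / 8 * g)
        ≤ Real.exp (-(1 / α)) * Real.exp (c / 8 * g) := by
          gcongr
          linarith [Real.add_one_le_exp (c / 8 * g)]
      _ = Real.exp (-(1 / α) + c / 8 * g) := (Real.exp_add _ _).symm
      _ ≤ _ := Real.exp_le_exp.2 (by linarith)
  have hdM : decay γ N n * M ≤ c * g / 32 := by
    calc decay γ N n * M ≤ c / (32 * (M + 1)) * g * (M + 1) := by
          gcongr
          linarith
      _ = c * g / 32 := by field_simp
  have hcg : c * g ≤ 8 := by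
    rw [le_div_iff₀ hc] at hg2
    linarith
  have hcg0 : 0 < c * g := by positivity
  have hge : (1 - c * g / 32) * (Real.exp (-(1 / α)) * (1 + c / 8 * g))
      ≤ ‖charFun (μ N) (decay γ N n)‖
        * ‖∏ k ∈ Finset.Ioc N n, charFun (unitPareto α) (decay γ k n * γ k ^ (1 / α))‖ :=
    mul_le_mul (by linarith) (hexp.trans hprod) (by positivity) (norm_nonneg _)
  -- a gain `c g / 8` of the exponent against a loss of at most `c g / 32` from the starting point
  have hnum : c * g / 16 ≤ (1 - c * g / 32) * (1 + c / 8 * g) - 1 := by nlinarith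
  have := mul_le_mul_of_nonneg_left hnum (Real.exp_pos (-(1 / α))).le
  linarith

end IsEulerLaw

/-! ### The sharp rate -/

lemma StepAssumption.exists_slowSteps {γ : ℕ → ℝ} {θ α : ℝ} (h : StepAssumption γ θ)
    (hω : stepOmega γ θ < ((min (rhoConst 1 α) 1 : ℝ) : EReal)) :
    ∃ w < 1, ∀ᶠ N in atTop, SlowSteps γ θ w N := by
  have hρ : rhoConst 1 α < 1 := by
    have h1 : Real.exp (-(2 : ℝ)) ≤ 1 := Real.exp_le_one_iff.2 (by norm_num)
    have h2 : rhoConst 1 α = 1 / 2 * Real.exp (-2) := by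
      norm_num [rhoConst, Real.rpow_neg_one]
    rw [h2]
    linarith [Real.exp_pos (-(2 : ℝ))]
  refine ⟨rhoConst 1 α, hρ, ?_⟩
  have hlt := eventually_lt_of_limsup_lt hω
  obtain ⟨N₀, hN₀⟩ := eventually_atTop.1
    (hlt.and ((h.tendsto_zero.eventually_le_const (show (0 : ℝ) < 1 / 2 by norm_num)).and
      (eventually_ge_atTop 1)))
  filter_upwards [eventually_ge_atTop N₀] with N hN
  refine ⟨fun k hk => h.pos k (hN₀ k (hN.trans hk)).2.2, fun k hk => (hN₀ k (hN.trans hk)).2.1,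
    fun k hk => h.decreasing k (hN₀ k (hN.trans hk)).2.2, fun k hk => ?_⟩
  have h1 := (hN₀ k (hN.trans hk)).1
  have hp := h.pos (k + 1) (by omega)
  have h2 := (EReal.coe_lt_coe_iff.1 h1).le.trans (min_le_left _ _)
  rw [div_le_iff₀ (Real.rpow_pos_of_pos hp _), Real.rpow_add hp, Real.rpow_one] at h2
  linarith

lemma StepAssumption.tendsto_sum_Ioc {γ : ℕ → ℝ} {θ : ℝ} (h : StepAssumption γ θ) (N : ℕ) :
    Tendsto (fun n => ∑ j ∈ Finset.Ioc N n, γ j) atTop atTop := by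
  refine (tendsto_atTop_add_const_right _ (-∑ j ∈ Finset.Ioc 0 N, γ j) h.sum_eq_infty).congr' ?_
  filter_upwards [eventually_ge_atTop N] with n hn
  have e : Finset.Icc 1 n = Finset.Ioc 0 n := by
    ext j
    simp only [Finset.mem_Icc, Finset.mem_Ioc]
    omega
  rw [e, ← Finset.sum_Ioc_consecutive γ (Nat.zero_le N) hn]
  ring

theorem mainTheorem4 (α : ℝ) (hα₁ : 1 < α) (hα₂ : α < 2)
    -- the stable Ornstein-Uhlenbeck process and its invariant measure
    {Ω : Type*} [MeasurableSpace Ω] (P : Measure Ω) [IsProbabilityMeasure P]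
    (Z : ℝ≥0 → Ω → ℝ) (hZ : IsSymmetricStableProcess α Z P)
    (X : ℝ → ℝ≥0 → Ω → ℝ) (hX : ∀ x, IsOUSolution Z P x (X x))
    (ν : Measure ℝ) (hν : IsInvariantLaw P X ν)
    -- the Pareto innovations
    {Ω' : Type*} [MeasurableSpace Ω'] (P' : Measure Ω') [IsProbabilityMeasure P']
    (ξ : ℕ → Ω' → ℝ) (hξ_indep : iIndepFun (fun n : ℕ => ξ (n + 1)) P')
    (hξ_law : ∀ n, 1 ≤ n → HasLaw (ξ n) (symmParetoLaw α) P')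
    -- the step sizes
    (γ : ℕ → ℝ) (hγ : StepAssumption γ ((2 - α) / α))
    (hω : stepOmega γ ((2 - α) / α) < ((min (rhoConst 1 α) 1 : ℝ) : EReal))
    (x : ℝ) :
    0 < liminf (fun n : ℕ =>
        wassersteinOne ν (P'.map (paretoEuler α γ ξ x n))
          / ENNReal.ofReal (γ n ^ (2 / α - 1))) atTop ∧
    liminf (fun n : ℕ =>
        wassersteinOne ν (P'.map (paretoEuler α γ ξ x n))
          / ENNReal.ofReal (γ n ^ (2 / α - 1))) atTop
      ≤ limsup (fun n : ℕ =>
        wassersteinOne ν (P'.map (paretoEuler α γ ξ x n))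
          / ENNReal.ofReal (γ n ^ (2 / α - 1))) atTop ∧
    limsup (fun n : ℕ =>
        wassersteinOne ν (P'.map (paretoEuler α γ ξ x n))
          / ENNReal.ofReal (γ n ^ (2 / α - 1))) atTop < ⊤ := by
  have h0 : 0 < α := by linarith
  have hθ : (2 - α) / α = 2 / α - 1 := by field_simp
  rw [hθ] at hγ hω
  set θ := 2 / α - 1 with hθd
  have hθα : 1 + θ = 2 / α := by rw [hθd]; ring
  have hνp := hν.isProbabilityMeasure
  have hSp : IsProbabilityMeasure (P.map fun ω => Z 1 ω - Z 0 ω) :=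
    Measure.isProbabilityMeasure_map ((hZ.aemeasurable 1).sub (hZ.aemeasurable 0))
  have hS : ∀ u, charFun (P.map fun ω => Z 1 ω - Z 0 ω) u
      = ((Real.exp (-|u| ^ α) : ℝ) : ℂ) := fun u => by
    rw [hZ.charFun_increment 0 1 zero_le_one]
    simp
  have hνc := charFun_invariantLaw hZ h0 hX hν
  set S := P.map fun ω => Z 1 ω - Z 0 ω
  have hνS : ν = stableAt α S (1 / α) := by
    refine Measure.ext_of_charFun (funext fun u => ?_)
    rw [hνc, charFun_stableAt h0 hS (by positivity), one_div_mul_eq_div]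
  set μ : ℕ → Measure ℝ := fun n => P'.map (paretoEuler α γ ξ x n) with hμd
  have hμp : ∀ n, IsProbabilityMeasure (μ n) := fun n =>
    Measure.isProbabilityMeasure_map (aemeasurable_paretoEuler γ x hξ_law n)
  have hμ : ∀ N, IsEulerLaw α γ N μ := fun N =>
    ⟨hμp, integrable_id_map_paretoEuler hα₁ γ x hξ_law N,
      fun k _ => map_paretoEuler_succ γ x hξ_indep hξ_law k⟩
  obtain ⟨w, hw, hslow⟩ := hγ.exists_slowSteps hω
  obtain ⟨κ, hκ, hlow⟩ := IsEulerLaw.exists_le_norm_charFun_sub hμ hα₁ hα₂ hθα hslow hw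
    hγ.tendsto_zero hγ.tendsto_sum_Ioc
  obtain ⟨N, hN⟩ := hslow.exists
  obtain ⟨K, hK⟩ := (hμ N).exists_abs_integral_sub_le hα₁ hα₂ hS hθα hN hw.le
  have hlower : ∀ᶠ n in atTop, ENNReal.ofReal κ
      ≤ wassersteinOne ν (μ n) / ENNReal.ofReal (γ n ^ θ) := by
    filter_upwards [hlow, eventually_ge_atTop 1] with n hn hn1
    have hg : 0 < γ n ^ θ := Real.rpow_pos_of_pos (hγ.pos n hn1) _
    rw [ENNReal.le_div_iff_mul_le (Or.inl (by simpa using hg)) (Or.inl ENNReal.ofReal_ne_top),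
      ← ENNReal.ofReal_mul hκ.le]
    have h1 := enorm_charFun_sub_le_wassersteinOne ν (μ n) 1
    rw [abs_one, ENNReal.ofReal_one, one_mul] at h1
    refine le_trans ?_ h1
    rw [← ofReal_norm]
    refine ENNReal.ofReal_le_ofReal (hn.trans ?_)
    have h2 := norm_sub_norm_le (charFun (μ n) 1) (charFun ν 1)
    rw [norm_sub_rev] at h2
    refine le_trans (le_of_eq ?_) h2
    rw [hνc, Complex.norm_real, Real.norm_of_nonneg (Real.exp_pos _).le, abs_one, Real.one_rpow]
  have hupper : ∀ᶠ n in atTop, wassersteinOne ν (μ n) / ENNReal.ofReal (γ n ^ θ)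
      ≤ ENNReal.ofReal K := by
    filter_upwards [eventually_ge_atTop (N + 1), eventually_ge_atTop 1] with n hn hn1
    have hg : 0 < γ n ^ θ := Real.rpow_pos_of_pos (hγ.pos n hn1) _
    refine ENNReal.div_le_of_le_mul ?_
    rw [← ENNReal.ofReal_mul' hg.le]
    refine wassersteinOne_le_of_forall_lipschitz ν (μ n) fun f hf hB => ?_
    obtain ⟨m, rfl⟩ : ∃ m, n = m + 1 := ⟨n - 1, by omega⟩
    have h1 := hK m (by omega) f hf hB
    rw [← hνS] at h1
    linarith [(abs_le.1 h1).1]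
  refine ⟨?_, liminf_le_limsup, ?_⟩
  · exact (ENNReal.ofReal_pos.2 hκ).trans_le (le_liminf_of_le (by isBoundedDefault) hlower)
  · exact (limsup_le_of_le (by isBoundedDefault) hupper).trans_lt ENNReal.ofReal_lt_top
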